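/- Let $d\ge 1$. Let $\sigma_0:\mathbb R\to\mathbb R$ be $2T$-periodic ($T>0$) and Hölder continuous of some order $\alpha>1/2$, with mean $m=\frac1{2T}\int_{-T}^{T}\sigma_0(s)\,ds$, and suppose that either (a) $\sigma_0\ge 0$, or (b) $m=\lim_{x\to\infty}\frac1x\int_0^x\sigma_0(s)\,ds\in(0,1)$. Set $\tilde m_0=\min\{2,m\}$ in case (a) and $\tilde m_0=m$ in case (b). Let $\eta\in C^2([0,\infty))$ satisfy $\eta(0)\ge 0$, $\eta'(t)>0$ and $\eta''(t)>0$ for all $t\ge0$. Put $$b(t)=\frac{\sigma_0(\eta(t))}{1+t},\qquad \mu(t)=\max_{0\le\tau\le t}\frac1{(1+\tau)\eta''(\tau)},\qquad \zeta(r)=\sqrt{\mu\big((\eta')^{-1}(r)\big)},$$ where $(\eta')^{-1}(r):=0$ for $r<\eta'(0)$, and $\zeta(r):=+\infty$ for $r\ge\sup\eta'$ (this occurs only if $\eta'$ is bounded). Then for every $\varepsilon>0$ there are constants $C,\nu>0$ such that for all $u_0\in H^1(\mathbb R^d)$, $u_1\in L^2(\mathbb R^d)$, the energy solution $u\in C([0,\infty);H^1)\cap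 C^1([0,\infty);L^2)$ of $$\partial_t^2u-\Delta u+b(t)\,\partial_tu=0,\qquad u(0)=u_0,\quad \partial_tu(0)=u_1$$ satisfies, for all $t\ge 0$, with $E(t)=\|\nabla u(t)\|_{L^2}^2+\|\partial_tu(t)\|_{L^2}^2$, $$E(t)\le C(1+t)^{-\tilde m_0}\int_{\mathbb R^d}\exp\Big(2\nu\,\zeta\big(\tfrac{T}{\pi}(2|\xi|+\varepsilon)\big)\Big)\Big((1+|\xi|^2)|\hat u_0(\xi)|^2+|\hat u_1(\xi)|^2\Big)\,d\xi,$$ where $\hat f(\xi)=(2\pi)^{-d/2}\int e^{-ix\cdot\xi}f(x)\,dx$ is the Fourier transform (extended to $L^2$), the right-hand side may be $+\infty$, and $\infty\cdot 0=0$ in the integrand. In particular, if $\sigma_0$ is $2\pi$-periodic ($T=\pi$), the weight is $\exp(2\nu\zeta(2|\xi|+\varepsilon))$. -/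

import Mathlib

open MeasureTheory Set Filter Topology
open scoped SchwartzMap Laplacian LineDeriv FourierTransform ENNReal NNReal

noncomputable section

namespace DissipativeWave

/-- `ℝ^d` with its Euclidean norm. -/
abbrev Space (d : ℕ) : Type := EuclideanSpace ℝ (Fin d)

/-- Complex-valued `L²(ℝ^d)`. -/
abbrev L2 (d : ℕ) : Type := Lp ℂ 2 (volume : Measure (Space d))

/-- An `L²` function viewed as a tempered distribution, `φ ↦ ∫ φ f`. -/
abbrev distrib {d : ℕ} (f : L2 d) : 𝓢'(Space d, ℂ) := Lp.toTemperedDistribution f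

/-- The Fourier transform on `L²(ℝ^d)` in the unitary angular-frequency normalization
`(2π)^(-d/2) ∫ exp(-i x·ξ) f(x) dx`, so that `-Δ` becomes multiplication by `‖ξ‖²` and Parseval's
identity holds without a factor. Mathlib's `𝓕` has the kernel `exp(-2πi x·ξ)`. -/
def hat {d : ℕ} (f : L2 d) (ξ : Space d) : ℂ :=
  (((2 * Real.pi) ^ (-(d : ℝ) / 2) : ℝ) : ℂ) * (𝓕 f : L2 d) ((2 * Real.pi)⁻¹ • ξ)

/-! ### The coefficient -/

/-- `σ₀` is periodic with period `2T` and Hölder continuous of some order `α > 1/2`. -/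
structure PeriodicHolder (σ₀ : ℝ → ℝ) (T : ℝ) : Prop where
  period_pos : 0 < T
  periodic : Function.Periodic σ₀ (2 * T)
  holder : ∃ K α : ℝ≥0, 1 / 2 < α ∧ HolderWith K α σ₀

/-- The non-negative dissipative condition `min σ₀ ≥ 0`. -/
def NonnegDissipative (σ₀ : ℝ → ℝ) : Prop := ∀ x : ℝ, 0 ≤ σ₀ x

/-- The non-effective dissipative condition: `(1/x) ∫_0^x σ₀` converges to a limit in `(0,1)`
as `x → ∞`. -/
def NonEffectiveDissipative (σ₀ : ℝ → ℝ) : Prop :=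
  ∃ m ∈ Ioo (0 : ℝ) 1, Tendsto (fun x : ℝ => (1 / x) * ∫ s in (0 : ℝ)..x, σ₀ s) atTop (𝓝 m)

/-- The mean value `m = (1/(2T)) ∫_{-T}^{T} σ₀`. -/
def mean (σ₀ : ℝ → ℝ) (T : ℝ) : ℝ := (1 / (2 * T)) * ∫ s in (-T)..T, σ₀ s

open Classical in
/-- The decay exponent: `min {2, m}` under the non-negative condition, and `m` otherwise. -/
def decayExponent (σ₀ : ℝ → ℝ) (T : ℝ) : ℝ :=
  if NonnegDissipative σ₀ then min 2 (mean σ₀ T) else mean σ₀ T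

/-- `η'` on `[0,∞)`, one-sided at `0`. -/
def d1 (η : ℝ → ℝ) (t : ℝ) : ℝ := derivWithin η (Ici 0) t

/-- `η''` on `[0,∞)`, one-sided at `0`. -/
def d2 (η : ℝ → ℝ) (t : ℝ) : ℝ := derivWithin (d1 η) (Ici 0) t

/-- `η ∈ C²([0,∞))`, `η(0) ≥ 0`, `η' > 0` and `η'' > 0` on `[0,∞)`. -/
structure AdmissiblePhase (η : ℝ → ℝ) : Prop where
  contDiffOn : ContDiffOn ℝ 2 η (Ici 0)
  zero_nonneg : 0 ≤ η 0
  d1_pos : ∀ t : ℝ, 0 ≤ t → 0 < d1 η t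
  d2_pos : ∀ t : ℝ, 0 ≤ t → 0 < d2 η t

/-- `μ(t) = max_{0 ≤ τ ≤ t} 1 / ((1+τ) η''(τ))`. -/
def mu (η : ℝ → ℝ) (t : ℝ) : ℝ := sSup ((fun τ : ℝ => 1 / ((1 + τ) * d2 η τ)) '' Icc 0 t)

open Classical in
/-- `ζ(r) = √(μ((η')⁻¹(r)))` for `r` in the range of `η'` on `[0,∞)`. Below this range `(η')⁻¹(r)`
is read as `0`; above it (which occurs only if `η'` is bounded) `ζ(r) = +∞`. -/
def zeta (η : ℝ → ℝ) (r : ℝ) : EReal :=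
  if r < d1 η 0 then ((Real.sqrt (mu η 0) : ℝ) : EReal)
  else if r ∈ d1 η '' Ici 0 then
    ((Real.sqrt (mu η (Function.invFunOn (d1 η) (Ici 0) r)) : ℝ) : EReal)
  else ⊤

/-- The dissipation `b(t) = σ₀(η(t)) / (1+t)`. -/
def dissipation (σ₀ η : ℝ → ℝ) (t : ℝ) : ℝ := σ₀ (η t) / (1 + t)

/-! ### Solutions and energy -/

/-- `u` is the energy solution on `[0,∞) × ℝ^d` of `∂ₜ² u - Δ u + b(t) ∂ₜ u = 0` with data
`u(0) = u₀`, `∂ₜ u(0) = u₁`, where `∇u = g` and `∂ₜ u = w`. Thus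
`u ∈ C([0,∞); H¹) ∩ C¹([0,∞); L²)`, and the equation holds in the sense of distributions. -/
structure IsEnergySolution {d : ℕ} (b : ℝ → ℝ) (u₀ u₁ : L2 d)
    (u : ℝ → L2 d) (g : ℝ → Fin d → L2 d) (w : ℝ → L2 d) : Prop where
  gradient : ∀ t : ℝ, 0 ≤ t → ∀ j : Fin d,
    ∂_{(EuclideanSpace.single j (1 : ℝ) : Space d)} (distrib (u t)) = distrib (g t j)
  gradient_continuousOn : ∀ j : Fin d, ContinuousOn (fun t => g t j) (Ici 0)
  velocity : ∀ t : ℝ, 0 ≤ t → HasDerivWithinAt u (w t) (Ici 0) t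
  velocity_continuousOn : ContinuousOn w (Ici 0)
  equation : ∀ φ : 𝓢(Space d, ℂ), ∀ t : ℝ, 0 < t →
    HasDerivAt (fun s => distrib (w s) φ)
      ((Δ (distrib (u t))) φ - (b t : ℂ) * distrib (w t) φ) t
  initial_position : u 0 = u₀
  initial_velocity : w 0 = u₁

/-- `E(t) = ‖∇u(t)‖² + ‖∂ₜ u(t)‖²`, from the gradient `g` and the time derivative `w` of `u`. -/
def energy {d : ℕ} (g : ℝ → Fin d → L2 d) (w : ℝ → L2 d) (t : ℝ) : ℝ :=
  (∑ j, ‖g t j‖ ^ 2) + ‖w t‖ ^ 2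

end DissipativeWave

end

/-!
Friction is oscillating here: `b(t) = σ₀(η(t)) / (1 + t)`, and only its mean `m / (1 + t)`
produces decay. The oscillations harm a solution of frequency `p` only while they are resonant
with it.

*One frequency.* For `U'' + p² U + b U' = 0` the energy `E = ‖U'‖² + p²‖U‖²` and the complex
quantity `P = ‖U'‖² - p²‖U‖² + 2ip Re ⟨U, U'⟩` form a closed linear system (`EnergyPair`), in
which `P` rotates with frequency `2p` and `E' = -b E - b Re P`. The first term on the right gives
the decay `exp (-∫ b) ≈ (1 + t)^(-m)`, as `η` is increasing and convex
(`exists_primitive_dissipation`). In the second term `σ₀` is replaced by its Fourier series, which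
converges absolutely because `σ₀` is Hölder continuous of order greater than `1/2`
(`summable_fourierCoeff_of_holder`). The `k`-th mode of `b P` then has the phase velocity `x_k = k
(π/T) η' + 2p`, so it is removed by a corrector of the energy with the factor `1 / x_k`. Near a
resonance `x_k = 0` this is replaced by `x_k / (x_k² + l²)`. The window `|x_k| ≲ l` is passed at
the speed `|k| (π/T) η''`, and `1 / (1 + t) ≤ μ η''`; hence `l = 1 / √μ` makes the total error of
the `k`-th mode, measured by the variation of `arctan (x_k / l)`, of order `√μ`, uniformly in `k`
(`EnergyPair.hyperbolic_le`, `EnergyPair.resonant_le`). Once `(π/T) η' ≥ 2p + ε` no mode is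
resonant any more and the loss is bounded (`EnergyPair.nonresonant_le`). This explains the weight
`exp (2ν ζ((T/π)(2p + ε)))`, and the corrected energy controls `E` as soon as `1 + t ≳ 1/p + 1 +
√μ`. For `(1 + t) p ≲ 1` friction dominates and `U'` is estimated directly by variation of
constants, which gives the decay rate `min 2 m` (`ShellSolution.elliptic_le`). Between these two
ranges `1 + t` grows by a factor of order `1 + √μ` only, and the trivial energy estimate costs a
power of it, which the exponential absorbs (`exists_shell_energy_le`).

*All frequencies.* A solution with values in `L²` has no pointwise equation at a given frequency,
so the Fourier transform of the solution is cut into shells `p - θ ≤ |ξ| ≤ p`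
(`IsEnergySolution.exists_shellSolution`). On a shell it solves the equation for the single
frequency `p` in the Hilbert space `L²`, up to an error of relative size `θ`. The estimates above
hold with such errors as long as `θ t ≲ 1`, with constants independent of `θ`. For each fixed `t`
the shells are chosen thin enough, and the estimates are summed
(`IsEnergySolution.energy_le_of_shells`).

If `m = 0`, which the hypotheses allow only for `σ₀ ≥ 0`, there is no decay to prove, and the
energy does not increase.
-/

namespace DissipativeWave

/-! ### Gronwall-type estimates for the energy of one frequency -/

/-- Gronwall's inequality with the exponent given by its primitive `g`. -/
lemma le_mul_exp_of_deriv_le {f g f' g' : ℝ → ℝ} {a b : ℝ} (hab : a ≤ b)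
    (hf : ContinuousOn f (Icc a b)) (hg : ContinuousOn g (Icc a b))
    (hf' : ∀ t ∈ Ioo a b, HasDerivAt f (f' t) t) (hg' : ∀ t ∈ Ioo a b, HasDerivAt g (g' t) t)
    (h : ∀ t ∈ Ioo a b, f' t ≤ g' t * f t) : f b ≤ f a * Real.exp (g b - g a) := by
  have hanti : AntitoneOn (fun t => f t * Real.exp (-g t)) (Icc a b) := by
    refine antitoneOn_of_hasDerivWithinAt_nonpos (convex_Icc a b)
      (f' := fun t => f' t * Real.exp (-g t) + f t * (Real.exp (-g t) * -g' t))
      (hf.mul (Real.continuous_exp.comp_continuousOn hg.neg)) ?_ ?_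
    · intro t ht
      rw [interior_Icc] at ht
      exact ((hf' t ht).mul (hg' t ht).neg.exp).hasDerivWithinAt
    · intro t ht
      rw [interior_Icc] at ht
      have h1 := h t ht
      have h2 := Real.exp_pos (-g t)
      have : f' t * Real.exp (-g t) + f t * (Real.exp (-g t) * -g' t)
          = (f' t - g' t * f t) * Real.exp (-g t) := by ring
      rw [this]
      exact mul_nonpos_of_nonpos_of_nonneg (by linarith) h2.le
  have h1 := hanti (left_mem_Icc.2 hab) (right_mem_Icc.2 hab) hab
  simp only at h1
  have h2 := mul_le_mul_of_nonneg_right h1 (Real.exp_pos (g b)).le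
  rw [mul_assoc, ← Real.exp_add, neg_add_cancel, Real.exp_zero, mul_one, mul_assoc,
    ← Real.exp_add] at h2
  rwa [show g b - g a = -g a + g b by ring]

/-- A differentiable function whose derivative is dominated by that of `g` grows at most as `g`. -/
lemma sub_le_sub_of_deriv_le {f g f' g' : ℝ → ℝ} {a b : ℝ} (hab : a ≤ b)
    (hf : ContinuousOn f (Icc a b)) (hg : ContinuousOn g (Icc a b))
    (hf' : ∀ t ∈ Ioo a b, HasDerivAt f (f' t) t) (hg' : ∀ t ∈ Ioo a b, HasDerivAt g (g' t) t)
    (h : ∀ t ∈ Ioo a b, f' t ≤ g' t) : f b - f a ≤ g b - g a := by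
  have hmono : MonotoneOn (fun t => g t - f t) (Icc a b) := by
    refine monotoneOn_of_hasDerivWithinAt_nonneg (convex_Icc a b)
      (f' := fun t => g' t - f' t) (hg.sub hf) ?_ ?_
    · intro t ht
      rw [interior_Icc] at ht
      exact ((hg' t ht).sub (hf' t ht)).hasDerivWithinAt
    · intro t ht
      rw [interior_Icc] at ht
      exact sub_nonneg.2 (h t ht)
  have h1 := hmono (left_mem_Icc.2 hab) (right_mem_Icc.2 hab) hab
  simp only at h1
  linarith

/-- The quadratic quantities of a solution of `U'' + p² U + b U' = 0` that enter the energy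
estimates: `E = ‖U'‖² + p²‖U‖²` and `P = (‖U'‖² - p²‖U‖²) + 2ip Re ⟨U, U'⟩`. They satisfy the closed
linear system `E' = -bE - b Re P`, `P' = -bP + 2ipP - bE`, here up to errors of size `ρ E`. -/
structure EnergyPair (b : ℝ → ℝ) (p ρ : ℝ) (E : ℝ → ℝ) (P : ℝ → ℂ) : Prop where
  continuousOn_fst : ContinuousOn E (Ici 0)
  continuousOn_snd : ContinuousOn P (Ici 0)
  norm_le : ∀ t, 0 ≤ t → ‖P t‖ ≤ E t
  deriv_fst : ∀ t, 0 < t → ∃ e : ℝ, |e| ≤ ρ * E t ∧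
    HasDerivAt E (-(b t) * E t - b t * (P t).re + e) t
  deriv_snd : ∀ t, 0 < t → ∃ e : ℂ, ‖e‖ ≤ ρ * E t ∧
    HasDerivAt P (-(b t : ℂ) * P t + 2 * Complex.I * p * P t - b t * E t + e) t

namespace EnergyPair

variable {b : ℝ → ℝ} {p ρ : ℝ} {E : ℝ → ℝ} {P : ℝ → ℂ}

lemma nonneg (h : EnergyPair b p ρ E P) {t : ℝ} (ht : 0 ≤ t) : 0 ≤ E t :=
  (norm_nonneg _).trans (h.norm_le t ht)

/-- Without using oscillations, the energy grows at most at the rate `2|b|`. -/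
lemma le_mul_exp (h : EnergyPair b p ρ E P) {G G' : ℝ → ℝ} {s t : ℝ} (hs : 0 ≤ s) (hst : s ≤ t)
    (hG : ContinuousOn G (Icc s t)) (hG' : ∀ r ∈ Ioo s t, HasDerivAt G (G' r) r)
    (hb : ∀ r ∈ Ioo s t, 2 * |b r| + ρ ≤ G' r) : E t ≤ E s * Real.exp (G t - G s) := by
  have hsub : Icc s t ⊆ Ici 0 := fun r hr => hs.trans hr.1
  have hd : ∀ r, ∃ e : ℝ, r ∈ Ioo s t → |e| ≤ ρ * E r ∧
      HasDerivAt E (-(b r) * E r - b r * (P r).re + e) r := by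
    intro r
    by_cases hr : r ∈ Ioo s t
    · obtain ⟨e, he⟩ := h.deriv_fst r (hs.trans_lt hr.1)
      exact ⟨e, fun _ => he⟩
    · exact ⟨0, fun h => absurd h hr⟩
  choose e he using hd
  refine le_mul_exp_of_deriv_le hst (h.continuousOn_fst.mono hsub) hG
    (fun r hr => (he r hr).2) hG' fun r hr => ?_
  have hr0 : 0 ≤ r := hs.trans hr.1.le
  have hE := h.nonneg hr0
  have h1 : |(P r).re| ≤ E r := (Complex.abs_re_le_norm _).trans (h.norm_le r hr0)
  have h2 : -(b r * (P r).re) ≤ |b r| * E r := by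
    calc -(b r * (P r).re) ≤ |b r * (P r).re| := neg_le_abs _
      _ = |b r| * |(P r).re| := abs_mul _ _
      _ ≤ _ := by gcongr
  have h3 : -(b r) * E r ≤ |b r| * E r := by gcongr; exact neg_le_abs _
  have h4 := (le_abs_self _).trans (he r hr).1
  have h5 := mul_le_mul_of_nonneg_right (hb r hr) hE
  linarith

/-- If the dissipation is non-negative, the energy does not increase, up to the error. -/
lemma le_mul_exp_of_nonneg (h : EnergyPair b p ρ E P) (hb : ∀ t, 0 ≤ t → 0 ≤ b t)
    {t : ℝ} (ht : 0 ≤ t) : E t ≤ E 0 * Real.exp (ρ * t) := by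
  have hd : ∀ r, ∃ e : ℝ, r ∈ Ioo 0 t → |e| ≤ ρ * E r ∧
      HasDerivAt E (-(b r) * E r - b r * (P r).re + e) r := by
    intro r
    by_cases hr : r ∈ Ioo 0 t
    · obtain ⟨e, he⟩ := h.deriv_fst r hr.1
      exact ⟨e, fun _ => he⟩
    · exact ⟨0, fun h => absurd h hr⟩
  choose e he using hd
  have key := le_mul_exp_of_deriv_le ht (h.continuousOn_fst.mono fun r hr => hr.1)
    (g := fun t => ρ * t) (g' := fun _ => ρ) (by fun_prop) (fun r hr => (he r hr).2)
    (fun r _ => by simpa using (hasDerivAt_id r).const_mul ρ) fun r hr => by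
      have h1 : -(P r).re ≤ E r :=
        (neg_le_abs _).trans ((Complex.abs_re_le_norm _).trans (h.norm_le r hr.1.le))
      have h2 := mul_le_mul_of_nonneg_left h1 (hb r hr.1.le)
      have h4 := (le_abs_self _).trans (he r hr).1
      linarith
  simpa using key

/-- The oscillating terms of the energy identity are removed by adding `Re (N P)` to the energy,
where `N` solves `N' + 2ipN = b` approximately; the remaining growth is measured by `D`. -/
lemma mul_exp_le_of_corrector (h : EnergyPair b p ρ E P) (hρ : 0 ≤ ρ) {B D D' : ℝ → ℝ}
    {N N' : ℝ → ℂ} {s t : ℝ} (hs : 0 ≤ s) (hst : s ≤ t)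
    (hB : ContinuousOn B (Icc s t)) (hB' : ∀ r ∈ Ioo s t, HasDerivAt B (b r) r)
    (hD : ContinuousOn D (Icc s t)) (hD' : ∀ r ∈ Ioo s t, HasDerivAt D (D' r) r)
    (hN : ContinuousOn N (Icc s t)) (hN' : ∀ r ∈ Ioo s t, HasDerivAt N (N' r) r)
    (hsmall : ∀ r ∈ Icc s t, ‖N r‖ ≤ 1 / 2)
    (herr : ∀ r ∈ Ioo s t,
      2 * (‖N' r + 2 * Complex.I * p * N r - b r‖ + |b r| * ‖N r‖ + 2 * ρ) ≤ D' r) :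
    E t * Real.exp (B t) ≤ 3 * (E s * Real.exp (B s)) * Real.exp (D t - D s) := by
  have hsub : Icc s t ⊆ Ici 0 := fun r hr => hs.trans hr.1
  have hd : ∀ r, ∃ e : ℝ, r ∈ Ioo s t → |e| ≤ ρ * E r ∧
      HasDerivAt E (-(b r) * E r - b r * (P r).re + e) r := by
    intro r
    by_cases hr : r ∈ Ioo s t
    · obtain ⟨e, he⟩ := h.deriv_fst r (hs.trans_lt hr.1)
      exact ⟨e, fun _ => he⟩
    · exact ⟨0, fun h => absurd h hr⟩
  have hd2 : ∀ r, ∃ e : ℂ, r ∈ Ioo s t → ‖e‖ ≤ ρ * E r ∧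
      HasDerivAt P (-(b r : ℂ) * P r + 2 * Complex.I * p * P r - b r * E r + e) r := by
    intro r
    by_cases hr : r ∈ Ioo s t
    · obtain ⟨e, he⟩ := h.deriv_snd r (hs.trans_lt hr.1)
      exact ⟨e, fun _ => he⟩
    · exact ⟨0, fun h => absurd h hr⟩
  choose e he using hd
  choose e2 he2 using hd2
  have hNP : ∀ r ∈ Icc s t, |(N r * P r).re| ≤ E r / 2 := fun r hr => by
    calc |(N r * P r).re| ≤ ‖N r * P r‖ := Complex.abs_re_le_norm _
      _ = ‖N r‖ * ‖P r‖ := norm_mul _ _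
      _ ≤ 1 / 2 * E r := by
        gcongr
        · exact hsmall r hr
        · exact h.norm_le r (hsub hr)
      _ = E r / 2 := by ring
  have key := le_mul_exp_of_deriv_le hst (f := fun r => E r + (N r * P r).re)
    (g := fun r => D r - B r) (g' := fun r => D' r - b r)
    (f' := fun r => (-(b r) * E r - b r * (P r).re + e r) + (N' r * P r + N r *
      (-(b r : ℂ) * P r + 2 * Complex.I * p * P r - b r * E r + e2 r)).re)
    ((h.continuousOn_fst.mono hsub).add (Complex.continuous_re.comp_continuousOn
      (hN.mul (h.continuousOn_snd.mono hsub)))) (hD.sub hB)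
    (fun r hr => (he r hr).2.add (Complex.reCLM.hasFDerivAt.comp_hasDerivAt r
      ((hN' r hr).mul (he2 r hr).2))) (fun r hr => (hD' r hr).sub (hB' r hr)) ?_
  · have hs1 := abs_le.1 (hNP s (left_mem_Icc.2 hst))
    have ht1 := abs_le.1 (hNP t (right_mem_Icc.2 hst))
    have h1 : E t / 2 ≤ 3 / 2 * E s * Real.exp (D t - B t - (D s - B s)) := by
      refine (by linarith : E t / 2 ≤ _).trans (key.trans ?_)
      gcongr
      linarith
    have h2 := mul_le_mul_of_nonneg_right h1 (Real.exp_pos (B t)).le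
    have h3 : Real.exp (D t - B t - (D s - B s)) * Real.exp (B t)
        = Real.exp (B s) * Real.exp (D t - D s) := by
      rw [← Real.exp_add, ← Real.exp_add]; congr 1; ring
    calc E t * Real.exp (B t) = 2 * (E t / 2 * Real.exp (B t)) := by ring
      _ ≤ 2 * (3 / 2 * E s * Real.exp (D t - B t - (D s - B s)) * Real.exp (B t)) := by gcongr
      _ = 3 * E s * (Real.exp (D t - B t - (D s - B s)) * Real.exp (B t)) := by ring
      _ = _ := by rw [h3]; ring
  · intro r hr
    have hr' := Ioo_subset_Icc_self hr
    have hE := h.nonneg (hsub hr')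
    have hP := h.norm_le r (hsub hr')
    have hid : (-(b r) * E r - b r * (P r).re + e r) + (N' r * P r + N r *
        (-(b r : ℂ) * P r + 2 * Complex.I * p * P r - b r * E r + e2 r)).re
        = -(b r) * (E r + (N r * P r).re) + ((N' r + 2 * Complex.I * p * N r - b r) * P r).re
          + (-(b r) * E r * (N r).re) + e r + (N r * e2 r).re := by
      simp only [Complex.add_re, Complex.mul_re, Complex.sub_re, Complex.neg_re, Complex.ofReal_re,
        Complex.ofReal_im, Complex.neg_im, Complex.add_im, Complex.mul_im, Complex.sub_im,
        Complex.I_re, Complex.I_im, Complex.re_ofNat, Complex.im_ofNat]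
      ring
    rw [hid]
    have t1 : ((N' r + 2 * Complex.I * p * N r - b r) * P r).re
        ≤ ‖N' r + 2 * Complex.I * p * N r - b r‖ * E r := by
      refine (Complex.re_le_norm _).trans ?_
      rw [norm_mul]; gcongr
    have t2 : -(b r) * E r * (N r).re ≤ |b r| * ‖N r‖ * E r := by
      calc -(b r) * E r * (N r).re ≤ |(-(b r) * E r * (N r).re)| := le_abs_self _
        _ = |b r| * E r * |(N r).re| := by rw [abs_mul, abs_mul, abs_neg, abs_of_nonneg hE]
        _ ≤ |b r| * E r * ‖N r‖ := by gcongr; exact Complex.abs_re_le_norm _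
        _ = _ := by ring
    have t3 : e r ≤ ρ * E r := (le_abs_self _).trans (he r hr).1
    have t4 : (N r * e2 r).re ≤ ρ * E r := by
      refine (Complex.re_le_norm _).trans ?_
      rw [norm_mul]
      calc ‖N r‖ * ‖e2 r‖ ≤ 1 / 2 * (ρ * E r) := by
            gcongr
            · exact hsmall r hr'
            · exact (he2 r hr).1
        _ ≤ ρ * E r := by linarith [mul_nonneg hρ hE]
    have hF := abs_le.1 (hNP r hr')
    have hD0 := herr r hr
    have hD1 : 0 ≤ D' r := le_trans (by positivity) hD0
    have t5 : D' r * (E r / 2) ≤ D' r * (E r + (N r * P r).re) := by gcongr; linarith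
    have t6 := mul_le_mul_of_nonneg_right hD0 (by positivity : 0 ≤ E r / 2)
    linarith

end EnergyPair

/-! ### Absolutely convergent Fourier series -/

section Fourier

variable {L : ℝ} [hL : Fact (0 < L)]

lemma fourierCoeff_comp_add_right (F : C(AddCircle L, ℂ)) (h : AddCircle L) (n : ℤ) :
    fourierCoeff (fun x => F (x + h)) n = fourier n h * fourierCoeff F n := by
  have key : ∀ x : AddCircle L, fourier (-n) x • F (x + h)
      = (fun y => fourier n h * (fourier (-n) y • F y)) (x + h) := by
    intro x
    have h1 : (fourier (-n) (x + h) : ℂ) = fourier (-n) x * fourier (-n) h := by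
      simp only [fourier_apply, smul_add, AddCircle.toCircle_add, Circle.coe_mul]
    have h2 : (fourier n h : ℂ) * fourier (-n) h = 1 := by
      rw [← fourier_add, add_neg_cancel, fourier_zero]
    simp only [smul_eq_mul]
    rw [h1]
    linear_combination (-(fourier (-n) x : ℂ) * F (x + h)) * h2
  rw [fourierCoeff, fourierCoeff, ← integral_const_mul, integral_congr_ae (ae_of_all _ key)]
  exact integral_add_right_eq_self (fun y => fourier n h * (fourier (-n) y • F y)) h

/-- Parseval's identity for an increment of `F`. -/
lemma sum_sq_fourierCoeff_increment_le (F : C(AddCircle L, ℂ)) (h : AddCircle L) {M : ℝ}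
    (hM : ∀ x, ‖F (x + h) - F x‖ ≤ M) (v : Finset ℤ) :
    ∑ n ∈ v, ‖(fourier n h : ℂ) - 1‖ ^ 2 * ‖fourierCoeff F n‖ ^ 2 ≤ M ^ 2 := by
  have hM0 : 0 ≤ M := (norm_nonneg _).trans (hM 0)
  let G : C(AddCircle L, ℂ) := ⟨fun x => F (x + h) - F x, by fun_prop⟩
  have hc : ∀ n, fourierCoeff G n = ((fourier n h : ℂ) - 1) * fourierCoeff F n := by
    intro n
    have h1 : fourierCoeff G n = fourierCoeff (fun x => F (x + h)) n - fourierCoeff F n := by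
      unfold fourierCoeff
      rw [← integral_sub]
      · simp [G, mul_sub]
      · exact Continuous.integrable_of_hasCompactSupport (by fun_prop)
          (HasCompactSupport.of_compactSpace _)
      · exact Continuous.integrable_of_hasCompactSupport (by fun_prop)
          (HasCompactSupport.of_compactSpace _)
    rw [h1, fourierCoeff_comp_add_right]; ring
  have hs := hasSum_sq_fourierCoeff (ContinuousMap.toLp (E := ℂ) 2 AddCircle.haarAddCircle ℂ G)
  simp only [fourierCoeff_toLp] at hs
  have h2 := sum_le_hasSum v (fun n _ => by positivity) hs
  simp only [hc, norm_mul, mul_pow] at h2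
  refine h2.trans ?_
  have h3 : ∫ t : AddCircle L, ‖(ContinuousMap.toLp (E := ℂ) 2 AddCircle.haarAddCircle ℂ G) t‖ ^ 2
      ∂AddCircle.haarAddCircle ≤ ∫ _ : AddCircle L, M ^ 2 ∂AddCircle.haarAddCircle := by
    refine integral_mono_of_nonneg (ae_of_all _ fun _ => by positivity) (integrable_const _) ?_
    filter_upwards [ContinuousMap.coeFn_toLp (p := 2) (𝕜 := ℂ) AddCircle.haarAddCircle G] with x hx
    rw [hx]
    exact pow_le_pow_left₀ (norm_nonneg _) (hM x) 2
  simpa using h3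

/-- On the dyadic block of frequencies `2^j ≤ |n| < 2^(j+1)`, the translation by `L / 2^(j+2)`
rotates every mode by at least a quarter turn. -/
lemma two_le_norm_fourier_sub_one_sq {n : ℤ} (hn : n ≠ 0) {j : ℕ} (hj : Nat.log 2 n.natAbs = j) :
    2 ≤ ‖(fourier n ((L / 2 ^ (j + 2) : ℝ) : AddCircle L) : ℂ) - 1‖ ^ 2 := by
  have hL0 : L ≠ 0 := hL.out.ne'
  set θ : ℝ := Real.pi * n / 2 ^ (j + 1) with hθ
  have h1 : (fourier n ((L / 2 ^ (j + 2) : ℝ) : AddCircle L) : ℂ) = Complex.exp (θ * Complex.I) := by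
    rw [fourier_coe_apply]
    congr 1
    have : (L : ℂ) ≠ 0 := by exact_mod_cast hL0
    push_cast [hθ]
    field_simp
    ring
  have h2 : ‖Complex.exp (θ * Complex.I) - 1‖ ^ 2 = 2 - 2 * Real.cos θ := by
    rw [← Complex.normSq_eq_norm_sq, Complex.normSq_apply]
    simp [Complex.exp_ofReal_mul_I_re, Complex.exp_ofReal_mul_I_im]
    linear_combination Real.sin_sq_add_cos_sq θ
  have hn0 : n.natAbs ≠ 0 := Int.natAbs_ne_zero.2 hn
  have hlo : (2 : ℝ) ^ j ≤ |(n : ℝ)| := by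
    have := Nat.pow_log_le_self 2 hn0
    rw [hj] at this
    have h3 : ((2 ^ j : ℕ) : ℝ) ≤ (n.natAbs : ℝ) := by exact_mod_cast this
    rwa [Nat.cast_natAbs, Int.cast_abs, Nat.cast_pow, Nat.cast_ofNat] at h3
  have hhi : |(n : ℝ)| ≤ 2 ^ (j + 1) := by
    have := (Nat.lt_pow_succ_log_self (b := 2) (by norm_num) n.natAbs).le
    rw [hj] at this
    have h3 : (n.natAbs : ℝ) ≤ ((2 ^ (j + 1) : ℕ) : ℝ) := by exact_mod_cast this
    rwa [Nat.cast_natAbs, Int.cast_abs, Nat.cast_pow, Nat.cast_ofNat] at h3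
  have habs : |θ| = Real.pi * |(n : ℝ)| / 2 ^ (j + 1) := by
    rw [hθ, abs_div, abs_mul, abs_of_pos Real.pi_pos, abs_pow, abs_two]
  have hcos : Real.cos θ ≤ 0 := by
    rw [← Real.cos_abs]
    apply Real.cos_nonpos_of_pi_div_two_le_of_le
    · rw [habs, div_le_div_iff₀ (by norm_num) (by positivity), pow_succ]
      nlinarith [Real.pi_pos]
    · rw [habs, div_le_iff₀ (by positivity), pow_succ] at *
      have := Real.pi_pos
      have := pow_pos (two_pos (α := ℝ)) j
      nlinarith
  rw [h1, h2]; linarith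

/-- **Bernstein's theorem**: the Fourier series of a Hölder continuous function of order greater
than `1/2` converges absolutely. -/
theorem summable_fourierCoeff_of_holder (F : C(AddCircle L, ℂ)) {K α : ℝ}
    (hα : 1 / 2 < α) (hF : ∀ (x : AddCircle L) (h : ℝ), 0 ≤ h → ‖F (x + h) - F x‖ ≤ K * h ^ α) :
    Summable (fun n => ‖fourierCoeff F n‖) := by
  have hL0 := hL.out
  have hK : 0 ≤ K := by
    have := (norm_nonneg _).trans (hF 0 1 zero_le_one)
    simpa using this
  set q : ℝ := 2 ^ (1 / 2 - α) with hq
  have hq0 : 0 < q := by positivity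
  have hq1 : q < 1 := Real.rpow_lt_one_of_one_lt_of_neg (by norm_num) (by linarith)
  set c : ℝ := 2 * (K * L ^ α) with hc
  have hc0 : 0 ≤ c := by positivity
  -- Cauchy-Schwarz on a dyadic block gives `2^(j/2)` from the number of modes, and `2^(-jα)` from
  -- the increment
  have block : ∀ (v : Finset ℤ) (j : ℕ), (∀ n ∈ v, n ≠ 0 ∧ Nat.log 2 n.natAbs = j) →
      ∑ n ∈ v, ‖fourierCoeff F n‖ ≤ c * q ^ j := by
    intro v j hv
    have hcard : (v.card : ℝ) ≤ 8 * 2 ^ j := by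
      have hsub : v ⊆ Finset.Icc (-(2 ^ (j + 1) : ℤ)) (2 ^ (j + 1)) := by
        intro n hn
        have := (Nat.lt_pow_succ_log_self (b := 2) (by norm_num) n.natAbs).le
        rw [(hv n hn).2] at this
        rw [Finset.mem_Icc, ← abs_le, Int.abs_eq_natAbs]
        exact_mod_cast this
      have h1 := Finset.card_le_card hsub
      rw [Int.card_Icc] at h1
      have h2 : ((2 ^ (j + 1) + 1 - -(2 ^ (j + 1)) : ℤ)).toNat = 4 * 2 ^ j + 1 := by
        have : (2 ^ (j + 1) + 1 - -(2 ^ (j + 1)) : ℤ) = ((4 * 2 ^ j + 1 : ℕ) : ℤ) := by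
          push_cast; ring
        rw [this, Int.toNat_natCast]
      rw [h2] at h1
      have h3 : v.card ≤ 8 * 2 ^ j := h1.trans (by have := Nat.one_le_two_pow (n := j); omega)
      exact_mod_cast h3
    have hsq : ∑ n ∈ v, ‖fourierCoeff F n‖ ^ 2 ≤ (K * (L / 2 ^ (j + 2)) ^ α) ^ 2 / 2 := by
      have h1 := sum_sq_fourierCoeff_increment_le F ((L / 2 ^ (j + 2) : ℝ) : AddCircle L)
        (fun x => hF x (L / 2 ^ (j + 2)) (by positivity)) v
      have h2 : ∑ n ∈ v, 2 * ‖fourierCoeff F n‖ ^ 2 ≤ (K * (L / 2 ^ (j + 2)) ^ α) ^ 2 := by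
        refine (Finset.sum_le_sum fun n hn => ?_).trans h1
        gcongr
        exact two_le_norm_fourier_sub_one_sq (hv n hn).1 (hv n hn).2
      rw [← Finset.mul_sum] at h2
      linarith
    have hcs := sq_sum_le_card_mul_sum_sq (s := v) (f := fun n => ‖fourierCoeff F n‖)
    have h4 : (∑ n ∈ v, ‖fourierCoeff F n‖) ^ 2
        ≤ 8 * 2 ^ j * ((K * (L / 2 ^ (j + 2)) ^ α) ^ 2 / 2) := by
      refine hcs.trans ?_
      gcongr
    refine le_of_sq_le_sq (h4.trans ?_) (by positivity)
    have h5 : (L / 2 ^ (j + 2)) ^ α ≤ L ^ α * ((2 : ℝ) ^ (-α)) ^ j := by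
      rw [Real.div_rpow hL0.le (by positivity), div_eq_mul_inv]
      gcongr
      rw [← Real.rpow_natCast, ← Real.rpow_mul (by norm_num), ← Real.rpow_neg (by norm_num),
        ← Real.rpow_natCast, ← Real.rpow_mul (by norm_num)]
      apply Real.rpow_le_rpow_of_exponent_le (by norm_num)
      push_cast
      nlinarith
    have h6 : ((2 : ℝ) ^ j) * (((2 : ℝ) ^ (-α)) ^ j) ^ 2 = (q ^ j) ^ 2 := by
      rw [← pow_mul, ← pow_mul, mul_comm j 2, pow_mul, pow_mul, ← mul_pow]
      congr 1
      rw [hq, ← Real.rpow_natCast, ← Real.rpow_natCast, ← Real.rpow_mul (by norm_num),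
        ← Real.rpow_mul (by norm_num)]
      nth_rw 1 [← Real.rpow_one 2]
      rw [← Real.rpow_add (by norm_num)]
      congr 1
      push_cast; ring
    calc 8 * 2 ^ j * ((K * (L / 2 ^ (j + 2)) ^ α) ^ 2 / 2)
        ≤ 8 * 2 ^ j * ((K * (L ^ α * ((2 : ℝ) ^ (-α)) ^ j)) ^ 2 / 2) := by gcongr
      _ = 4 * (K * L ^ α) ^ 2 * (2 ^ j * (((2 : ℝ) ^ (-α)) ^ j) ^ 2) := by ring
      _ = (c * q ^ j) ^ 2 := by rw [h6, hc]; ring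
  refine summable_of_sum_le (c := ‖fourierCoeff F 0‖ + c * (1 - q)⁻¹) (fun _ => norm_nonneg _) ?_
  intro u
  have h0 : ∑ n ∈ u, ‖fourierCoeff F n‖
      ≤ ‖fourierCoeff F 0‖ + ∑ n ∈ u.erase 0, ‖fourierCoeff F n‖ := by
    by_cases h : (0 : ℤ) ∈ u
    · exact (Finset.add_sum_erase u (fun n => ‖fourierCoeff F n‖) h).ge
    · rw [Finset.erase_eq_of_notMem h]; simp
  refine h0.trans (add_le_add_right ?_ _)
  set J := (u.erase 0).sup (fun n => Nat.log 2 n.natAbs) + 1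
  rw [← Finset.sum_fiberwise_of_maps_to (t := Finset.range J)
    (g := fun n : ℤ => Nat.log 2 n.natAbs)]
  · calc _ ≤ ∑ j ∈ Finset.range J, c * q ^ j := Finset.sum_le_sum fun j _ => block _ j fun n hn => by
          rw [Finset.mem_filter, Finset.mem_erase] at hn
          exact ⟨hn.1.1, hn.2⟩
      _ = c * ∑ j ∈ Finset.range J, q ^ j := by rw [Finset.mul_sum]
      _ ≤ c * (1 - q)⁻¹ := by
        gcongr
        rw [← tsum_geometric_of_lt_one hq0.le hq1]
        exact (summable_geometric_of_lt_one hq0.le hq1).sum_le_tsum _ fun _ _ => by positivity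
  · intro n hn
    exact Finset.mem_range.2 (Nat.lt_succ_of_le
      (Finset.le_sup (f := fun n : ℤ => Nat.log 2 n.natAbs) hn))

end Fourier

/-- The coefficient `σ₀` is the sum of an absolutely convergent Fourier series, whose constant term
is the mean. -/
theorem PeriodicHolder.exists_fourier {σ₀ : ℝ → ℝ} {T : ℝ} (h : PeriodicHolder σ₀ T) :
    ∃ c : ℤ → ℂ, Summable (fun k => ‖c k‖) ∧ c 0 = mean σ₀ T ∧
      ∀ x : ℝ, HasSum (fun k : ℤ => c k * Complex.exp (Complex.I * (k * (Real.pi / T) * x : ℝ)))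
        (σ₀ x) := by
  obtain ⟨K, α, hα, hH⟩ := h.holder
  have hT := h.period_pos
  have : Fact (0 < 2 * T) := ⟨by linarith⟩
  have hα0 : 0 < α := lt_trans (by norm_num) hα
  have hcont : Continuous σ₀ := hH.continuous hα0
  have hper : Function.Periodic (fun x => (σ₀ x : ℂ)) (2 * T) := fun x => by
    simp only; rw [h.periodic x]
  let F : C(AddCircle (2 * T), ℂ) :=
    ⟨hper.lift, continuous_coinduced_dom.2 (Complex.continuous_ofReal.comp hcont)⟩
  have hFx : ∀ x : ℝ, F (x : AddCircle (2 * T)) = σ₀ x := fun x => hper.lift_coe x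
  have hsum : Summable (fun n => ‖fourierCoeff F n‖) := by
    refine summable_fourierCoeff_of_holder F (K := K) (α := α) (by exact_mod_cast hα) ?_
    intro x y hy
    induction x using QuotientAddGroup.induction_on with
    | H x =>
      have h1 : F ((x : AddCircle (2 * T)) + (y : AddCircle (2 * T))) = σ₀ (x + y) := by
        rw [← AddCircle.coe_add, hFx]
      have h2 := hH.dist_le (x + y) x
      rw [Real.dist_eq, Real.dist_eq, add_sub_cancel_left, abs_of_nonneg hy] at h2
      erw [h1, hFx]
      rw [← Complex.ofReal_sub, Complex.norm_real, Real.norm_eq_abs]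
      exact h2
  refine ⟨fourierCoeff F, hsum, ?_, fun x => ?_⟩
  · rw [fourierCoeff_eq_intervalIntegral F 0 (-T), mean]
    have h1 : -T + 2 * T = T := by ring
    have h2 : ∀ x : ℝ, (fourier (-0) (x : AddCircle (2 * T)) : ℂ) • F x = (σ₀ x : ℂ) := by
      intro x
      rw [neg_zero, fourier_zero, hFx, one_smul]
    simp only [h2, h1]
    rw [intervalIntegral.integral_ofReal, Complex.real_smul]
    push_cast; rfl
  · have h1 := has_pointwise_sum_fourier_series_of_summable hsum.of_norm (x : AddCircle (2 * T))
    rw [hFx] at h1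
    convert! h1 using 1
    ext k
    rw [fourier_coe_apply, smul_eq_mul]
    congr 2
    have : (T : ℂ) ≠ 0 := by exact_mod_cast hT.ne'
    push_cast
    field_simp

/-- The mean of `σ₀` is its limit mean at infinity. -/
lemma PeriodicHolder.mean_eq_of_tendsto {σ₀ : ℝ → ℝ} {T m : ℝ} (h : PeriodicHolder σ₀ T)
    (hm : Tendsto (fun x : ℝ => (1 / x) * ∫ s in (0 : ℝ)..x, σ₀ s) atTop (𝓝 m)) :
    mean σ₀ T = m := by
  obtain ⟨K, α, hα, hH⟩ := h.holder
  have hT := h.period_pos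
  have hcont : Continuous σ₀ := hH.continuous (lt_trans (by norm_num) hα)
  have h1 : Tendsto (fun n : ℕ => ((n : ℝ) + 1) * (2 * T)) atTop atTop :=
    (tendsto_atTop_add_const_right _ _ tendsto_natCast_atTop_atTop).atTop_mul_const (by linarith)
  have h2 := hm.comp h1
  refine tendsto_nhds_unique (tendsto_const_nhds.congr fun n => ?_) h2
  have h3 := h.periodic.intervalIntegral_add_zsmul_eq (n + 1) 0
    (fun t₁ t₂ => hcont.intervalIntegrable _ _)
  have h4 := h.periodic.intervalIntegral_add_eq 0 (-T)
  have h5 : -T + 2 * T = T := by ring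
  rw [h5] at h4
  simp only [zero_add, zsmul_eq_mul, Int.cast_add, Int.cast_natCast, Int.cast_one] at h3 h4
  simp only [Function.comp]
  rw [h3, h4, mean]
  have : (n : ℝ) + 1 ≠ 0 := by positivity
  field_simp


/-! ### The phase `η` and the primitive of the dissipation -/

namespace AdmissiblePhase

variable {η : ℝ → ℝ}

lemma continuousOn_d1 (h : AdmissiblePhase η) : ContinuousOn (d1 η) (Ici 0) :=
  h.contDiffOn.continuousOn_derivWithin (uniqueDiffOn_Ici 0) (by norm_num)

lemma contDiffOn_d1 (h : AdmissiblePhase η) : ContDiffOn ℝ 1 (d1 η) (Ici 0) :=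
  h.contDiffOn.derivWithin (uniqueDiffOn_Ici 0) (by norm_num)

lemma continuousOn_d2 (h : AdmissiblePhase η) : ContinuousOn (d2 η) (Ici 0) :=
  h.contDiffOn_d1.continuousOn_derivWithin (uniqueDiffOn_Ici 0) (by norm_num)

lemma hasDerivAt (h : AdmissiblePhase η) {t : ℝ} (ht : 0 < t) : HasDerivAt η (d1 η t) t :=
  ((h.contDiffOn.differentiableOn (by norm_num)) t ht.le).hasDerivWithinAt.hasDerivAt
    (Ici_mem_nhds ht)

lemma hasDerivAt_d1 (h : AdmissiblePhase η) {t : ℝ} (ht : 0 < t) :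
    HasDerivAt (d1 η) (d2 η t) t :=
  ((h.contDiffOn_d1.differentiableOn (by norm_num)) t ht.le).hasDerivWithinAt.hasDerivAt
    (Ici_mem_nhds ht)

lemma strictMonoOn_d1 (h : AdmissiblePhase η) : StrictMonoOn (d1 η) (Ici 0) := by
  refine strictMonoOn_of_deriv_pos (convex_Ici 0) h.continuousOn_d1 fun t ht => ?_
  rw [interior_Ici] at ht
  rw [(h.hasDerivAt_d1 ht).deriv]
  exact h.d2_pos t ht.le

lemma continuousOn_inv_mul_d2 (h : AdmissiblePhase η) :
    ContinuousOn (fun τ : ℝ => 1 / ((1 + τ) * d2 η τ)) (Ici 0) := by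
  refine continuousOn_const.div ((by fun_prop : ContinuousOn (fun τ : ℝ => 1 + τ) _).mul
    h.continuousOn_d2) fun t ht => ?_
  have := h.d2_pos t ht
  have : (0 : ℝ) ≤ t := ht
  positivity

lemma bddAbove_image (h : AdmissiblePhase η) (t : ℝ) :
    BddAbove ((fun τ : ℝ => 1 / ((1 + τ) * d2 η τ)) '' Icc 0 t) :=
  (isCompact_Icc.image_of_continuousOn
    (h.continuousOn_inv_mul_d2.mono fun _ hx => hx.1)).bddAbove

lemma le_mu (h : AdmissiblePhase η) {s t : ℝ} (hs : 0 ≤ s) (hst : s ≤ t) :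
    1 / ((1 + s) * d2 η s) ≤ mu η t :=
  le_csSup (h.bddAbove_image t) ⟨s, ⟨hs, hst⟩, rfl⟩

lemma mu_pos (h : AdmissiblePhase η) {t : ℝ} (ht : 0 ≤ t) : 0 < mu η t := by
  refine lt_of_lt_of_le ?_ (h.le_mu le_rfl ht)
  have := h.d2_pos 0 le_rfl
  positivity

lemma mu_mono (h : AdmissiblePhase η) {s t : ℝ} (hs : 0 ≤ s) (hst : s ≤ t) : mu η s ≤ mu η t :=
  csSup_le_csSup (h.bddAbove_image t) ⟨_, 0, ⟨le_rfl, hs⟩, rfl⟩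
    (image_mono (Icc_subset_Icc_right hst))

lemma zeta_nonneg (r : ℝ) : 0 ≤ zeta η r := by
  unfold zeta
  split_ifs
  · exact EReal.coe_nonneg.2 (Real.sqrt_nonneg _)
  · exact EReal.coe_nonneg.2 (Real.sqrt_nonneg _)
  · exact le_top

lemma zeta_of_eq (h : AdmissiblePhase η) {t : ℝ} (ht : 0 ≤ t) :
    zeta η (d1 η t) = ((Real.sqrt (mu η t) : ℝ) : EReal) := by
  have h1 : ¬ d1 η t < d1 η 0 := not_lt.2 (h.strictMonoOn_d1.monotoneOn self_mem_Ici ht ht)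
  have h2 : d1 η t ∈ d1 η '' Ici 0 := ⟨t, ht, rfl⟩
  rw [zeta, if_neg h1, if_pos h2]
  congr 3
  exact h.strictMonoOn_d1.injOn (Function.invFunOn_mem h2) ht (Function.invFunOn_eq h2)

/-- A finite value of `ζ` is attained at a time after which `η' ≥ r`. -/
lemma exists_of_zeta_ne_top (h : AdmissiblePhase η) {r : ℝ} (hr : zeta η r ≠ ⊤) :
    ∃ t, 0 ≤ t ∧ r ≤ d1 η t ∧ zeta η r = ((Real.sqrt (mu η t) : ℝ) : EReal) := by
  by_cases h1 : r < d1 η 0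
  · exact ⟨0, le_rfl, h1.le, by rw [zeta, if_pos h1]⟩
  · by_cases h2 : r ∈ d1 η '' Ici 0
    · obtain ⟨t, ht, rfl⟩ := h2
      exact ⟨t, ht, le_rfl, h.zeta_of_eq ht⟩
    · rw [zeta, if_neg h1, if_neg h2] at hr
      exact absurd rfl hr

lemma zeta_mono (h : AdmissiblePhase η) : Monotone (zeta η) := by
  intro r s hrs
  by_cases h1 : s < d1 η 0
  · rw [zeta, zeta, if_pos h1, if_pos (hrs.trans_lt h1)]
  · by_cases h2 : s ∈ d1 η '' Ici 0
    · obtain ⟨t, ht, rfl⟩ := h2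
      rw [h.zeta_of_eq ht]
      by_cases h3 : r < d1 η 0
      · rw [zeta, if_pos h3]
        exact EReal.coe_le_coe_iff.2 (Real.sqrt_le_sqrt (h.mu_mono le_rfl ht))
      · obtain ⟨u, hu, rfl⟩ := intermediate_value_Icc (show (0 : ℝ) ≤ t from ht)
          (h.continuousOn_d1.mono fun _ hx => hx.1) ⟨not_lt.1 h3, hrs⟩
        rw [h.zeta_of_eq hu.1]
        exact EReal.coe_le_coe_iff.2 (Real.sqrt_le_sqrt (h.mu_mono hu.1 hu.2))
    · rw [zeta.eq_1 η s, if_neg h1, if_neg h2]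
      exact le_top

end AdmissiblePhase

lemma PeriodicHolder.continuous {σ₀ : ℝ → ℝ} {T : ℝ} (h : PeriodicHolder σ₀ T) :
    Continuous σ₀ := by
  obtain ⟨K, α, hα, hH⟩ := h.holder
  exact hH.continuous (lt_trans (by norm_num) hα)

/-- The oscillating part of `σ₀` has a bounded primitive. -/
lemma PeriodicHolder.exists_bounded_primitive {σ₀ : ℝ → ℝ} {T : ℝ} (h : PeriodicHolder σ₀ T) :
    ∃ (S : ℝ → ℝ) (C : ℝ), (∀ x, HasDerivAt S (σ₀ x - mean σ₀ T) x) ∧ ∀ x, |S x| ≤ C := by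
  have hT := h.period_pos
  have hc : Continuous fun x => σ₀ x - mean σ₀ T := h.continuous.sub continuous_const
  have hd : ∀ x, HasDerivAt (fun x => ∫ s in (0 : ℝ)..x, (σ₀ s - mean σ₀ T))
      (σ₀ x - mean σ₀ T) x := fun x => (hc.integral_hasStrictDerivAt 0 x).hasDerivAt
  have hper : Function.Periodic (fun x => ∫ s in (0 : ℝ)..x, (σ₀ s - mean σ₀ T)) (2 * T) := by
    intro x
    have h1 : ∫ s in x..(x + 2 * T), (σ₀ s - mean σ₀ T) = 0 := by
      rw [intervalIntegral.integral_sub (h.continuous.intervalIntegrable _ _)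
        (continuous_const.intervalIntegrable _ _), h.periodic.intervalIntegral_add_eq x (-T)]
      rw [show -T + 2 * T = T by ring, mean, intervalIntegral.integral_const]
      simp only [smul_eq_mul]
      field_simp
      ring
    simp only
    rw [← intervalIntegral.integral_add_adjacent_intervals (hc.intervalIntegrable 0 x)
      (hc.intervalIntegrable x _), h1, add_zero]
  have hcont : Continuous (fun x => ∫ s in (0 : ℝ)..x, (σ₀ s - mean σ₀ T)) :=
    continuous_iff_continuousAt.2 fun x => (hd x).continuousAt
  obtain ⟨C, hC⟩ := (hper.isBounded_of_continuous (by positivity) hcont).exists_norm_le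
  exact ⟨_, C, hd, fun x => hC _ ⟨x, rfl⟩⟩

/-- The primitive of the dissipation is `m log (1 + t)` up to a bounded error, because `η` is
convex and increasing. -/
lemma exists_primitive_dissipation {σ₀ η : ℝ → ℝ} {T : ℝ} (hσ : PeriodicHolder σ₀ T)
    (hη : AdmissiblePhase η) :
    ∃ (B : ℝ → ℝ) (C : ℝ), B 0 = 0 ∧ Continuous B ∧
      (∀ t, 0 < t → HasDerivAt B (dissipation σ₀ η t) t) ∧
      ∀ t, 0 ≤ t → |B t - mean σ₀ T * Real.log (1 + t)| ≤ C := by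
  obtain ⟨S, C, hS, hC⟩ := hσ.exists_bounded_primitive
  have hC0 : 0 ≤ C := (abs_nonneg _).trans (hC 0)
  have hcontη : Continuous fun t : ℝ => η (max t 0) :=
    hη.contDiffOn.continuousOn.comp_continuous (by fun_prop) fun t => mem_Ici.2 (le_max_right t 0)
  have hcontb : Continuous fun t : ℝ => dissipation σ₀ η (max t 0) := by
    unfold dissipation
    refine (hσ.continuous.comp hcontη).div (by fun_prop) fun t => ?_
    have := le_max_right t 0
    positivity
  set B : ℝ → ℝ := fun t => ∫ s in (0 : ℝ)..t, dissipation σ₀ η (max s 0) with hBdef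
  have hB : ∀ t, HasDerivAt B (dissipation σ₀ η (max t 0)) t :=
    fun t => (hcontb.integral_hasStrictDerivAt 0 t).hasDerivAt
  have hB' : ∀ t, 0 < t → HasDerivAt B (dissipation σ₀ η t) t := fun t ht => by
    have := hB t; rwa [max_eq_left ht.le] at this
  have hBc : Continuous B := continuous_iff_continuousAt.2 fun x => (hB x).continuousAt
  have hp0 := hη.d1_pos 0 le_rfl
  refine ⟨B, C / d1 η 0 + (C / d1 η 0 + C * (1 / d1 η 0 + 1 / d1 η 0)), by simp [hBdef], hBc, hB',
    fun t ht => ?_⟩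
  set m := mean σ₀ T
  -- One integration by parts: with a bounded primitive `S` of `σ₀ - m`, the oscillating part of
  -- `∫ b` is `S(η) / (η' (1 + t))` up to the remainder `R`, whose variation is dominated by that
  -- of `g`.
  set R : ℝ → ℝ := fun t => B t - m * Real.log (1 + t) - S (η t) * (d1 η t * (1 + t))⁻¹ with hR
  set R' : ℝ → ℝ := fun t => S (η t) * ((d2 η t * (1 + t) + d1 η t) / (d1 η t * (1 + t)) ^ 2)
    with hR'
  set g : ℝ → ℝ := fun t => C * (-(d1 η t)⁻¹ - (d1 η 0)⁻¹ * (1 + t)⁻¹) with hg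
  set g' : ℝ → ℝ := fun t => C * (d2 η t / d1 η t ^ 2 + (d1 η 0)⁻¹ * (1 / (1 + t) ^ 2)) with hg'
  have hsub : Icc 0 t ⊆ Ici 0 := fun r hr => hr.1
  have hne : ∀ r ∈ Icc 0 t, d1 η r ≠ 0 := fun r hr => (hη.d1_pos r hr.1).ne'
  have hne1 : ∀ r ∈ Icc 0 t, 1 + r ≠ 0 := fun r hr => by linarith [hr.1]
  have hc1 := hη.continuousOn_d1.mono hsub
  have hid : ContinuousOn (fun r : ℝ => 1 + r) (Icc 0 t) := by fun_prop
  have hScont : Continuous S := continuous_iff_continuousAt.2 fun x => (hS x).continuousAt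
  have hRc : ContinuousOn R (Icc 0 t) :=
    (hBc.continuousOn.sub (continuousOn_const.mul (hid.log hne1))).sub
      ((hScont.comp_continuousOn (hη.contDiffOn.continuousOn.mono hsub)).mul
        ((hc1.mul hid).inv₀ fun r hr => mul_ne_zero (hne r hr) (hne1 r hr)))
  have hgc : ContinuousOn g (Icc 0 t) :=
    continuousOn_const.mul ((hc1.inv₀ hne).neg.sub (continuousOn_const.mul (hid.inv₀ hne1)))
  have hRd : ∀ r ∈ Ioo 0 t, HasDerivAt R (R' r) r := fun r hr => by
    have e1 := (hη.d1_pos r hr.1.le).ne'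
    have e2 : 1 + r ≠ 0 := by linarith [hr.1]
    have i1 := (hasDerivAt_id r).const_add 1
    have i2 := ((hη.hasDerivAt_d1 hr.1).mul i1).inv (mul_ne_zero e1 e2)
    have i3 := ((hB' r hr.1).sub ((i1.log e2).const_mul m)).sub
      (((hS (η r)).comp r (hη.hasDerivAt hr.1)).mul i2)
    refine i3.congr_deriv ?_
    simp only [hR', dissipation, id, Pi.mul_apply, Pi.inv_apply, Function.comp]
    field_simp
    ring
  have hgd : ∀ r ∈ Ioo 0 t, HasDerivAt g (g' r) r := fun r hr => by
    have e1 := (hη.d1_pos r hr.1.le).ne'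
    have e2 : 1 + r ≠ 0 := by linarith [hr.1]
    have i1 := (hasDerivAt_id r).const_add 1
    have i3 := (((hη.hasDerivAt_d1 hr.1).inv e1).neg.sub
      ((i1.inv e2).const_mul (d1 η 0)⁻¹)).const_mul C
    refine i3.congr_deriv ?_
    simp only [hg', id]
    ring
  have hle : ∀ r ∈ Ioo 0 t, |R' r| ≤ g' r := fun r hr => by
    have e1 := hη.d1_pos r hr.1.le
    have e2 : 1 ≤ 1 + r := by linarith [hr.1]
    have e3 := hη.d2_pos r hr.1.le
    have e4 : d1 η 0 ≤ d1 η r := hη.strictMonoOn_d1.monotoneOn self_mem_Ici hr.1.le hr.1.le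
    have : (0 : ℝ) < 1 + r := by linarith
    simp only [hR', hg', abs_mul]
    refine mul_le_mul (hC _) ?_ (abs_nonneg _) hC0
    rw [abs_of_nonneg (by positivity)]
    have : (d2 η r * (1 + r) + d1 η r) / (d1 η r * (1 + r)) ^ 2
        = d2 η r / d1 η r ^ 2 * (1 / (1 + r)) + (d1 η r)⁻¹ * (1 / (1 + r) ^ 2) := by
      field_simp
    rw [this]
    gcongr
    apply mul_le_of_le_one_right (by positivity)
    rw [div_le_one (by linarith)]; exact e2
  have k1 := sub_le_sub_of_deriv_le ht hRc hgc hRd hgd fun r hr => (le_abs_self _).trans (hle r hr)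
  have k2 := sub_le_sub_of_deriv_le ht hRc.neg hgc (fun r hr => (hRd r hr).neg) hgd
    fun r hr => (neg_le_abs _).trans (hle r hr)
  have hpt := hη.d1_pos t ht
  have k3 : g t - g 0 ≤ C * (1 / d1 η 0 + 1 / d1 η 0) := by
    simp only [hg]
    have a1 : 0 ≤ C * (d1 η t)⁻¹ := by positivity
    have a2 : 0 ≤ C * ((d1 η 0)⁻¹ * (1 + t)⁻¹) := by positivity
    have a3 : (1 + (0 : ℝ))⁻¹ = 1 := by norm_num
    rw [a3, one_div]
    linarith
  have bnd : ∀ r, 0 ≤ r → |S (η r) * (d1 η r * (1 + r))⁻¹| ≤ C / d1 η 0 := fun r hr => by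
    have e4 : d1 η 0 ≤ d1 η r := hη.strictMonoOn_d1.monotoneOn self_mem_Ici hr hr
    have e1 := hη.d1_pos r hr
    rw [abs_mul, abs_of_nonneg (by positivity : 0 ≤ (d1 η r * (1 + r))⁻¹), div_eq_mul_inv]
    have := hC (η r)
    gcongr
    nlinarith
  have b0 := abs_le.1 (bnd 0 le_rfl)
  have bt := abs_le.1 (bnd t ht)
  have r0 : R 0 = - (S (η 0) * (d1 η 0 * (1 + 0))⁻¹) := by simp [hR, hBdef]
  have rt : B t - m * Real.log (1 + t) = R t + S (η t) * (d1 η t * (1 + t))⁻¹ := by simp [hR]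
  simp only [Pi.neg_apply] at k2
  rw [rt, abs_le]
  constructor <;> linarith


/-! ### The hyperbolic zone -/

lemma sign_mul_sub_le {x y z : ℝ} (hx : |x| ≤ z / 2) (hy : |y| ≤ z / 2) (k : ℝ) :
    SignType.sign k * (x - y) ≤ z := by
  have hx := abs_le.1 hx
  have hy := abs_le.1 hy
  rcases lt_trichotomy k 0 with h | h | h
  · rw [sign_neg h]; simp; linarith
  · rw [h]; simp; linarith
  · rw [sign_pos h]; simp; linarith

lemma abs_arctan_le (x : ℝ) : |Real.arctan x| ≤ Real.pi / 2 :=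
  abs_le.2 ⟨(Real.neg_pi_div_two_lt_arctan x).le, (Real.arctan_lt_pi_div_two x).le⟩

/-- Energy estimate in the hyperbolic zone. The corrector is
`N = -i/(1+t) (m/(2p) + ∑ c_k exp(ikκη) h(x_k))`, where `x_k = kκη' + 2p` measures the distance of the
`k`-th mode of the coefficient from resonance and `h` stands for `1/x`, truncated near `x = 0` at the
scale `l` where resonances occur. The total error is measured by the variation of
`arctan (x_k / l)`. The sum over `k` runs over a finite set; `δ` bounds the tail of the series. -/
lemma EnergyPair.hyperbolic_le {σ₀ η : ℝ → ℝ} (hη : AdmissiblePhase η)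
    {κ p ρ m A δ l G : ℝ} {E B : ℝ → ℝ} {P : ℝ → ℂ}
    (hE : EnergyPair (dissipation σ₀ η) p ρ E P) (hρ : 0 ≤ ρ) (hp : 0 < p) (hκ : 0 < κ)
    (hl : 0 < l) (hG : 0 ≤ G) (hBc : Continuous B)
    (hB : ∀ t, 0 < t → HasDerivAt B (dissipation σ₀ η t) t)
    (hm : |m| ≤ A) (hσ : ∀ x, |σ₀ x| ≤ A) {F : Finset ℤ} {c : ℤ → ℂ}
    (hcA : ∑ k ∈ F, ‖c k‖ ≤ A)
    (hδ : ∀ x : ℝ, ‖(m : ℂ) + ∑ k ∈ F, c k * Complex.exp (Complex.I * (k * κ * x : ℝ)) - σ₀ x‖ ≤ δ)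
    {s t : ℝ} (hs : 0 ≤ s) (hst : s ≤ t) {h h' : ℝ → ℝ}
    (hd : ∀ r ∈ Icc s t, ∀ k ∈ F, HasDerivAt h (h' (k * κ * d1 η r + 2 * p)) (k * κ * d1 η r + 2 * p))
    (hle : ∀ r ∈ Icc s t, ∀ k ∈ F, |h (k * κ * d1 η r + 2 * p)| ≤ 1 / l)
    (herr : ∀ r ∈ Ioo s t, ∀ k ∈ F,
      |(k * κ * d1 η r + 2 * p) * h (k * κ * d1 η r + 2 * p) - 1| / (1 + r)
        + |h' (k * κ * d1 η r + 2 * p)| * (|(k : ℝ)| * κ * d2 η r) / (1 + r)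
      ≤ G * (|(k : ℝ)| * κ * d2 η r) / ((k * κ * d1 η r + 2 * p) ^ 2 + l ^ 2))
    (hsA : A / p + 2 * (A / l) ≤ 1 + s) (hδt : δ * Real.log (1 + t) ≤ 1) (hρt : ρ * t ≤ 1) :
    E t * Real.exp (B t)
      ≤ 3 * (E s * Real.exp (B s)) * Real.exp (7 + A + 2 * Real.pi * A * (G / l)) := by
  have hA : 0 ≤ A := (abs_nonneg _).trans hm
  have hδ0 : 0 ≤ δ := (norm_nonneg _).trans (hδ 0)
  set X : ℤ → ℝ → ℝ := fun k r => k * κ * d1 η r + 2 * p with hX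
  set e : ℤ → ℝ → ℂ := fun k r => Complex.exp (Complex.I * (k * κ * η r : ℝ)) with he
  have he1 : ∀ k r, ‖e k r‖ = 1 := fun k r => by
    simp only [he]; rw [mul_comm]; exact Complex.norm_exp_ofReal_mul_I _
  set Z : ℝ → ℂ := fun r => m / (2 * p) + ∑ k ∈ F, c k * (e k r * (h (X k r) : ℂ)) with hZ
  set Z' : ℝ → ℂ := fun r => ∑ k ∈ F, c k *
    (e k r * (Complex.I * (k * κ * d1 η r : ℝ)) * (h (X k r) : ℂ)
    + e k r * (h' (X k r) * (k * κ * d2 η r) : ℝ)) with hZ'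
  set N : ℝ → ℂ := fun r => -Complex.I * ((((1 + r)⁻¹ : ℝ) : ℂ) * Z r) with hN
  set N' : ℝ → ℂ := fun r => -Complex.I * ((((-1 / (1 + r) ^ 2 : ℝ)) : ℂ) * Z r +
    (((1 + r)⁻¹ : ℝ) : ℂ) * Z' r) with hN'
  have hsub : Icc s t ⊆ Ici 0 := fun r hr => hs.trans hr.1
  have hpos : ∀ r ∈ Ioo s t, 0 < r := fun r hr => hs.trans_lt hr.1
  have hXc : ∀ k, ContinuousOn (X k) (Icc s t) := fun k =>
    (continuousOn_const.mul (hη.continuousOn_d1.mono hsub)).add continuousOn_const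
  have hηc : ContinuousOn η (Icc s t) := hη.contDiffOn.continuousOn.mono hsub
  have hec : ∀ k, ContinuousOn (e k) (Icc s t) := fun k =>
    Complex.continuous_exp.comp_continuousOn (continuousOn_const.mul
      (Complex.continuous_ofReal.comp_continuousOn (continuousOn_const.mul hηc)))
  have hhc : ∀ k ∈ F, ContinuousOn (fun r => (h (X k r) : ℂ)) (Icc s t) := fun k hk r hr =>
    Complex.continuous_ofReal.continuousAt.comp_continuousWithinAt
      ((hd r hr k hk).continuousAt.comp_continuousWithinAt (f := X k) (hXc k r hr))
  have hne1 : ∀ r ∈ Icc s t, 1 + r ≠ 0 := fun r hr => by linarith [hr.1]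
  have hid : ContinuousOn (fun r : ℝ => 1 + r) (Icc s t) := by fun_prop
  have hZc : ContinuousOn Z (Icc s t) := continuousOn_const.add
    (continuousOn_finsetSum _ fun k hk => continuousOn_const.mul ((hec k).mul (hhc k hk)))
  have hNc : ContinuousOn N (Icc s t) := continuousOn_const.mul
    ((Complex.continuous_ofReal.comp_continuousOn (hid.inv₀ hne1)).mul hZc)
  have hXd : ∀ k, ∀ r ∈ Ioo s t, HasDerivAt (X k) (k * κ * d2 η r) r := fun k r hr =>
    ((hη.hasDerivAt_d1 (hpos r hr)).const_mul _).add_const _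
  have hed : ∀ k, ∀ r ∈ Ioo s t,
      HasDerivAt (e k) (e k r * (Complex.I * (k * κ * d1 η r : ℝ))) r := fun k r hr =>
    ((((hη.hasDerivAt (hpos r hr)).const_mul (k * κ)).ofReal_comp).const_mul Complex.I).cexp
  have hZd : ∀ r ∈ Ioo s t, HasDerivAt Z (Z' r) r := fun r hr =>
    (HasDerivAt.fun_sum fun k hk => (((hed k r hr).mul
      (((hd r (Ioo_subset_Icc_self hr) k hk).comp r (hXd k r hr)).ofReal_comp)).const_mul
        (c k))).const_add _
  have hNd : ∀ r ∈ Ioo s t, HasDerivAt N (N' r) r := fun r hr => by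
    have i1 := ((hasDerivAt_id r).const_add 1).inv (by simpa using hne1 r (Ioo_subset_Icc_self hr))
    exact ((i1.ofReal_comp).mul (hZd r hr)).const_mul (-Complex.I)
  have hZle' : ∀ r ∈ Icc s t, ‖Z r‖ ≤ A / (2 * p) + (∑ k ∈ F, ‖c k‖) * (1 / l) := fun r hr => by
    refine (norm_add_le _ _).trans (add_le_add ?_ ?_)
    · rw [norm_div, Complex.norm_real, norm_mul, Complex.norm_real, Real.norm_eq_abs,
        Real.norm_eq_abs, abs_of_pos hp, Complex.norm_ofNat]
      gcongr
    · refine (norm_sum_le _ _).trans ?_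
      rw [Finset.sum_mul]
      refine Finset.sum_le_sum fun k hk => ?_
      rw [norm_mul, norm_mul, he1, one_mul, Complex.norm_real, Real.norm_eq_abs]
      have := hle r hr k hk
      gcongr
  have hZle : ∀ r ∈ Icc s t, ‖Z r‖ ≤ A / (2 * p) + A / l := fun r hr => by
    refine (hZle' r hr).trans ?_
    rw [div_eq_mul_one_div A l]
    gcongr
  have hNle : ∀ r ∈ Icc s t, ‖N r‖ ≤ (A / (2 * p) + A / l) / (1 + r) := fun r hr => by
    have h1 : 0 < 1 + r := by linarith [hr.1]
    simp only [hN]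
    rw [norm_mul, norm_neg, Complex.norm_I, one_mul, norm_mul, Complex.norm_real, Real.norm_eq_abs,
      abs_of_pos (by positivity), div_eq_inv_mul]
    have := hZle r hr
    gcongr
  have hZ0 : A / (2 * p) + A / l ≤ (1 + s) / 2 := by
    have : A / (2 * p) = A / p / 2 := by field_simp
    rw [this]; linarith
  set Z0 := A / (2 * p) + A / l with hZ0def
  have hZ0n : 0 ≤ Z0 := by positivity
  -- `D'` collects all errors; the resonant ones add up to multiples of `arctan (x_k / l)`
  set D : ℝ → ℝ := fun r => 2 * (-(A / (2 * p)) * (1 + r)⁻¹ + δ * Real.log (1 + r)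
    + ∑ k ∈ F, ‖c k‖ * (G / l * (SignType.sign (k : ℝ) * Real.arctan (X k r / l)) - 1 / l * (1 + r)⁻¹)
    - A * Z0 * (1 + r)⁻¹ + 2 * ρ * r) with hD
  set D' : ℝ → ℝ := fun r => 2 * (A / (2 * p) / (1 + r) ^ 2 + δ / (1 + r)
    + ∑ k ∈ F, ‖c k‖ * (G * (|(k : ℝ)| * κ * d2 η r) / (X k r ^ 2 + l ^ 2) + 1 / l / (1 + r) ^ 2)
    + A * Z0 / (1 + r) ^ 2 + 2 * ρ) with hD'
  have hDc : ContinuousOn D (Icc s t) := by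
    have hinv := hid.inv₀ hne1
    refine continuousOn_const.mul (((((continuousOn_const.mul hinv).add
      (continuousOn_const.mul (hid.log hne1))).add (continuousOn_finsetSum _ fun k hk =>
      continuousOn_const.mul ((continuousOn_const.mul (continuousOn_const.mul
        (Real.continuous_arctan.comp_continuousOn ((hXc k).div_const l)))).sub
        (continuousOn_const.mul hinv)))).sub (continuousOn_const.mul hinv)).add ?_)
    fun_prop
  have hDd : ∀ r ∈ Ioo s t, HasDerivAt D (D' r) r := fun r hr => by
    have hr1 : 1 + r ≠ 0 := hne1 r (Ioo_subset_Icc_self hr)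
    have i0 := (hasDerivAt_id r).const_add 1
    have i1 := i0.inv (by simpa using hr1)
    have i2 := i0.log (by simpa using hr1)
    have i3 : ∀ k ∈ F, HasDerivAt (fun r => ‖c k‖ * (G / l * (SignType.sign (k : ℝ) *
        Real.arctan (X k r / l)) - 1 / l * (1 + r)⁻¹))
        (‖c k‖ * (G * (|(k : ℝ)| * κ * d2 η r) / (X k r ^ 2 + l ^ 2) + 1 / l / (1 + r) ^ 2)) r := by
      intro k hk
      have j1 := ((((hXd k r hr).div_const l).arctan.const_mul
        (SignType.sign (k : ℝ) : ℝ)).const_mul (G / l)).sub (i1.const_mul (1 / l))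
      refine (j1.const_mul ‖c k‖).congr_deriv ?_
      have hpos2 : X k r ^ 2 + l ^ 2 ≠ 0 := by positivity
      have hpos3 : 1 + (X k r / l) ^ 2 ≠ 0 := by positivity
      have : (1 + (X k r / l) ^ 2) = (X k r ^ 2 + l ^ 2) / l ^ 2 := by field_simp; ring
      rw [this, ← sign_mul_self (k : ℝ)]
      simp only [id]
      field_simp
      ring
    have i4 := (((((i1.const_mul (-(A / (2 * p)))).add (i2.const_mul δ)).add
      (HasDerivAt.fun_sum i3)).sub (i1.const_mul (A * Z0))).add
      ((hasDerivAt_id r).const_mul (2 * ρ))).const_mul 2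
    refine i4.congr_deriv ?_
    simp only [hD', id]
    ring
  have key := hE.mul_exp_le_of_corrector hρ hs hst hBc.continuousOn
    (fun r hr => hB r (hpos r hr)) hDc hDd hNc hNd (fun r hr => ?_) (fun r hr => ?_)
  · refine key.trans ?_
    have hEs := hE.nonneg hs
    gcongr
    -- the total variation of `D`
    have v1 : ∀ k ∈ F, ‖c k‖ * (G / l * (SignType.sign (k : ℝ) * Real.arctan (X k t / l))
        - 1 / l * (1 + t)⁻¹) - ‖c k‖ * (G / l * (SignType.sign (k : ℝ) * Real.arctan (X k s / l))
        - 1 / l * (1 + s)⁻¹) ≤ ‖c k‖ * (G / l * Real.pi + 1 / l * (1 + s)⁻¹) := fun k _ => by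
      rw [← mul_sub]
      refine mul_le_mul_of_nonneg_left ?_ (norm_nonneg _)
      have a1 := mul_le_mul_of_nonneg_left (sign_mul_sub_le (abs_arctan_le (X k t / l))
        (abs_arctan_le (X k s / l)) (k : ℝ)) (by positivity : 0 ≤ G / l)
      have a2 : 0 ≤ 1 / l * (1 + t)⁻¹ := by
        have : 0 < 1 + t := by linarith
        positivity
      linarith
    have v2 := (Finset.sum_le_sum v1)
    rw [Finset.sum_sub_distrib, ← Finset.sum_mul] at v2
    have hs1 : 0 < 1 + s := by linarith
    have ht1 : 0 < 1 + t := by linarith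
    have v3 := v2.trans (mul_le_mul_of_nonneg_right hcA
      (by positivity : 0 ≤ G / l * Real.pi + 1 / l * (1 + s)⁻¹))
    have v4 : (A / (2 * p) + A / l) * (1 + s)⁻¹ ≤ 1 / 2 := by
      rw [← div_eq_mul_inv, div_le_iff₀ hs1]; linarith
    have v5 : 0 ≤ δ * Real.log (1 + s) := mul_nonneg hδ0 (Real.log_nonneg (by linarith))
    have v6 : A * Z0 * (1 + s)⁻¹ ≤ A * (1 / 2) := by
      rw [mul_assoc]; exact mul_le_mul_of_nonneg_left v4 hA
    have v7 : 0 ≤ A * Z0 * (1 + t)⁻¹ := by positivity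
    have v8 : 0 ≤ A / (2 * p) * (1 + t)⁻¹ := by positivity
    have v9 : 0 ≤ ρ * s := by positivity
    have v10 : A * (G / l * Real.pi + 1 / l * (1 + s)⁻¹)
        = Real.pi * A * (G / l) + A / l * (1 + s)⁻¹ := by ring
    simp only [hD]
    linarith
  · have h1 : 0 < 1 + r := by linarith [hr.1]
    refine (hNle r hr).trans ?_
    rw [div_le_iff₀ h1]
    linarith [hr.1]
  · have hr' := Ioo_subset_Icc_self hr
    have h1 : 0 < 1 + r := by linarith [hr.1]
    have h1c : (1 + r : ℂ) ≠ 0 := by exact_mod_cast h1.ne'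
    have hpc : (p : ℂ) ≠ 0 := by exact_mod_cast hp.ne'
    have hexp : N' r + 2 * Complex.I * p * N r - dissipation σ₀ η r
        = Complex.I * (((1 / (1 + r) ^ 2 : ℝ) : ℂ) * Z r) + (((1 + r)⁻¹ : ℝ) : ℂ) *
          (((m : ℂ) + ∑ k ∈ F, c k * Complex.exp (Complex.I * (k * κ * η r : ℝ)) - σ₀ (η r))
          + ∑ k ∈ F, c k * (e k r * ((X k r * h (X k r) - 1 : ℝ)
            - Complex.I * (h' (X k r) * (k * κ * d2 η r) : ℝ)))) := by
      have hs1 : -Complex.I * Z' r + 2 * p * Z r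
          = (m + ∑ k ∈ F, c k * e k r) + ∑ k ∈ F, c k * (e k r * ((X k r * h (X k r) - 1 : ℝ)
            - Complex.I * (h' (X k r) * (k * κ * d2 η r) : ℝ))) := by
        simp only [hZ, hZ', mul_add, Finset.mul_sum]
        rw [add_left_comm, add_assoc, ← Finset.sum_add_distrib, ← Finset.sum_add_distrib]
        congr 1
        · field_simp
        · refine Finset.sum_congr rfl fun k _ => ?_
          simp only [hX]
          push_cast
          linear_combination
            (-c k * e k r * k * κ * d1 η r * h (k * κ * d1 η r + 2 * p)) * Complex.I_sq
      have hb : ((dissipation σ₀ η r : ℝ) : ℂ) = (((1 + r)⁻¹ : ℝ) : ℂ) * σ₀ (η r) := by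
        rw [dissipation]; push_cast; field_simp
      rw [hb]
      simp only [hN, hN']
      have hs2 : 2 * Complex.I * p * (-Complex.I * ((((1 + r)⁻¹ : ℝ) : ℂ) * Z r))
          = (((1 + r)⁻¹ : ℝ) : ℂ) * (2 * p * Z r) := by
        linear_combination (-2 * p * ((((1 + r)⁻¹ : ℝ) : ℂ) * Z r)) * Complex.I_sq
      rw [hs2]
      have hneg : (((-1 / (1 + r) ^ 2 : ℝ)) : ℂ) = -(((1 / (1 + r) ^ 2 : ℝ) : ℂ)) := by
        push_cast; ring
      rw [hneg]
      linear_combination (((1 + r)⁻¹ : ℝ) : ℂ) * hs1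
    have n1 : ‖Complex.I * (((1 / (1 + r) ^ 2 : ℝ) : ℂ) * Z r)‖
        ≤ 1 / (1 + r) ^ 2 * (A / (2 * p) + (∑ k ∈ F, ‖c k‖) * (1 / l)) := by
      rw [norm_mul, Complex.norm_I, one_mul, norm_mul, Complex.norm_real, Real.norm_eq_abs,
        abs_of_pos (by positivity)]
      have := hZle' r hr'
      gcongr
    have n2 : ‖∑ k ∈ F, c k * (e k r * ((X k r * h (X k r) - 1 : ℝ)
            - Complex.I * (h' (X k r) * (k * κ * d2 η r) : ℝ)))‖
        ≤ ∑ k ∈ F, ‖c k‖ * (|X k r * h (X k r) - 1| + |h' (X k r)| * (|(k : ℝ)| * κ * d2 η r)) := by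
      refine (norm_sum_le _ _).trans (Finset.sum_le_sum fun k _ => ?_)
      rw [norm_mul, norm_mul, he1, one_mul]
      refine mul_le_mul_of_nonneg_left ((norm_sub_le _ _).trans (le_of_eq ?_)) (norm_nonneg _)
      rw [norm_mul, Complex.norm_I, one_mul, Complex.norm_real, Complex.norm_real,
        Real.norm_eq_abs, Real.norm_eq_abs, abs_mul, abs_mul, abs_mul, abs_of_pos hκ,
        abs_of_pos (hη.d2_pos r (hpos r hr).le)]
    have n3 : (1 + r)⁻¹ * ∑ k ∈ F, ‖c k‖ * (|X k r * h (X k r) - 1|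
          + |h' (X k r)| * (|(k : ℝ)| * κ * d2 η r))
        ≤ ∑ k ∈ F, ‖c k‖ * (G * (|(k : ℝ)| * κ * d2 η r) / (X k r ^ 2 + l ^ 2)) := by
      rw [Finset.mul_sum]
      refine Finset.sum_le_sum fun k hk => ?_
      rw [mul_left_comm]
      refine mul_le_mul_of_nonneg_left (le_trans (le_of_eq ?_) (herr r hr k hk)) (norm_nonneg _)
      rw [← add_div, div_eq_inv_mul]
    have n4 : ‖(((1 + r)⁻¹ : ℝ) : ℂ) *
          (((m : ℂ) + ∑ k ∈ F, c k * Complex.exp (Complex.I * (k * κ * η r : ℝ)) - σ₀ (η r))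
          + ∑ k ∈ F, c k * (e k r * ((X k r * h (X k r) - 1 : ℝ)
            - Complex.I * (h' (X k r) * (k * κ * d2 η r) : ℝ))))‖
        ≤ δ / (1 + r) + ∑ k ∈ F, ‖c k‖ * (G * (|(k : ℝ)| * κ * d2 η r) / (X k r ^ 2 + l ^ 2)) := by
      rw [norm_mul, Complex.norm_real, Real.norm_eq_abs, abs_of_pos (by positivity)]
      refine (mul_le_mul_of_nonneg_left ((norm_add_le _ _).trans (add_le_add (hδ (η r)) n2))
        (by positivity)).trans ?_
      rw [mul_add, div_eq_inv_mul]
      linarith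
    have n5 : |dissipation σ₀ η r| * ‖N r‖ ≤ A / (1 + r) * (Z0 / (1 + r)) := by
      refine mul_le_mul ?_ (hNle r hr') (norm_nonneg _) (by positivity)
      rw [dissipation, abs_div, abs_of_pos h1]
      have := hσ (η r)
      gcongr
    have n6 := norm_add_le (Complex.I * (((1 / (1 + r) ^ 2 : ℝ) : ℂ) * Z r)) ((((1 + r)⁻¹ : ℝ) : ℂ) *
          (((m : ℂ) + ∑ k ∈ F, c k * Complex.exp (Complex.I * (k * κ * η r : ℝ)) - σ₀ (η r))
          + ∑ k ∈ F, c k * (e k r * ((X k r * h (X k r) - 1 : ℝ)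
            - Complex.I * (h' (X k r) * (k * κ * d2 η r) : ℝ)))))
    have n7 : D' r = 2 * ((1 / (1 + r) ^ 2 * (A / (2 * p) + (∑ k ∈ F, ‖c k‖) * (1 / l)))
        + (δ / (1 + r) + ∑ k ∈ F, ‖c k‖ * (G * (|(k : ℝ)| * κ * d2 η r) / (X k r ^ 2 + l ^ 2)))
        + A / (1 + r) * (Z0 / (1 + r)) + 2 * ρ) := by
      have hsplit : ∑ k ∈ F, ‖c k‖ * (G * (|(k : ℝ)| * κ * d2 η r) / (X k r ^ 2 + l ^ 2)
            + 1 / l / (1 + r) ^ 2)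
          = ∑ k ∈ F, ‖c k‖ * (G * (|(k : ℝ)| * κ * d2 η r) / (X k r ^ 2 + l ^ 2))
            + (∑ k ∈ F, ‖c k‖) * (1 / l / (1 + r) ^ 2) := by
        rw [Finset.sum_mul, ← Finset.sum_add_distrib]
        exact Finset.sum_congr rfl fun k _ => mul_add _ _ _
      simp only [hD']
      rw [hsplit]
      generalize ∑ k ∈ F, ‖c k‖ * (G * (|(k : ℝ)| * κ * d2 η r) / (X k r ^ 2 + l ^ 2)) = s₁
      generalize ∑ k ∈ F, ‖c k‖ = s₂
      field_simp
      ring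
    rw [hexp, n7]
    linarith


/-- A finite part of the Fourier series, without the constant term, approximates `σ₀` uniformly. -/
lemma exists_finset_fourier_sub_le {σ₀ : ℝ → ℝ} {κ m : ℝ} {c : ℤ → ℂ}
    (hc : Summable fun k => ‖c k‖) (hc0 : c 0 = m)
    (hsum : ∀ x : ℝ, HasSum (fun k : ℤ => c k * Complex.exp (Complex.I * (k * κ * x : ℝ))) (σ₀ x))
    {δ : ℝ} (hδ : 0 < δ) :
    ∃ F : Finset ℤ, (0 : ℤ) ∉ F ∧ ∀ x : ℝ,
      ‖(m : ℂ) + ∑ k ∈ F, c k * Complex.exp (Complex.I * (k * κ * x : ℝ)) - σ₀ x‖ ≤ δ := by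
  have h1 := (hc.hasSum.eventually (lt_mem_nhds (sub_lt_self (∑' k, ‖c k‖) hδ))).and
    (eventually_ge_atTop {(0 : ℤ)})
  obtain ⟨F, hF, h0⟩ := h1.exists
  have h0 : (0 : ℤ) ∈ F := by simpa using h0
  refine ⟨F.erase 0, Finset.notMem_erase _ _, fun x => ?_⟩
  set f : ℤ → ℂ := fun k => c k * Complex.exp (Complex.I * (k * κ * x : ℝ)) with hf
  have hnorm : ∀ k, ‖f k‖ = ‖c k‖ := fun k => by
    simp only [hf]
    rw [norm_mul, mul_comm Complex.I, Complex.norm_exp_ofReal_mul_I, mul_one]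
  have e1 : (m : ℂ) + ∑ k ∈ F.erase 0, f k = ∑ k ∈ F, f k := by
    rw [← Finset.add_sum_erase F f h0]
    simp [hf, hc0]
  have e2 := (hsum x).summable.sum_add_tsum_compl (s := F)
  rw [(hsum x).tsum_eq] at e2
  have e3 := hc.sum_add_tsum_compl (s := F)
  rw [e1, ← e2, sub_add_cancel_left, norm_neg]
  have e4 : Summable fun k : ↑((F : Set ℤ)ᶜ) => ‖f k‖ :=
    (hc.subtype _).congr fun k => (hnorm k).symm
  refine (norm_tsum_le_tsum_norm e4).trans ?_
  rw [tsum_congr fun k : ↑((F : Set ℤ)ᶜ) => hnorm k]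
  linarith

lemma hasDerivAt_div_sq_add {l : ℝ} (hl : 0 < l) (x : ℝ) :
    HasDerivAt (fun x : ℝ => x / (x ^ 2 + l ^ 2)) ((l ^ 2 - x ^ 2) / (x ^ 2 + l ^ 2) ^ 2) x := by
  have hne : x ^ 2 + l ^ 2 ≠ 0 := by positivity
  have h1 : HasDerivAt (fun x : ℝ => x ^ 2 + l ^ 2) (2 * x) x := by
    simpa using (hasDerivAt_pow 2 x).add_const (l ^ 2)
  refine ((hasDerivAt_id x).div h1 hne).congr_deriv ?_
  simp only [id]
  ring

lemma abs_div_sq_add_le {l : ℝ} (hl : 0 < l) (x : ℝ) : |x / (x ^ 2 + l ^ 2)| ≤ 1 / l := by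
  have hpos : 0 < x ^ 2 + l ^ 2 := by positivity
  rw [abs_div, abs_of_pos hpos, div_le_div_iff₀ hpos hl, ← sq_abs x]
  nlinarith [sq_nonneg (|x| - l), sq_nonneg (|x| + l), abs_nonneg x]

lemma abs_deriv_div_sq_add_le {l : ℝ} (hl : 0 < l) (x : ℝ) :
    |(l ^ 2 - x ^ 2) / (x ^ 2 + l ^ 2) ^ 2| ≤ 1 / (x ^ 2 + l ^ 2) := by
  have hpos : 0 < x ^ 2 + l ^ 2 := by positivity
  rw [abs_div, abs_of_pos (pow_pos hpos 2), div_le_div_iff₀ (pow_pos hpos 2) hpos, one_mul,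
    sq (_ + _)]
  refine mul_le_mul_of_nonneg_right (abs_le.2 ⟨?_, ?_⟩) hpos.le <;>
    linarith [sq_nonneg x, sq_nonneg l]

lemma abs_mul_div_sq_add_sub_one {l : ℝ} (hl : 0 < l) (x : ℝ) :
    |x * (x / (x ^ 2 + l ^ 2)) - 1| = l ^ 2 / (x ^ 2 + l ^ 2) := by
  have hpos : 0 < x ^ 2 + l ^ 2 := by positivity
  have : x * (x / (x ^ 2 + l ^ 2)) - 1 = -(l ^ 2 / (x ^ 2 + l ^ 2)) := by
    field_simp
    ring
  rw [this, abs_neg, abs_of_nonneg (by positivity)]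

/-- Up to the time `τ`, the inequality `1 / (1 + t) ≤ μ(τ) η''` measures the resonant windows of width
`l = 1 / √(μ(τ))` in the variable `x_k`. -/
lemma EnergyPair.resonant_le {σ₀ η : ℝ → ℝ} (hη : AdmissiblePhase η)
    {κ p ρ m A δ τ : ℝ} {E B : ℝ → ℝ} {P : ℝ → ℂ}
    (hE : EnergyPair (dissipation σ₀ η) p ρ E P) (hρ : 0 ≤ ρ) (hp : 0 < p) (hκ : 0 < κ)
    (hBc : Continuous B) (hB : ∀ t, 0 < t → HasDerivAt B (dissipation σ₀ η t) t)
    (hm : |m| ≤ A) (hσ : ∀ x, |σ₀ x| ≤ A) {F : Finset ℤ} (hF0 : (0 : ℤ) ∉ F) {c : ℤ → ℂ}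
    (hcA : ∑ k ∈ F, ‖c k‖ ≤ A)
    (hδ : ∀ x : ℝ, ‖(m : ℂ) + ∑ k ∈ F, c k * Complex.exp (Complex.I * (k * κ * x : ℝ)) - σ₀ x‖ ≤ δ)
    {s t : ℝ} (hs : 0 ≤ s) (hst : s ≤ t) (htτ : t ≤ τ)
    (hsA : A / p + 2 * (A / (1 / Real.sqrt (mu η τ))) ≤ 1 + s)
    (hδt : δ * Real.log (1 + t) ≤ 1) (hρt : ρ * t ≤ 1) :
    E t * Real.exp (B t) ≤ 3 * (E s * Real.exp (B s)) *
      Real.exp (7 + A + 2 * Real.pi * A * ((1 + 1 / κ) * Real.sqrt (mu η τ))) := by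
  have hμ := hη.mu_pos (hs.trans (hst.trans htτ))
  have hz0 : 0 < Real.sqrt (mu η τ) := Real.sqrt_pos.2 hμ
  have hz2 : Real.sqrt (mu η τ) ^ 2 = mu η τ := Real.sq_sqrt hμ.le
  generalize Real.sqrt (mu η τ) = z at *
  have hl : 0 < 1 / z := by positivity
  have e0 : (1 + 1 / κ) * z = (1 + 1 / κ) / (1 / z) := by field_simp
  rw [e0]
  refine hE.hyperbolic_le hη (h := fun x => x / (x ^ 2 + (1 / z) ^ 2))
    (h' := fun x => ((1 / z) ^ 2 - x ^ 2) / (x ^ 2 + (1 / z) ^ 2) ^ 2) hρ hp hκ hl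
    (by positivity) hBc hB hm hσ hcA hδ hs hst
    (fun r _ k _ => hasDerivAt_div_sq_add hl _) (fun r _ k _ => abs_div_sq_add_le hl _) ?_
    hsA hδt hρt
  intro r hr k hk
  have hr0 : 0 < r := hs.trans_lt hr.1
  have hd2 := hη.d2_pos r hr0.le
  have hk0 : k ≠ 0 := fun h => hF0 (h ▸ hk)
  have hk1 : 1 ≤ |(k : ℝ)| := by exact_mod_cast Int.one_le_abs hk0
  have hμr : (1 / z) ^ 2 / (1 + r) ≤ d2 η r := by
    have := hη.le_mu hr0.le (hr.2.le.trans htτ)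
    rw [← hz2, div_le_iff₀ (by positivity)] at this
    rw [div_pow, one_pow, div_div, div_le_iff₀ (by positivity)]
    linarith
  generalize (k : ℝ) * κ * d1 η r + 2 * p = x
  have hpos : 0 < x ^ 2 + (1 / z) ^ 2 := by positivity
  have e2 : |x * (x / (x ^ 2 + (1 / z) ^ 2)) - 1| / (1 + r)
      ≤ 1 / κ * (|(k : ℝ)| * κ * d2 η r) / (x ^ 2 + (1 / z) ^ 2) := by
    rw [abs_mul_div_sq_add_sub_one hl, div_right_comm]
    have : 1 / κ * (|(k : ℝ)| * κ * d2 η r) = |(k : ℝ)| * d2 η r := by field_simp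
    rw [this]
    exact div_le_div_of_nonneg_right (hμr.trans (le_mul_of_one_le_left hd2.le hk1)) hpos.le
  have e4 : |((1 / z) ^ 2 - x ^ 2) / (x ^ 2 + (1 / z) ^ 2) ^ 2| * (|(k : ℝ)| * κ * d2 η r) / (1 + r)
      ≤ 1 / (x ^ 2 + (1 / z) ^ 2) * (|(k : ℝ)| * κ * d2 η r) := by
    refine (div_le_self (by positivity) (by linarith)).trans ?_
    exact mul_le_mul_of_nonneg_right (abs_deriv_div_sq_add_le hl x) (by positivity)
  refine (add_le_add e2 e4).trans (le_of_eq ?_)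
  ring

/-- After the time `τ` every mode stays at distance `ε` from resonance. -/
lemma EnergyPair.nonresonant_le {σ₀ η : ℝ → ℝ} (hη : AdmissiblePhase η)
    {κ p ρ m A δ τ : ℝ} {E B : ℝ → ℝ} {P : ℝ → ℂ}
    (hE : EnergyPair (dissipation σ₀ η) p ρ E P) (hρ : 0 ≤ ρ) (hp : 0 < p) (hκ : 0 < κ)
    (hBc : Continuous B) (hB : ∀ t, 0 < t → HasDerivAt B (dissipation σ₀ η t) t)
    (hm : |m| ≤ A) (hσ : ∀ x, |σ₀ x| ≤ A) {F : Finset ℤ} (hF0 : (0 : ℤ) ∉ F) {c : ℤ → ℂ}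
    (hcA : ∑ k ∈ F, ‖c k‖ ≤ A)
    (hδ : ∀ x : ℝ, ‖(m : ℂ) + ∑ k ∈ F, c k * Complex.exp (Complex.I * (k * κ * x : ℝ)) - σ₀ x‖ ≤ δ)
    {ε : ℝ} (hε : 0 < ε) (hτ0 : 0 ≤ τ) (hτ : 2 * p + ε ≤ κ * d1 η τ)
    {s t : ℝ} (hs : τ ≤ s) (hst : s ≤ t) (hsA : A / p + 2 * (A / ε) ≤ 1 + s)
    (hδt : δ * Real.log (1 + t) ≤ 1) (hρt : ρ * t ≤ 1) :
    E t * Real.exp (B t)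
      ≤ 3 * (E s * Real.exp (B s)) * Real.exp (7 + A + 2 * Real.pi * A * (2 / ε)) := by
  have hx : ∀ r, τ ≤ r → ∀ k ∈ F, ε ≤ |(k : ℝ) * κ * d1 η r + 2 * p| := by
    intro r hr k hk
    have hk0 : k ≠ 0 := fun h => hF0 (h ▸ hk)
    have hk1 : 1 ≤ |(k : ℝ)| := by exact_mod_cast Int.one_le_abs hk0
    have h1 : d1 η τ ≤ d1 η r := hη.strictMonoOn_d1.monotoneOn hτ0 (hτ0.trans hr) hr
    have h2 := hη.d1_pos r (hτ0.trans hr)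
    have h3 : κ * d1 η τ ≤ |(k : ℝ)| * (κ * d1 η r) :=
      le_trans (by gcongr) (le_mul_of_one_le_left (by positivity) hk1)
    have h4 : |(k : ℝ) * κ * d1 η r| = |(k : ℝ)| * (κ * d1 η r) := by
      rw [mul_assoc, abs_mul, abs_of_pos (mul_pos hκ h2)]
    have h5 := abs_sub_abs_le_abs_sub ((k : ℝ) * κ * d1 η r) (-(2 * p))
    rw [sub_neg_eq_add, abs_neg, h4, abs_of_pos (by positivity : 0 < 2 * p)] at h5
    linarith
  refine hE.hyperbolic_le hη (h := fun x => x⁻¹) (h' := fun x => -(x ^ 2)⁻¹) hρ hp hκ hε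
    zero_le_two hBc hB hm hσ hcA hδ (hτ0.trans hs) hst ?_ ?_ ?_ hsA hδt hρt
  · intro r hr k hk
    have h1 := hx r (hs.trans hr.1) k hk
    refine hasDerivAt_inv fun h => ?_
    rw [h, abs_zero] at h1
    linarith
  · intro r hr k hk
    have h1 := hx r (hs.trans hr.1) k hk
    rw [abs_inv, one_div]
    exact inv_anti₀ hε h1
  · intro r hr k hk
    have h1 := hx r (hs.trans hr.1.le) k hk
    have hr0 : 0 < r := (hτ0.trans hs).trans_lt hr.1
    have hd2 := hη.d2_pos r hr0.le
    generalize (k : ℝ) * κ * d1 η r + 2 * p = x at h1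
    have hx0 : x ≠ 0 := fun h => by rw [h, abs_zero] at h1; linarith
    have hx2 : ε ^ 2 ≤ x ^ 2 := by rw [← sq_abs x]; gcongr
    rw [mul_inv_cancel₀ hx0, sub_self, abs_zero, zero_div, zero_add, abs_neg,
      abs_of_pos (by positivity : 0 < (x ^ 2)⁻¹)]
    have e1 : (x ^ 2)⁻¹ ≤ 2 / (x ^ 2 + ε ^ 2) := by
      rw [inv_eq_one_div, div_le_div_iff₀ (by positivity) (by positivity)]
      linarith
    refine (div_le_self (by positivity) (by linarith)).trans ?_
    refine (mul_le_mul_of_nonneg_right e1 (by positivity)).trans (le_of_eq ?_)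
    ring

/-- In the hyperbolic zone the energy decays like `(1 + t)^(-m)`. The resonances, which lie before any
time `τ` with `(π/T) η'(τ) ≥ 2p + ε`, cost a factor exponential in `√(μ(τ))`. -/
theorem exists_hyperbolic_le {σ₀ η : ℝ → ℝ} {T : ℝ} (hσ : PeriodicHolder σ₀ T)
    (hη : AdmissiblePhase η) {ε : ℝ} (hε : 0 < ε) :
    ∃ K Q ν : ℝ, 0 < K ∧ 0 < Q ∧ 0 < ν ∧ ∀ {p ρ τ : ℝ} {E : ℝ → ℝ} {P : ℝ → ℂ},
      EnergyPair (dissipation σ₀ η) p ρ E P → 0 ≤ ρ → 0 < p → 0 ≤ τ →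
      2 * p + ε ≤ Real.pi / T * d1 η τ → ∀ {s t : ℝ}, 0 ≤ s → s ≤ t → ρ * t ≤ 1 →
      Q * (1 / p + 1 + Real.sqrt (mu η τ)) ≤ 1 + s →
      E t * (1 + t) ^ mean σ₀ T
        ≤ K * Real.exp (ν * Real.sqrt (mu η τ)) * (E s * (1 + s) ^ mean σ₀ T) := by
  obtain ⟨c, hc, hc0, hsum⟩ := hσ.exists_fourier
  obtain ⟨B, C, -, hBc, hB, hBm⟩ := exists_primitive_dissipation hσ hη
  set m := mean σ₀ T with hm
  set A := ∑' k, ‖c k‖ with hAdef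
  have hT := hσ.period_pos
  set κ := Real.pi / T with hκdef
  have hκ : 0 < κ := div_pos Real.pi_pos hT
  have hA : 0 ≤ A := tsum_nonneg fun _ => norm_nonneg _
  have hmA : |m| ≤ A := by
    have h1 := hc.le_tsum 0 fun _ _ => norm_nonneg _
    rwa [hc0, Complex.norm_real, Real.norm_eq_abs] at h1
  have hσA : ∀ x, |σ₀ x| ≤ A := fun x => by
    have hnorm : ∀ k : ℤ, ‖c k * Complex.exp (Complex.I * (k * κ * x : ℝ))‖ = ‖c k‖ := fun k => by
      rw [norm_mul, mul_comm Complex.I, Complex.norm_exp_ofReal_mul_I, mul_one]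
    have h1 := norm_tsum_le_tsum_norm (f := fun k : ℤ =>
      c k * Complex.exp (Complex.I * (k * κ * x : ℝ))) (by simp only [hnorm]; exact hc)
    rw [(hsum x).tsum_eq, Complex.norm_real, Real.norm_eq_abs] at h1
    simpa only [hnorm] using h1
  have hC0 : 0 ≤ C := (abs_nonneg _).trans (hBm 0 le_rfl)
  set K₁ := 3 * Real.exp (7 + A) with hK₁
  set K₂ := 3 * Real.exp (7 + A + 2 * Real.pi * A * (2 / ε)) with hK₂
  set ν := 2 * Real.pi * A * (1 + 1 / κ) + 1 with hν
  have hpi := Real.pi_pos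
  have hν0 : 0 < ν := by positivity
  have hK₁1 : 1 ≤ K₁ := by
    have := Real.one_le_exp (by positivity : 0 ≤ 7 + A)
    linarith
  have hK₂1 : 1 ≤ K₂ := by
    have := Real.one_le_exp (by positivity : 0 ≤ 7 + A + 2 * Real.pi * A * (2 / ε))
    linarith
  refine ⟨Real.exp (2 * C) * (K₁ * K₂), 2 * A + 2 * A / ε + 1, ν, by positivity, by positivity, hν0, ?_⟩
  intro p ρ τ E P hE hρ hp hτ0 hτ s t hs hst hρt hs1
  set z := Real.sqrt (mu η τ) with hz
  have hμ := hη.mu_pos hτ0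
  have hz0 : 0 < z := Real.sqrt_pos.2 hμ
  have hz2 : z ^ 2 = mu η τ := Real.sq_sqrt hμ.le
  have hcF : ∀ F : Finset ℤ, ∑ k ∈ F, ‖c k‖ ≤ A := fun F => hc.sum_le_tsum F fun _ _ => norm_nonneg _
  have hexpz : 1 ≤ Real.exp (ν * z) := Real.one_le_exp (by positivity)
  have hz3 : A / p + 2 * (A / (1 / z)) ≤ 1 + s ∧ A / p + 2 * (A / ε) ≤ 1 + s := by
    have a1 : 0 ≤ A / p := by positivity
    have a2 : 0 ≤ A / ε := by positivity
    have a3 : 0 ≤ A * z := by positivity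
    have a4 : 0 ≤ A / ε * z := by positivity
    have a5 : 0 ≤ A / ε * (1 / p) := by positivity
    have a6 : 0 < 1 / p := by positivity
    have e1 : (2 * A + 2 * A / ε + 1) * (1 / p + 1 + z) = 2 * (A / p) + 2 * A + 2 * (A * z)
      + 2 * (A / ε * (1 / p)) + 2 * (A / ε) + 2 * (A / ε * z) + 1 / p + 1 + z := by ring
    have e2 : A / (1 / z) = A * z := by field_simp
    rw [e1] at hs1
    rw [e2]
    constructor <;> linarith
  -- Up to the time `τ`. The truncation of the Fourier series depends on the time: its tail is to be
  -- integrated against `1 / (1 + t)`.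
  have phase1 : ∀ t', s ≤ t' → t' ≤ t → t' ≤ τ →
      E t' * Real.exp (B t') ≤ K₁ * Real.exp (ν * z) * (E s * Real.exp (B s)) := by
    intro t' hst' htt' htτ
    have hlog : 0 ≤ Real.log (1 + t') := Real.log_nonneg (by linarith)
    obtain ⟨F, hF0, hF⟩ := exists_finset_fourier_sub_le hc hc0 hsum
      (by positivity : 0 < 1 / (1 + Real.log (1 + t')))
    have hδt : 1 / (1 + Real.log (1 + t')) * Real.log (1 + t') ≤ 1 := by
      rw [div_mul_eq_mul_div, one_mul, div_le_one (by positivity)]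
      linarith
    have key := hE.resonant_le hη hρ hp hκ hBc hB hmA hσA hF0 (hcF F) hF hs hst' htτ
      hz3.1 hδt (le_trans (mul_le_mul_of_nonneg_left htt' hρ) hρt)
    refine key.trans ?_
    have hEs := hE.nonneg hs
    have e1 : 7 + A + 2 * Real.pi * A * ((1 + 1 / κ) * z) ≤ (7 + A) + ν * z := by
      rw [hν]; linarith
    calc 3 * (E s * Real.exp (B s)) * Real.exp (7 + A + 2 * Real.pi * A * ((1 + 1 / κ) * z))
        ≤ 3 * (E s * Real.exp (B s)) * Real.exp ((7 + A) + ν * z) := by gcongr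
      _ = _ := by rw [Real.exp_add, hK₁]; ring
  -- after the time `τ`
  have phase2 : ∀ s', s ≤ s' → s' ≤ t → τ ≤ s' →
      E t * Real.exp (B t) ≤ K₂ * (E s' * Real.exp (B s')) := by
    intro s' hss' hst' hsτ
    have hlog : 0 ≤ Real.log (1 + t) := Real.log_nonneg (by linarith)
    obtain ⟨F, hF0, hF⟩ := exists_finset_fourier_sub_le hc hc0 hsum
      (by positivity : 0 < 1 / (1 + Real.log (1 + t)))
    have hδt : 1 / (1 + Real.log (1 + t)) * Real.log (1 + t) ≤ 1 := by
      rw [div_mul_eq_mul_div, one_mul, div_le_one (by positivity)]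
      linarith
    have key := hE.nonresonant_le hη hρ hp hκ hBc hB hmA hσA hF0 (hcF F) hF hε hτ0 hτ hsτ hst'
      (hz3.2.trans (by linarith)) hδt hρt
    refine key.trans (le_of_eq ?_)
    rw [hK₂]; ring
  have main : E t * Real.exp (B t) ≤ K₁ * K₂ * Real.exp (ν * z) * (E s * Real.exp (B s)) := by
    have hXs : 0 ≤ E s * Real.exp (B s) := mul_nonneg (hE.nonneg hs) (Real.exp_pos _).le
    rcases le_total τ s with h1 | h1
    · refine (phase2 s le_rfl hst h1).trans (mul_le_mul_of_nonneg_right ?_ hXs)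
      calc K₂ = 1 * K₂ * 1 := by ring
        _ ≤ K₁ * K₂ * Real.exp (ν * z) := by gcongr
    · rcases le_total t τ with h2 | h2
      · refine (phase1 t hst le_rfl h2).trans (mul_le_mul_of_nonneg_right ?_ hXs)
        gcongr
        exact le_mul_of_one_le_right (by positivity) hK₂1
      · refine (phase2 τ h1 h2 le_rfl).trans ?_
        refine (mul_le_mul_of_nonneg_left (phase1 τ h1 h2 le_rfl) (by positivity)).trans (le_of_eq ?_)
        ring
  have hpow : ∀ r, 0 ≤ r → (1 + r) ^ m ≤ Real.exp C * Real.exp (B r) ∧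
      Real.exp (B r) ≤ Real.exp C * (1 + r) ^ m := by
    intro r hr
    have h1 := abs_le.1 (hBm r hr)
    rw [Real.rpow_def_of_pos (by linarith), ← Real.exp_add, ← Real.exp_add, Real.exp_le_exp,
      Real.exp_le_exp, mul_comm (Real.log _)]
    constructor <;> linarith
  calc E t * (1 + t) ^ m ≤ E t * (Real.exp C * Real.exp (B t)) :=
        mul_le_mul_of_nonneg_left (hpow t (hs.trans hst)).1 (hE.nonneg (hs.trans hst))
    _ = Real.exp C * (E t * Real.exp (B t)) := by ring
    _ ≤ Real.exp C * (K₁ * K₂ * Real.exp (ν * z) * (E s * Real.exp (B s))) := by gcongr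
    _ ≤ Real.exp C * (K₁ * K₂ * Real.exp (ν * z) * (E s * (Real.exp C * (1 + s) ^ m))) := by
        have := hE.nonneg hs
        gcongr
        exact (hpow s hs).2
    _ = _ := by
        rw [show 2 * C = C + C by ring, Real.exp_add]; ring


/-! ### Hilbert space valued solutions at one frequency -/

/-- A curve `U` with velocity `W` in a Hilbert space that solves `U'' + p² U + b U' = f`, where the
perturbation `f` comes from replacing the frequencies in a thin shell below `p` by `p`. -/
structure ShellSolution {H : Type*} [NormedAddCommGroup H] [InnerProductSpace ℂ H] [NormedSpace ℝ H]
    (b : ℝ → ℝ) (p θ : ℝ) (U W f : ℝ → H) : Prop where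
  continuousOn_fst : ContinuousOn U (Ici 0)
  continuousOn_snd : ContinuousOn W (Ici 0)
  deriv_fst : ∀ t, 0 < t → HasDerivAt U (W t) t
  deriv_snd : ∀ t, 0 < t →
    HasDerivAt W (-((p ^ 2 : ℝ) : ℂ) • U t - (b t : ℂ) • W t + f t) t
  norm_le : ∀ t, 0 < t → ‖f t‖ ≤ 2 * p * θ * ‖U t‖
  norm_sub_le : ∀ t, 0 < t → ‖f t - ((p ^ 2 : ℝ) : ℂ) • U t‖ ≤ p ^ 2 * ‖U t‖

/-- The mean value inequality, with the derivative bounded in the open interval only. -/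
lemma norm_sub_le_of_norm_deriv_le {H : Type*} [NormedAddCommGroup H] [NormedSpace ℝ H]
    {f f' : ℝ → H} {g g' : ℝ → ℝ} {a b : ℝ} (hab : a ≤ b)
    (hf : ContinuousOn f (Icc a b)) (hg : ContinuousOn g (Icc a b))
    (hf' : ∀ t ∈ Ioo a b, HasDerivAt f (f' t) t) (hg' : ∀ t ∈ Ioo a b, HasDerivAt g (g' t) t)
    (h : ∀ t ∈ Ioo a b, ‖f' t‖ ≤ g' t) : ‖f b - f a‖ ≤ g b - g a := by
  obtain ⟨φ, hφ, hφx⟩ := exists_dual_vector'' ℝ (f b - f a)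
  have h1 := sub_le_sub_of_deriv_le hab (φ.continuous.comp_continuousOn hf) hg
    (fun t ht => φ.hasFDerivAt.comp_hasDerivAt t (hf' t ht)) hg' fun t ht => by
      calc φ (f' t) ≤ ‖φ (f' t)‖ := le_abs_self _
        _ ≤ 1 * ‖f' t‖ := φ.le_of_opNorm_le hφ _
        _ ≤ g' t := by rw [one_mul]; exact h t ht
  simp only [Function.comp] at h1
  rw [← map_sub, hφx] at h1
  exact h1

namespace ShellSolution

variable {H : Type*} [NormedAddCommGroup H] [InnerProductSpace ℂ H] [NormedSpace ℝ H]
  {b : ℝ → ℝ} {p θ : ℝ} {U W f : ℝ → H}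

open scoped InnerProductSpace

/-- The quadratic quantities of a shell solution; the perturbation enters their linear system with
errors of relative size `θ`. -/
lemma energyPair (h : ShellSolution b p θ U W f) (hp : 0 < p) (hθ : 0 ≤ θ) :
    EnergyPair b p (6 * θ) (fun t => ‖W t‖ ^ 2 + p ^ 2 * ‖U t‖ ^ 2)
      (fun t => ((‖W t‖ ^ 2 - p ^ 2 * ‖U t‖ ^ 2 : ℝ) : ℂ)
        + Complex.I * ((2 * p * (⟪U t, W t⟫_ℂ).re : ℝ) : ℂ)) := by
  have hsq : ∀ {V V' : ℝ → H} {t : ℝ}, HasDerivAt V (V' t) t →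
      HasDerivAt (fun t => ‖V t‖ ^ 2) (2 * (⟪V t, V' t⟫_ℂ).re) t := by
    intro V V' t hV
    have h1 := Complex.reCLM.hasFDerivAt.comp_hasDerivAt t (hV.inner ℂ hV)
    refine (h1.congr_deriv ?_).congr_of_eventuallyEq (Eventually.of_forall fun s => ?_)
    · simp only [Complex.reCLM_apply, Complex.add_re]
      rw [← inner_conj_symm (V' t) (V t), Complex.conj_re]; ring
    · simp only [Function.comp, Complex.reCLM_apply]
      exact norm_sq_eq_re_inner (𝕜 := ℂ) (V s)
  have hW' : ∀ t, 0 < t → HasDerivAt (fun t => ‖W t‖ ^ 2)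
      (-(2 * p ^ 2 * (⟪U t, W t⟫_ℂ).re) - 2 * b t * ‖W t‖ ^ 2 + 2 * (⟪W t, f t⟫_ℂ).re) t := by
    intro t ht
    refine (hsq (V' := fun t => -((p ^ 2 : ℝ) : ℂ) • U t - (b t : ℂ) • W t + f t)
      (h.deriv_snd t ht)).congr_deriv ?_
    have e1 : (⟪W t, U t⟫_ℂ).re = (⟪U t, W t⟫_ℂ).re := by
      rw [← inner_conj_symm (W t) (U t), Complex.conj_re]
    have e2 : (⟪W t, W t⟫_ℂ).re = ‖W t‖ ^ 2 := (norm_sq_eq_re_inner (𝕜 := ℂ) (W t)).symm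
    simp only [inner_add_right, inner_sub_right, inner_smul_right, neg_smul, inner_neg_right,
      Complex.add_re, Complex.sub_re, Complex.neg_re, Complex.re_ofReal_mul, e1, e2]
    ring
  have hU' : ∀ t, 0 < t → HasDerivAt (fun t => ‖U t‖ ^ 2) (2 * (⟪U t, W t⟫_ℂ).re) t :=
    fun t ht => hsq (h.deriv_fst t ht)
  have hUW' : ∀ t, 0 < t → HasDerivAt (fun t => (⟪U t, W t⟫_ℂ).re)
      (‖W t‖ ^ 2 - p ^ 2 * ‖U t‖ ^ 2 - b t * (⟪U t, W t⟫_ℂ).re + (⟪U t, f t⟫_ℂ).re) t := by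
    intro t ht
    have h1 := Complex.reCLM.hasFDerivAt.comp_hasDerivAt t
      ((h.deriv_fst t ht).inner ℂ (h.deriv_snd t ht))
    refine h1.congr_deriv ?_
    have e2 : (⟪W t, W t⟫_ℂ).re = ‖W t‖ ^ 2 := (norm_sq_eq_re_inner (𝕜 := ℂ) (W t)).symm
    have e3 : (⟪U t, U t⟫_ℂ).re = ‖U t‖ ^ 2 := (norm_sq_eq_re_inner (𝕜 := ℂ) (U t)).symm
    simp only [inner_add_right, inner_sub_right, inner_smul_right, neg_smul, inner_neg_right,
      Complex.reCLM_apply, Complex.add_re, Complex.sub_re, Complex.neg_re, Complex.re_ofReal_mul,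
      e2, e3]
    ring
  have hinner : ∀ x y : H, |(⟪x, y⟫_ℂ).re| ≤ ‖x‖ * ‖y‖ := fun x y =>
    (Complex.abs_re_le_norm _).trans (norm_inner_le_norm x y)
  have hE0 : ∀ t, 2 * p * ‖U t‖ * ‖W t‖ ≤ ‖W t‖ ^ 2 + p ^ 2 * ‖U t‖ ^ 2 := fun t => by
    nlinarith [sq_nonneg (‖W t‖ - p * ‖U t‖)]
  have hfW : ∀ t, 0 < t → |(⟪W t, f t⟫_ℂ).re| ≤ θ * (‖W t‖ ^ 2 + p ^ 2 * ‖U t‖ ^ 2) := by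
    intro t ht
    refine (hinner _ _).trans ?_
    have h1 := mul_le_mul_of_nonneg_left (h.norm_le t ht) (norm_nonneg (W t))
    have h2 := mul_le_mul_of_nonneg_left (hE0 t) hθ
    linarith
  have hfU : ∀ t, 0 < t → p * |(⟪U t, f t⟫_ℂ).re| ≤ 2 * θ * (‖W t‖ ^ 2 + p ^ 2 * ‖U t‖ ^ 2) := by
    intro t ht
    have h1 := mul_le_mul_of_nonneg_left (hinner (U t) (f t)) hp.le
    have h2 := mul_le_mul_of_nonneg_left (h.norm_le t ht)
      (mul_nonneg hp.le (norm_nonneg (U t)))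
    have h3 : 0 ≤ θ * ‖W t‖ ^ 2 := by positivity
    linarith
  refine ⟨?_, ?_, ?_, ?_, ?_⟩
  · exact (h.continuousOn_snd.norm.pow 2).add
      (continuousOn_const.mul (h.continuousOn_fst.norm.pow 2))
  · refine (Complex.continuous_ofReal.comp_continuousOn ((h.continuousOn_snd.norm.pow 2).sub
      (continuousOn_const.mul (h.continuousOn_fst.norm.pow 2)))).add
      (continuousOn_const.mul (Complex.continuous_ofReal.comp_continuousOn (continuousOn_const.mul
        (Complex.continuous_re.comp_continuousOn
          (h.continuousOn_fst.inner (𝕜 := ℂ) h.continuousOn_snd)))))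
  · intro t _
    have h1 := hinner (U t) (W t)
    have h2 : ((⟪U t, W t⟫_ℂ).re) ^ 2 ≤ (‖U t‖ * ‖W t‖) ^ 2 := sq_le_sq' (abs_le.1 h1).1 (abs_le.1 h1).2
    refine le_of_sq_le_sq ?_ (by positivity)
    rw [← Complex.normSq_eq_norm_sq, Complex.normSq_apply]
    simp only [Complex.add_re, Complex.add_im, Complex.ofReal_re, Complex.ofReal_im, Complex.mul_re,
      Complex.mul_im, Complex.I_re, Complex.I_im]
    have h3 := mul_le_mul_of_nonneg_left h2 (by positivity : 0 ≤ 4 * p ^ 2)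
    linarith
  · intro t ht
    refine ⟨2 * (⟪W t, f t⟫_ℂ).re, ?_, ?_⟩
    · rw [abs_mul, abs_two]
      have : 0 ≤ θ * (‖W t‖ ^ 2 + p ^ 2 * ‖U t‖ ^ 2) := by positivity
      linarith [hfW t ht]
    · refine ((hW' t ht).add ((hU' t ht).const_mul (p ^ 2))).congr_deriv ?_
      simp only [Complex.add_re, Complex.ofReal_re, Complex.ofReal_im, Complex.mul_re,
        Complex.I_re, Complex.I_im]
      ring
  · intro t ht
    refine ⟨((2 * (⟪W t, f t⟫_ℂ).re : ℝ) : ℂ) + Complex.I * ((2 * p * (⟪U t, f t⟫_ℂ).re : ℝ) : ℂ),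
      ?_, ?_⟩
    · refine (norm_add_le _ _).trans ?_
      rw [norm_mul, Complex.norm_I, one_mul, Complex.norm_real, Complex.norm_real,
        Real.norm_eq_abs, Real.norm_eq_abs, abs_mul, abs_mul, abs_mul, abs_two, abs_of_pos hp]
      linarith [hfW t ht, hfU t ht]
    · have h1 := ((hW' t ht).sub ((hU' t ht).const_mul (p ^ 2))).ofReal_comp.add
        ((((hUW' t ht).const_mul (2 * p)).ofReal_comp).const_mul Complex.I)
      refine h1.congr_deriv ?_
      push_cast
      linear_combination (-4 * (p : ℂ) ^ 2 * (⟪U t, W t⟫_ℂ).re) * Complex.I_sq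

/-- In the elliptic zone `(1 + t) p ≤ n` the friction dominates: `U` stays bounded up to the
growth `(1 + t)^(1 - a)` produced by the velocity, and the energy decays like `(1 + t)^(-2a)`. -/
lemma elliptic_le [IsScalarTower ℝ ℂ H] (h : ShellSolution b p θ U W f) (hp : 0 < p)
    {B I I' : ℝ → ℝ} {m a C K n t : ℝ}
    (hm : 0 ≤ m) (ha : a ≤ m) (ha1 : a ≤ 1) (hB0 : B 0 = 0) (hBc : Continuous B)
    (hB : ∀ t, 0 < t → HasDerivAt B (b t) t)
    (hBm : ∀ t, 0 ≤ t → |B t - m * Real.log (1 + t)| ≤ C)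
    (hI0 : 0 ≤ I 0) (hIc : ContinuousOn I (Ici 0))
    (hI : ∀ t, 0 < t → HasDerivAt I (I' t) t) (hI' : ∀ t, 0 < t → (1 + t) ^ (-m) ≤ I' t)
    (hIle : ∀ t, 0 ≤ t → I t ≤ K * (1 + t) ^ (1 - a)) (hn : 0 ≤ n)
    (hn1 : Real.exp (2 * C) * n ^ 2 ≤ 1 / 2) (ht : 0 ≤ t) (htp : (1 + t) * p ≤ n) :
    p * ‖U t‖ ≤ 2 * n * (1 + t) ^ (-a) * (‖U 0‖ + Real.exp C * K * ‖W 0‖) ∧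
    ‖W t‖ ≤ Real.exp C * (1 + t) ^ (-a) * ‖W 0‖ + Real.exp (2 * C) * n *
      (2 * n * (1 + t) ^ (-a) * (‖U 0‖ + Real.exp C * K * ‖W 0‖)) := by
  have hsub : Icc 0 t ⊆ Ici 0 := fun r hr => hr.1
  have hexp : ∀ s, 0 ≤ s → Real.exp (B s) ≤ Real.exp C * (1 + s) ^ m ∧
      Real.exp (-B s) ≤ Real.exp C * (1 + s) ^ (-m) := by
    intro s hs
    have h1 := abs_le.1 (hBm s hs)
    rw [Real.rpow_def_of_pos (by linarith), Real.rpow_def_of_pos (by linarith), ← Real.exp_add,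
      ← Real.exp_add, Real.exp_le_exp, Real.exp_le_exp]
    constructor <;> linarith
  obtain ⟨x, hx, hmax⟩ := isCompact_Icc.exists_isMaxOn (nonempty_Icc.2 ht)
    (h.continuousOn_fst.norm.mono hsub)
  set R := ‖U x‖ with hR
  have hR0 : 0 ≤ R := norm_nonneg _
  have hRle : ∀ s ∈ Icc 0 t, ‖U s‖ ≤ R := fun s hs => hmax hs
  set c := Real.exp C with hc
  have hc0 : 0 < c := Real.exp_pos C
  have hcc : Real.exp (2 * C) = c * c := by rw [hc, ← Real.exp_add]; congr 1; ring
  rw [hcc] at hn1 ⊢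
  have hK : 0 ≤ K := by
    have := hI0.trans (hIle 0 le_rfl)
    simpa using this
  -- `exp B • W` has derivative `exp B • (f - p² U)`, which gives the bound on the velocity
  have hW : ∀ s ∈ Icc 0 t, ‖W s‖ ≤ c * (1 + s) ^ (-m) * ‖W 0‖ + c * c * p ^ 2 * R * (1 + s) := by
    intro s hs
    have hs1 : 0 < 1 + s := by linarith [hs.1]
    have hsub' : Icc 0 s ⊆ Ici 0 := fun r hr => hr.1
    have hid : ContinuousOn (fun r : ℝ => 1 + r) (Icc 0 s) := by fun_prop
    have key := norm_sub_le_of_norm_deriv_le hs.1 (f := fun r => ((Real.exp (B r) : ℝ) : ℂ) • W r)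
      (f' := fun r => ((Real.exp (B r) : ℝ) : ℂ) • (f r - ((p ^ 2 : ℝ) : ℂ) • U r))
      (g := fun r => c * p ^ 2 * R * (1 + r) ^ (m + 1))
      (g' := fun r => c * p ^ 2 * R * ((m + 1) * (1 + r) ^ m))
      ((Complex.continuous_ofReal.comp (Real.continuous_exp.comp hBc)).continuousOn.smul
        (h.continuousOn_snd.mono hsub'))
      (continuousOn_const.mul (hid.rpow_const fun r hr => Or.inr (by linarith)))
      (fun r hr => ?_) (fun r hr => ?_) (fun r hr => ?_)
    · simp only [hB0, Real.exp_zero, Complex.ofReal_one, one_smul, add_zero, Real.one_rpow] at key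
      have h1 : ‖((Real.exp (B s) : ℝ) : ℂ) • W s‖ ≤ ‖W 0‖ + c * p ^ 2 * R * (1 + s) ^ (m + 1) := by
        have h2 := norm_le_norm_add_norm_sub' (((Real.exp (B s) : ℝ) : ℂ) • W s) (W 0)
        have h3 : 0 ≤ c * p ^ 2 * R * 1 := by positivity
        linarith
      rw [norm_smul, Complex.norm_real, Real.norm_eq_abs, abs_of_pos (Real.exp_pos _)] at h1
      have h4 : ‖W s‖ = Real.exp (-B s) * (Real.exp (B s) * ‖W s‖) := by
        rw [← mul_assoc, ← Real.exp_add, neg_add_cancel, Real.exp_zero, one_mul]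
      have h5 : (1 + s) ^ (-m) * (1 + s) ^ (m + 1) = 1 + s := by
        rw [← Real.rpow_add hs1, neg_add_cancel_left, Real.rpow_one]
      rw [h4]
      calc _ ≤ c * (1 + s) ^ (-m) * (‖W 0‖ + c * p ^ 2 * R * (1 + s) ^ (m + 1)) :=
            mul_le_mul (hexp s hs.1).2 h1 (by positivity) (by positivity)
        _ = c * (1 + s) ^ (-m) * ‖W 0‖
            + c * c * p ^ 2 * R * ((1 + s) ^ (-m) * (1 + s) ^ (m + 1)) := by ring
        _ = _ := by rw [h5]
    · have h1 := (hB r hr.1).exp.ofReal_comp.smul (h.deriv_snd r hr.1)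
      refine h1.congr_deriv ?_
      push_cast
      module
    · have h1 : HasDerivAt (fun r : ℝ => 1 + r) 1 r := (hasDerivAt_id r).const_add 1
      have h2 := (h1.rpow_const (p := m + 1) (Or.inl (by linarith [hr.1]))).const_mul
        (c * p ^ 2 * R)
      refine h2.congr_deriv ?_
      rw [add_sub_cancel_right]; ring
    · have hr1 : 0 < 1 + r := by linarith [hr.1]
      have hrt : r ∈ Icc 0 t := ⟨hr.1.le, hr.2.le.trans hs.2⟩
      rw [norm_smul, Complex.norm_real, Real.norm_eq_abs, abs_of_pos (Real.exp_pos _)]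
      have h1 : ‖f r - ((p ^ 2 : ℝ) : ℂ) • U r‖ ≤ p ^ 2 * R :=
        (h.norm_sub_le r hr.1).trans (mul_le_mul_of_nonneg_left (hRle r hrt) (sq_nonneg p))
      have h2 : 0 ≤ c * (1 + r) ^ m * (p ^ 2 * R) := by positivity
      calc _ ≤ c * (1 + r) ^ m * (p ^ 2 * R) :=
            mul_le_mul (hexp r hr.1.le).1 h1 (norm_nonneg _) (by positivity)
        _ ≤ (m + 1) * (c * (1 + r) ^ m * (p ^ 2 * R)) := le_mul_of_one_le_left h2 (by linarith)
        _ = _ := by ring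
  -- integrating the velocity; the last term is absorbed, since `n` is small
  have hU : R ≤ ‖U 0‖ + c * K * (1 + t) ^ (1 - a) * ‖W 0‖ + c * c * n ^ 2 * R := by
    have hsub' : Icc 0 x ⊆ Ici 0 := fun r hr => hr.1
    have key := norm_sub_le_of_norm_deriv_le hx.1 (f := U) (f' := W)
      (g := fun r => c * ‖W 0‖ * I r + c * c * p ^ 2 * R * ((1 + r) ^ 2 / 2))
      (g' := fun r => c * ‖W 0‖ * I' r + c * c * p ^ 2 * R * (1 + r))
      (h.continuousOn_fst.mono hsub')
      ((continuousOn_const.mul (hIc.mono hsub')).add (by fun_prop))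
      (fun r hr => h.deriv_fst r hr.1) (fun r hr => ?_) (fun r hr => ?_)
    · have h2 := norm_le_norm_add_norm_sub' (U x) (U 0)
      have h3 : c * ‖W 0‖ * I x ≤ c * ‖W 0‖ * (K * (1 + t) ^ (1 - a)) := by
        refine mul_le_mul_of_nonneg_left ((hIle x hx.1).trans ?_) (by positivity)
        have := Real.rpow_le_rpow (by linarith [hx.1]) (by linarith [hx.2] : 1 + x ≤ 1 + t)
          (by linarith : 0 ≤ 1 - a)
        gcongr
      have h4 : 0 ≤ c * ‖W 0‖ * I 0 := by positivity
      have h5 : c * c * p ^ 2 * R * ((1 + x) ^ 2 / 2) ≤ c * c * n ^ 2 * R := by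
        have h6 : (1 + x) * p ≤ n := le_trans (by have := hx.2; gcongr) htp
        have h7 : ((1 + x) * p) ^ 2 ≤ n ^ 2 :=
          pow_le_pow_left₀ (mul_nonneg (by linarith [hx.1]) hp.le) h6 2
        have h8 : 0 ≤ c * c * R := by positivity
        have h9 := mul_le_mul_of_nonneg_left h7 h8
        have h10 : 0 ≤ c * c * R * ((1 + x) * p) ^ 2 := by positivity
        linarith
      have h6 : 0 ≤ c * c * p ^ 2 * R * ((1 + 0) ^ 2 / 2) := by positivity
      rw [hR]
      linarith
    · have h1 : HasDerivAt (fun r : ℝ => 1 + r) 1 r := (hasDerivAt_id r).const_add 1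
      refine (((hI r hr.1).const_mul (c * ‖W 0‖)).add
        (((h1.pow 2).div_const 2).const_mul (c * c * p ^ 2 * R))).congr_deriv ?_
      simp
    · have h1 := mul_le_mul_of_nonneg_left (hI' r hr.1) (by positivity : 0 ≤ c * ‖W 0‖)
      linarith [hW r ⟨hr.1.le, hr.2.le.trans hx.2⟩]
  have ht1 : 1 ≤ 1 + t := by linarith
  have ht0 : 0 < 1 + t := by linarith
  have hR2 : R ≤ 2 * (1 + t) ^ (1 - a) * (‖U 0‖ + c * K * ‖W 0‖) := by
    have h1 := mul_le_mul_of_nonneg_right hn1 hR0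
    have h2 : ‖U 0‖ ≤ (1 + t) ^ (1 - a) * ‖U 0‖ :=
      le_mul_of_one_le_left (norm_nonneg _) (Real.one_le_rpow ht1 (by linarith))
    linarith
  have hpR : p * R ≤ 2 * n * (1 + t) ^ (-a) * (‖U 0‖ + c * K * ‖W 0‖) := by
    have h1 : (1 + t) ^ (1 - a) = (1 + t) * (1 + t) ^ (-a) := by
      rw [sub_eq_add_neg, Real.rpow_add ht0, Real.rpow_one]
    rw [h1] at hR2
    calc p * R ≤ p * (2 * ((1 + t) * (1 + t) ^ (-a)) * (‖U 0‖ + c * K * ‖W 0‖)) := by gcongr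
      _ = ((1 + t) * p) * (2 * (1 + t) ^ (-a) * (‖U 0‖ + c * K * ‖W 0‖)) := by ring
      _ ≤ n * (2 * (1 + t) ^ (-a) * (‖U 0‖ + c * K * ‖W 0‖)) := by gcongr
      _ = _ := by ring
  refine ⟨(mul_le_mul_of_nonneg_left (hRle t (right_mem_Icc.2 ht)) hp.le).trans hpR, ?_⟩
  refine (hW t (right_mem_Icc.2 ht)).trans (add_le_add ?_ ?_)
  · have := Real.rpow_le_rpow_of_exponent_le ht1 (neg_le_neg ha)
    gcongr
  · calc c * c * p ^ 2 * R * (1 + t) = c * c * ((1 + t) * p) * (p * R) := by ring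
      _ ≤ _ := by gcongr

end ShellSolution

/-! ### Decay of the energy at one frequency -/

/-- A primitive that dominates `(1 + t)^(-m)` and grows at most like `(1 + t)^(1 - min 1 (m / 2))`. -/
lemma exists_primitive_rpow {m : ℝ} (hm : 0 < m) :
    ∃ (I I' : ℝ → ℝ) (K : ℝ), 0 ≤ I 0 ∧ ContinuousOn I (Ici 0) ∧
      (∀ t, 0 < t → HasDerivAt I (I' t) t) ∧ (∀ t, 0 < t → (1 + t) ^ (-m) ≤ I' t) ∧
      ∀ t, 0 ≤ t → I t ≤ K * (1 + t) ^ (1 - min 1 (m / 2)) := by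
  have hid : ContinuousOn (fun r : ℝ => 1 + r) (Ici 0) := by fun_prop
  have hd : ∀ t : ℝ, HasDerivAt (fun r : ℝ => 1 + r) 1 t := fun t => (hasDerivAt_id t).const_add 1
  rcases lt_or_ge (m / 2) 1 with h | h
  · rw [min_eq_right h.le]
    have ham := half_le_self hm.le
    set a := m / 2
    refine ⟨fun t => (1 - a)⁻¹ * (1 + t) ^ (1 - a), fun t => (1 + t) ^ (-a), (1 - a)⁻¹, ?_, ?_, ?_, ?_,
      fun t _ => le_rfl⟩
    · have : 0 < 1 - a := by linarith
      simp only [add_zero, Real.one_rpow]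
      positivity
    · exact continuousOn_const.mul (hid.rpow_const fun r hr => Or.inr (by linarith))
    · intro t ht
      have h2 := ((hd t).rpow_const (p := 1 - a) (Or.inl (by linarith))).const_mul (1 - a)⁻¹
      refine h2.congr_deriv ?_
      have : 1 - a ≠ 0 := by linarith
      rw [show 1 - a - 1 = -a by ring]
      field_simp
    · intro t ht
      exact Real.rpow_le_rpow_of_exponent_le (by linarith) (by linarith)
  · rw [min_eq_left h, sub_self]
    refine ⟨fun t => 1 - (1 + t)⁻¹, fun t => 1 / (1 + t) ^ 2, 1, by simp, ?_, ?_, ?_, ?_⟩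
    · exact continuousOn_const.sub (hid.inv₀ fun r hr => by
        have : (0 : ℝ) ≤ r := hr
        positivity)
    · intro t ht
      refine (((hd t).inv (by positivity)).const_sub 1).congr_deriv ?_
      ring
    · intro t ht
      beta_reduce
      rw [one_div, ← Real.rpow_natCast, ← Real.rpow_neg (by positivity)]
      refine Real.rpow_le_rpow_of_exponent_le (by linarith) ?_
      push_cast
      linarith
    · intro t ht
      rw [Real.rpow_zero, mul_one]
      have : 0 ≤ (1 + t)⁻¹ := by positivity
      linarith

lemma PeriodicHolder.exists_bound {σ₀ : ℝ → ℝ} {T : ℝ} (h : PeriodicHolder σ₀ T) :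
    ∃ A, 0 ≤ A ∧ ∀ x, |σ₀ x| ≤ A := by
  have hT := h.period_pos
  obtain ⟨A, hA⟩ := (h.periodic.isBounded_of_continuous (by positivity) h.continuous).exists_norm_le
  exact ⟨A, (norm_nonneg _).trans (hA _ ⟨0, rfl⟩), fun x => hA _ ⟨x, rfl⟩⟩

/-- The trivial energy estimate: the energy grows at most at the rate `2|b| ≤ 2A / (1 + t)`. -/
lemma EnergyPair.le_rpow_mul {σ₀ η : ℝ → ℝ} {A p ρ : ℝ} {E : ℝ → ℝ} {P : ℝ → ℂ}
    (hE : EnergyPair (dissipation σ₀ η) p ρ E P) (hσ : ∀ x, |σ₀ x| ≤ A) (hρ : 0 ≤ ρ) {s t : ℝ}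
    (hs : 0 ≤ s) (hst : s ≤ t) (hρt : ρ * t ≤ 1) :
    E t ≤ Real.exp 1 * ((1 + t) / (1 + s)) ^ (2 * A) * E s := by
  have hs1 : 0 < 1 + s := by linarith
  have ht1 : 0 < 1 + t := by linarith
  have hid : ContinuousOn (fun r : ℝ => 1 + r) (Icc s t) := by fun_prop
  have key := hE.le_mul_exp (G := fun r => 2 * A * Real.log (1 + r) + ρ * r)
    (G' := fun r => 2 * A / (1 + r) + ρ) hs hst
    ((continuousOn_const.mul (hid.log fun r hr => by linarith [hr.1])).add (by fun_prop))
    (fun r hr => ?_) (fun r hr => ?_)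
  · refine key.trans ?_
    rw [mul_comm]
    have hEs := hE.nonneg hs
    refine mul_le_mul_of_nonneg_right ?_ hEs
    rw [Real.rpow_def_of_pos (by positivity), ← Real.exp_add, Real.exp_le_exp,
      Real.log_div ht1.ne' hs1.ne']
    have : 0 ≤ ρ * s := by positivity
    linarith
  · have hr1 : 1 + r ≠ 0 := by linarith [hr.1]
    have h1 : HasDerivAt (fun r : ℝ => 1 + r) 1 r := (hasDerivAt_id r).const_add 1
    refine (((h1.log hr1).const_mul (2 * A)).add ((hasDerivAt_id r).const_mul ρ)).congr_deriv ?_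
    ring
  · have hr1 : 0 < 1 + r := by linarith [hr.1]
    rw [dissipation, abs_div, abs_of_pos hr1, mul_div_assoc]
    have := hσ (η r)
    gcongr

set_option maxHeartbeats 400000 in
/-- The energy estimate at one frequency `p`. The elliptic zone `(1 + t) p ≤ n`, where friction
dominates, is followed by an interval in which `1 + t` grows by a factor of order `1 + √μ`, and by the
hyperbolic zone. The middle part costs a power of `1 + √μ`, which is absorbed in the exponential. -/
theorem exists_shell_energy_le {H : Type*} [NormedAddCommGroup H] [InnerProductSpace ℂ H]
    [NormedSpace ℝ H] [IsScalarTower ℝ ℂ H] {σ₀ η : ℝ → ℝ} {T : ℝ} (hσ : PeriodicHolder σ₀ T)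
    (hη : AdmissiblePhase η) (hm : 0 < mean σ₀ T) {ε : ℝ} (hε : 0 < ε) :
    ∃ K ν : ℝ, 0 < K ∧ 0 < ν ∧ ∀ {p θ τ t : ℝ} {U W f : ℝ → H},
      ShellSolution (dissipation σ₀ η) p θ U W f → 0 < p → 0 ≤ θ → 0 ≤ τ →
      2 * p + ε ≤ Real.pi / T * d1 η τ → 0 ≤ t → 6 * θ * t ≤ 1 →
      ‖W t‖ ^ 2 + p ^ 2 * ‖U t‖ ^ 2 ≤ K * (1 + t) ^ (-min 2 (mean σ₀ T)) *
        Real.exp (ν * Real.sqrt (mu η τ)) * ((1 + p ^ 2) * ‖U 0‖ ^ 2 + ‖W 0‖ ^ 2) := by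
  obtain ⟨A, hA0, hA⟩ := hσ.exists_bound
  obtain ⟨B, C, hB0, hBc, hB, hBm⟩ := exists_primitive_dissipation hσ hη
  obtain ⟨K₁, Q, ν₁, hK₁, hQ, hν₁, hyp⟩ := exists_hyperbolic_le hσ hη hε
  obtain ⟨I, I', KI, hI0, hIc, hI, hI', hIle⟩ := exists_primitive_rpow hm
  set m := mean σ₀ T
  set a := min 1 (m / 2) with ha
  have ha2 : min 2 m = 2 * a := by
    rw [ha, mul_min_of_nonneg _ _ zero_le_two]; congr 1 <;> ring
  have ha0 : 0 < a := lt_min one_pos (by linarith)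
  have ham : 2 * a ≤ m := by rw [← ha2]; exact min_le_right _ _
  have hKI : 0 ≤ KI := by simpa using hI0.trans (hIle 0 le_rfl)
  set c := Real.exp C with hc
  have hc0 : 0 < c := Real.exp_pos C
  have hcc : Real.exp (2 * C) = c * c := by rw [hc, ← Real.exp_add]; congr 1; ring
  set n := 1 / (2 * c) with hn
  have hn0 : 0 < n := by positivity
  have hn1 : Real.exp (2 * C) * n ^ 2 ≤ 1 / 2 := by
    rw [hcc, hn]; field_simp; norm_num
  set k₁ := 2 * n * (1 + c * KI) with hk₁
  set k₂ := c + c * c * n * k₁ with hk₂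
  have hk₁0 : 0 ≤ k₁ := by positivity
  have hk₂0 : 0 ≤ k₂ := by positivity
  set K₂ := 1 + 2 * (k₁ ^ 2 + k₂ ^ 2) with hK₂
  have hK₂1 : 1 ≤ K₂ := by have : 0 ≤ 2 * (k₁ ^ 2 + k₂ ^ 2) := by positivity
                           linarith
  set q := 2 * A + 2 * a with hq
  have hq0 : 0 < q := by positivity
  set K₃ := 1 + Q * (1 / n + 1) with hK₃
  have hK₃1 : 1 ≤ K₃ := by have : 0 ≤ Q * (1 / n + 1) := by positivity
                           linarith
  have hK₃q : 1 ≤ K₃ ^ q := Real.one_le_rpow hK₃1 hq0.le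
  refine ⟨(1 + K₁) * (Real.exp 1 * K₃ ^ q * K₂), ν₁ + q, by positivity, by positivity, ?_⟩
  intro p θ τ t U W f hS hp hθ hτ0 hτ ht hθt
  rw [ha2]
  set z := Real.sqrt (mu η τ) with hz
  have hz0 : 0 ≤ z := Real.sqrt_nonneg _
  have hE := hS.energyPair hp hθ
  set E : ℝ → ℝ := fun t => ‖W t‖ ^ 2 + p ^ 2 * ‖U t‖ ^ 2 with hEdef
  set Data := (1 + p ^ 2) * ‖U 0‖ ^ 2 + ‖W 0‖ ^ 2 with hData
  have hD0 : 0 ≤ Data := by positivity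
  -- it suffices to bound the weighted energy `E (1 + t)^(2a)`
  suffices hmain : E t * (1 + t) ^ (2 * a)
      ≤ (1 + K₁) * (Real.exp 1 * K₃ ^ q * K₂) * Real.exp ((ν₁ + q) * z) * Data by
    have ht0 : 0 < 1 + t := by linarith
    have h1 := mul_le_mul_of_nonneg_right hmain (Real.rpow_nonneg ht0.le (-(2 * a)))
    rw [mul_assoc, ← Real.rpow_add ht0, add_neg_cancel, Real.rpow_zero, mul_one] at h1
    refine h1.trans (le_of_eq ?_)
    ring
  have elliptic : ∀ s, 0 ≤ s → (1 + s) * p ≤ n → E s * (1 + s) ^ (2 * a) ≤ K₂ * Data := by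
    intro s hs hsp
    have hs0 : 0 < 1 + s := by linarith
    obtain ⟨h1, h2⟩ := hS.elliptic_le hp hm.le (by linarith : a ≤ m) (min_le_left _ _) hB0 hBc hB hBm
      hI0 hIc hI hI' hIle hn0.le hn1 hs hsp
    rw [hcc] at h2
    set x := ‖U 0‖
    set y := ‖W 0‖
    have hx : 0 ≤ x := norm_nonneg _
    have hy : 0 ≤ y := norm_nonneg _
    set d := (1 + s) ^ (-a) with hd
    have hd0 : 0 < d := Real.rpow_pos_of_pos hs0 _
    have h3 : p * ‖U s‖ ≤ d * (k₁ * (x + y)) := by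
      refine h1.trans ?_
      have : x + c * KI * y ≤ (1 + c * KI) * (x + y) := by
        have : 0 ≤ c * KI * x := by positivity
        linarith
      calc 2 * n * d * (x + c * KI * y) ≤ 2 * n * d * ((1 + c * KI) * (x + y)) := by gcongr
        _ = _ := by rw [hk₁]; ring
    have h4 : ‖W s‖ ≤ d * (k₂ * (x + y)) := by
      refine h2.trans ?_
      have h5 : x + c * KI * y ≤ (1 + c * KI) * (x + y) := by
        have : 0 ≤ c * KI * x := by positivity
        linarith
      have h6 : c * d * y ≤ c * d * (x + y) := by gcongr; linarith
      calc c * d * y + c * c * n * (2 * n * d * (x + c * KI * y))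
          ≤ c * d * (x + y) + c * c * n * (2 * n * d * ((1 + c * KI) * (x + y))) := by gcongr
        _ = _ := by rw [hk₂, hk₁]; ring
    have h5 : d ^ 2 * (1 + s) ^ (2 * a) = 1 := by
      rw [hd, ← Real.rpow_natCast, ← Real.rpow_mul hs0.le, ← Real.rpow_add hs0]
      convert Real.rpow_zero _ using 2
      push_cast; ring
    have h6 : E s ≤ d ^ 2 * ((k₁ ^ 2 + k₂ ^ 2) * (x + y) ^ 2) := by
      have h7 := pow_le_pow_left₀ (by positivity) h3 2
      have h8 := pow_le_pow_left₀ (norm_nonneg _) h4 2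
      simp only [hEdef]
      linarith
    have h7 : (x + y) ^ 2 ≤ 2 * Data := by
      have h8 : 0 ≤ p ^ 2 * x ^ 2 := by positivity
      have h9 := sq_nonneg (x - y)
      rw [hData]
      linarith
    calc E s * (1 + s) ^ (2 * a)
        ≤ d ^ 2 * ((k₁ ^ 2 + k₂ ^ 2) * (x + y) ^ 2) * (1 + s) ^ (2 * a) := by gcongr
      _ = (d ^ 2 * (1 + s) ^ (2 * a)) * ((k₁ ^ 2 + k₂ ^ 2) * (x + y) ^ 2) := by ring
      _ ≤ 1 * ((k₁ ^ 2 + k₂ ^ 2) * (2 * Data)) := by rw [h5]; gcongr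
      _ ≤ K₂ * Data := by rw [hK₂]; linarith
  have naive : ∀ s r, 0 ≤ s → s ≤ r → r ≤ t → E r * (1 + r) ^ (2 * a)
      ≤ Real.exp 1 * ((1 + r) / (1 + s)) ^ q * (E s * (1 + s) ^ (2 * a)) := by
    intro s r hs hsr hrt
    have hs0 : 0 < 1 + s := by linarith
    have hr0 : 0 < 1 + r := by linarith
    have h1 := hE.le_rpow_mul hA (by positivity) hs hsr
      (le_trans (mul_le_mul_of_nonneg_left hrt (by positivity)) hθt)
    have h2 : (1 + r) ^ (2 * a) = ((1 + r) / (1 + s)) ^ (2 * a) * (1 + s) ^ (2 * a) := by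
      rw [← Real.mul_rpow (by positivity) hs0.le, div_mul_cancel₀ _ hs0.ne']
    calc E r * (1 + r) ^ (2 * a)
        ≤ Real.exp 1 * ((1 + r) / (1 + s)) ^ (2 * A) * E s * (1 + r) ^ (2 * a) := by gcongr
      _ = Real.exp 1 * (((1 + r) / (1 + s)) ^ (2 * A) * ((1 + r) / (1 + s)) ^ (2 * a))
          * (E s * (1 + s) ^ (2 * a)) := by rw [h2]; ring
      _ = _ := by rw [← Real.rpow_add (by positivity)]
  have hexpz : 1 ≤ Real.exp ((ν₁ + q) * z) := Real.one_le_exp (by positivity)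
  have hexp1 : 1 ≤ Real.exp 1 := Real.one_le_exp zero_le_one
  rcases le_or_gt ((1 + t) * p) n with hcase | hcase
  · refine (elliptic t ht hcase).trans ?_
    calc K₂ * Data = 1 * (1 * 1 * K₂) * 1 * Data := by ring
      _ ≤ _ := by gcongr; linarith
  -- the elliptic zone ends at `s`
  set s := max 0 (n / p - 1) with hs
  have hs0 : 0 ≤ s := le_max_left _ _
  have hsn : n / p ≤ 1 + s := by linarith [le_max_right 0 (n / p - 1)]
  have hst : s ≤ t := max_le ht (by
    have : n / p ≤ 1 + t := by rw [div_le_iff₀ hp]; exact hcase.le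
    linarith)
  have hEs : E s * (1 + s) ^ (2 * a) ≤ K₂ * Data := by
    rcases le_total (n / p - 1) 0 with h1 | h1
    · have h2 : s = 0 := max_eq_left h1
      rw [h2, add_zero, Real.one_rpow, mul_one]
      refine le_trans ?_ (le_mul_of_one_le_left hD0 hK₂1)
      simp only [hEdef, hData]
      linarith [sq_nonneg ‖U 0‖]
    · refine elliptic s hs0 (le_of_eq ?_)
      rw [hs, max_eq_right h1]
      field_simp
      ring
  set L := 1 + Q * (1 / n + 1 + z) with hL
  have hL1 : 1 ≤ L := by have : 0 ≤ Q * (1 / n + 1 + z) := by positivity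
                         linarith
  have hLq : L ^ q ≤ K₃ ^ q * Real.exp (q * z) := by
    have h1 : L ≤ K₃ * Real.exp z := by
      have h2 := Real.add_one_le_exp z
      have h3 : 0 ≤ Q * (1 / n) * z := by positivity
      calc L ≤ K₃ * (z + 1) := by rw [hL, hK₃]; linarith
        _ ≤ _ := by gcongr
    calc L ^ q ≤ (K₃ * Real.exp z) ^ q := Real.rpow_le_rpow (by linarith) h1 hq0.le
      _ = _ := by
        rw [Real.mul_rpow (by positivity) (Real.exp_pos z).le, ← Real.exp_mul, mul_comm z q]
  have hs1 : 0 < 1 + s := by linarith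
  -- until `s'` the energy is estimated without using oscillations
  set s' := (1 + s) * L - 1 with hs'
  have hs's : 1 + s' = (1 + s) * L := by rw [hs']; ring
  have hss' : s ≤ s' := by
    have := le_mul_of_one_le_right hs1.le hL1
    linarith
  have hmid : ∀ r, s ≤ r → r ≤ s' → r ≤ t → E r * (1 + r) ^ (2 * a)
      ≤ Real.exp 1 * K₃ ^ q * K₂ * Real.exp (q * z) * Data := by
    intro r hsr hrs' hrt
    have h0 : 0 ≤ E s * (1 + s) ^ (2 * a) := mul_nonneg (hE.nonneg hs0) (by positivity)
    have h1 : (1 + r) / (1 + s) ≤ L := by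
      rw [div_le_iff₀ hs1]; linarith
    have h1' : 0 ≤ (1 + r) / (1 + s) := div_nonneg (by linarith) hs1.le
    calc E r * (1 + r) ^ (2 * a)
        ≤ Real.exp 1 * ((1 + r) / (1 + s)) ^ q * (E s * (1 + s) ^ (2 * a)) :=
          naive s r hs0 hsr hrt
      _ ≤ Real.exp 1 * (K₃ ^ q * Real.exp (q * z)) * (K₂ * Data) := by
          have := (Real.rpow_le_rpow h1' h1 hq0.le).trans hLq
          gcongr
      _ = _ := by ring
  rcases le_total t s' with hts' | hts'
  · refine (hmid t hst hts' le_rfl).trans ?_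
    calc Real.exp 1 * K₃ ^ q * K₂ * Real.exp (q * z) * Data
        = 1 * (Real.exp 1 * K₃ ^ q * K₂) * Real.exp (q * z) * Data := by ring
      _ ≤ _ := by
        gcongr
        · linarith
        · linarith
  · have hs'0 : 0 ≤ s' := hs0.trans hss'
    have h1 : Q * (1 / p + 1 + z) ≤ 1 + s' := by
      have h2 : 1 / p ≤ (1 + s) * (1 / n) := by
        rw [mul_one_div, div_le_div_iff₀ hp hn0]
        rw [div_le_iff₀ hp] at hsn
        linarith
      have h3 : 1 / p + 1 + z ≤ (1 + s) * (1 / n + 1 + z) := by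
        have : 0 ≤ s * (1 + z) := by positivity
        linarith
      have h4 := mul_le_mul_of_nonneg_left h3 hQ.le
      rw [hs's, hL]
      linarith
    have h2 := hyp hE (by positivity) hp hτ0 hτ hs'0 hts' hθt h1
    have ht0 : 0 < 1 + t := by linarith
    have hs'1 : 0 < 1 + s' := by linarith
    have h3 : ∀ r : ℝ, 0 < 1 + r → (1 + r) ^ (2 * a) = (1 + r) ^ m * (1 + r) ^ (2 * a - m) := by
      intro r hr
      rw [← Real.rpow_add hr]; congr 1; ring
    have h4 : (1 + t) ^ (2 * a - m) ≤ (1 + s') ^ (2 * a - m) :=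
      Real.rpow_le_rpow_of_nonpos hs'1 (by linarith) (by linarith)
    have hEs' := hE.nonneg hs'0
    calc E t * (1 + t) ^ (2 * a) = E t * (1 + t) ^ m * (1 + t) ^ (2 * a - m) := by
          rw [h3 t ht0, mul_assoc]
      _ ≤ K₁ * Real.exp (ν₁ * z) * (E s' * (1 + s') ^ m) * (1 + s') ^ (2 * a - m) := by gcongr
      _ = K₁ * Real.exp (ν₁ * z) * (E s' * (1 + s') ^ (2 * a)) := by rw [h3 s' hs'1]; ring
      _ ≤ K₁ * Real.exp (ν₁ * z) * (Real.exp 1 * K₃ ^ q * K₂ * Real.exp (q * z) * Data) := by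
          have := hmid s' hss' le_rfl hts'
          gcongr
      _ = K₁ * (Real.exp 1 * K₃ ^ q * K₂) * (Real.exp (ν₁ * z) * Real.exp (q * z)) * Data := by ring
      _ = K₁ * (Real.exp 1 * K₃ ^ q * K₂) * Real.exp ((ν₁ + q) * z) * Data := by
          rw [← Real.exp_add, ← add_mul]
      _ ≤ _ := by
          have : 0 ≤ Real.exp 1 * K₃ ^ q * K₂ * Real.exp ((ν₁ + q) * z) * Data := by positivity
          linarith


/-! ### The equation on the Fourier side -/

section FourierSide

variable {d : ℕ}

/-- Multiplication by a bounded measurable function is a bounded operator on `L²`. -/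
lemma exists_mul_clm {a : Space d → ℂ} (ha : Measurable a) {C : ℝ} (hC : ∀ x, ‖a x‖ ≤ C) :
    ∃ M : L2 d →L[ℂ] L2 d, ∀ f : L2 d, M f =ᵐ[volume] fun x => a x * f x := by
  have hm : MemLp a ∞ (volume : Measure (Space d)) :=
    memLp_top_of_bound ha.aestronglyMeasurable C (ae_of_all _ hC)
  refine ⟨(ContinuousLinearMap.mul ℂ ℂ).holderL volume ∞ 2 2 (hm.toLp a), fun f => ?_⟩
  rw [ContinuousLinearMap.holderL_apply_apply]
  filter_upwards [(ContinuousLinearMap.mul ℂ ℂ).coeFn_holder (r := 2) (hm.toLp a) f,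
    hm.coeFn_toLp] with x h1 h2
  rw [h1, h2, ContinuousLinearMap.mul_apply']

/-- If the product of `u ∈ L²` with a symbol is the distribution given by `v ∈ L²`, it is so almost
everywhere. -/
lemma ae_eq_of_smulLeftCLM_eq {P : Space d → ℂ} (hP : P.HasTemperateGrowth) {u v : L2 d}
    (h : TemperedDistribution.smulLeftCLM ℂ P (distrib u) = distrib v) :
    v =ᵐ[volume] fun x => P x * u x := by
  have hu : LocallyIntegrable u (volume : Measure (Space d)) :=
    (Lp.memLp u).locallyIntegrable (by norm_num)
  have hPu : LocallyIntegrable (fun x => P x * u x) (volume : Measure (Space d)) := by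
    rw [← locallyIntegrableOn_univ] at hu ⊢
    exact hu.continuousOn_mul hP.1.continuous.continuousOn isOpen_univ.isLocallyClosed
  refine ae_eq_of_integral_contDiff_smul_eq ((Lp.memLp v).locallyIntegrable (by norm_num)) hPu ?_
  intro g hg hgc
  have hg₁ : HasCompactSupport (Complex.ofRealCLM ∘ g) := hgc.comp_left rfl
  have hg₂ : ContDiff ℝ (⊤ : ℕ∞) (Complex.ofRealCLM ∘ g) := by fun_prop
  have h1 := congrArg (fun D : 𝓢'(Space d, ℂ) => D (hg₁.toSchwartzMap hg₂)) h
  simp only [TemperedDistribution.smulLeftCLM_apply_apply, Lp.toTemperedDistribution_apply] at h1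
  refine Eq.trans ?_ (h1.symm.trans ?_)
  · refine integral_congr_ae (ae_of_all _ fun x => ?_)
    simp
  · refine integral_congr_ae (ae_of_all _ fun x => ?_)
    simp [hP]
    ring

lemma fourier_gradient_ae_eq {u g : L2 d} {e : Space d}
    (h : ∂_{e} (distrib u) = distrib g) :
    (𝓕 g : L2 d) =ᵐ[volume] fun x =>
      (2 * Real.pi * Complex.I * (inner ℝ x e : ℝ)) * (𝓕 u : L2 d) x := by
  have h1 := congrArg (fun D : 𝓢'(Space d, ℂ) => 𝓕 D) h
  simp only [TemperedDistribution.fourier_lineDerivOp_eq] at h1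
  have e1 : 𝓕 (distrib u) = distrib (𝓕 u : L2 d) := Lp.fourier_toTemperedDistribution_eq u
  have e2 : 𝓕 (distrib g) = distrib (𝓕 g : L2 d) := Lp.fourier_toTemperedDistribution_eq g
  rw [e1, e2] at h1
  have hg : (fun x : Space d => ((inner ℝ x e : ℝ) : ℂ)).HasTemperateGrowth := by fun_prop
  have h2 := TemperedDistribution.smulLeftCLM_smul (F := ℂ) hg (2 * Real.pi * Complex.I)
  refine ae_eq_of_smulLeftCLM_eq (P := fun x => 2 * Real.pi * Complex.I * (inner ℝ x e : ℝ))
    (by fun_prop) ?_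
  rw [← h1]
  exact DFunLike.congr_fun h2 (distrib (𝓕 u : L2 d))

lemma fourier_laplacian_ae_eq {V Y : L2 d} (h : Δ (distrib V) = distrib Y) :
    (𝓕 Y : L2 d) =ᵐ[volume] fun x =>
      ((-(2 * Real.pi * ‖x‖) ^ 2 : ℝ) : ℂ) * (𝓕 V : L2 d) x := by
  have h1 := congrArg (fun D : 𝓢'(Space d, ℂ) => 𝓕 D) h
  have hg : (fun x : Space d => ((‖x‖ ^ 2 : ℝ) : ℂ)).HasTemperateGrowth := by fun_prop
  have e1 : 𝓕 (distrib V) = distrib (𝓕 V : L2 d) := Lp.fourier_toTemperedDistribution_eq V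
  have e2 : 𝓕 (distrib Y) = distrib (𝓕 Y : L2 d) := Lp.fourier_toTemperedDistribution_eq Y
  have e3 : 𝓕 (Δ (distrib V)) = ((-(2 * Real.pi) ^ 2 : ℝ) : ℂ) • TemperedDistribution.smulLeftCLM ℂ
      (fun x : Space d => ((‖x‖ ^ 2 : ℝ) : ℂ)) (distrib (𝓕 V : L2 d)) := by
    rw [TemperedDistribution.laplacian_eq_fourierMultiplierCLM,
      TemperedDistribution.fourierMultiplierCLM_apply, ← Complex.coe_smul,
      FourierTransform.fourier_smul, FourierTransform.fourier_fourierInv_eq, e1]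
  simp only [e2, e3] at h1
  have h2 := TemperedDistribution.smulLeftCLM_smul (F := ℂ) hg ((-(2 * Real.pi) ^ 2 : ℝ) : ℂ)
  have h3 : TemperedDistribution.smulLeftCLM ℂ (((-(2 * Real.pi) ^ 2 : ℝ) : ℂ) •
      (fun x : Space d => ((‖x‖ ^ 2 : ℝ) : ℂ))) (distrib (𝓕 V : L2 d)) = distrib (𝓕 Y : L2 d) := by
    rw [h2, ← h1]; rfl
  have h4 := ae_eq_of_smulLeftCLM_eq (by fun_prop) h3
  filter_upwards [h4] with x hx
  rw [hx]
  simp only [Pi.smul_apply, smul_eq_mul]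
  push_cast
  ring

end FourierSide

/-! ### Frequency shells -/

section Shell

variable {d : ℕ}

/-- Testing the distribution given by an `L²` function against a fixed Schwartz function is a
continuous linear functional. -/
lemma exists_clm_distrib (φ : 𝓢(Space d, ℂ)) :
    ∃ L : L2 d →L[ℂ] ℂ, ∀ f : L2 d, L f = distrib f φ :=
  ⟨(PointwiseConvergenceCLM.evalCLM (RingHom.id ℂ) ℂ φ).comp
    (Lp.toTemperedDistributionCLM ℂ (volume : Measure (Space d)) 2), fun _ => rfl⟩

lemma _root_.ContinuousOn.intervalIntegrable_zero {F : Type*} [NormedAddCommGroup F]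
    {f : ℝ → F} (hf : ContinuousOn f (Ici 0)) {t : ℝ} (ht : 0 ≤ t) :
    IntervalIntegrable f volume 0 t :=
  (hf.mono (by rw [uIcc_of_le ht]; exact Icc_subset_Ici_self)).intervalIntegrable

lemma PeriodicHolder.continuousOn_dissipation {σ₀ η : ℝ → ℝ} {T : ℝ} (hσ : PeriodicHolder σ₀ T)
    (hη : AdmissiblePhase η) : ContinuousOn (dissipation σ₀ η) (Ici 0) := by
  refine ContinuousOn.div (hσ.continuous.comp_continuousOn hη.contDiffOn.continuousOn)
    (by fun_prop) fun t (ht : 0 ≤ t) => by positivity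

namespace IsEnergySolution

variable {b : ℝ → ℝ} {u₀ u₁ : L2 d} {u : ℝ → L2 d} {g : ℝ → Fin d → L2 d} {w : ℝ → L2 d}

lemma continuousOn (h : IsEnergySolution b u₀ u₁ u g w) : ContinuousOn u (Ici 0) :=
  fun t ht => (h.velocity t ht).continuousWithinAt

lemma continuousOn_smul (h : IsEnergySolution b u₀ u₁ u g w) (hb : ContinuousOn b (Ici 0)) :
    ContinuousOn (fun t => (b t : ℂ) • w t) (Ici 0) :=
  (Complex.continuous_ofReal.comp_continuousOn hb).smul h.velocity_continuousOn

/-- The equation integrated in time: all its terms but the Laplacian are then in `L²`. -/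
lemma laplacian_integral (h : IsEnergySolution b u₀ u₁ u g w) (hb : ContinuousOn b (Ici 0))
    {t : ℝ} (ht : 0 ≤ t) :
    Δ (distrib (∫ s in (0 : ℝ)..t, u s)) =
      distrib (w t - w 0 + ∫ s in (0 : ℝ)..t, (b s : ℂ) • w s) := by
  ext φ
  obtain ⟨L, hL⟩ := exists_clm_distrib φ
  obtain ⟨L', hL'⟩ := exists_clm_distrib (Δ φ)
  have hu := h.continuousOn
  have hbw := h.continuousOn_smul hb
  have key : (∫ s in (0 : ℝ)..t, (L' (u s) - L ((b s : ℂ) • w s))) = L (w t) - L (w 0) := by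
    refine intervalIntegral.integral_eq_sub_of_hasDerivAt_of_le ht
      ((L.continuous.comp_continuousOn h.velocity_continuousOn).mono Icc_subset_Ici_self) ?_ ?_
    · intro s hs
      refine ((h.equation φ s hs.1).congr_deriv ?_).congr_of_eventuallyEq
        (Eventually.of_forall fun r => hL (w r))
      rw [TemperedDistribution.laplacian_apply_apply, hL', map_smul, hL, smul_eq_mul]
    · exact ((L'.continuous.comp_continuousOn hu).sub
        (L.continuous.comp_continuousOn hbw)).intervalIntegrable_zero ht
  have c1 : IntervalIntegrable (fun s => L' (u s)) volume 0 t :=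
    (L'.continuous.comp_continuousOn hu).intervalIntegrable_zero ht
  have c2 : IntervalIntegrable (fun s => L ((b s : ℂ) • w s)) volume 0 t :=
    (L.continuous.comp_continuousOn hbw).intervalIntegrable_zero ht
  rw [intervalIntegral.integral_sub c1 c2, L'.intervalIntegral_comp_comm (hu.intervalIntegrable_zero ht),
    L.intervalIntegral_comp_comm (hbw.intervalIntegrable_zero ht)] at key
  rw [TemperedDistribution.laplacian_apply_apply, ← hL', ← hL, map_add, map_sub, ← key]
  ring

/-- If `S` turns the Laplacian into `N - p²`, then it turns the equation into an ordinary
differential equation with the perturbation `N u`. -/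
lemma hasDerivAt_clm (h : IsEnergySolution b u₀ u₁ u g w) (hb : ContinuousOn b (Ici 0))
    {S N : L2 d →L[ℂ] L2 d} {c : ℂ}
    (hSN : ∀ V Y : L2 d, Δ (distrib V) = distrib Y → S Y = N V - c • S V) {t : ℝ} (ht : 0 < t) :
    HasDerivAt (fun t => S (w t)) (-c • S (u t) - (b t : ℂ) • S (w t) + N (u t)) t := by
  have hu := h.continuousOn
  have hw := h.velocity_continuousOn
  have hbw := h.continuousOn_smul hb
  have k1 : ContinuousOn (fun s => -c • S (u s)) (Ici 0) :=
    (S.continuous.comp_continuousOn hu).const_smul (-c)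
  have k2 : ContinuousOn (fun s => (b s : ℂ) • S (w s)) (Ici 0) :=
    (Complex.continuous_ofReal.comp_continuousOn hb).smul (S.continuous.comp_continuousOn hw)
  have k3 : ContinuousOn (fun s => N (u s)) (Ici 0) := N.continuous.comp_continuousOn hu
  have hWt : ∀ t, 0 ≤ t → S (w t) = S (w 0) +
      ∫ s in (0 : ℝ)..t, (-c • S (u s) - (b s : ℂ) • S (w s) + N (u s)) := by
    intro t ht
    have e2 := hSN _ _ (h.laplacian_integral hb ht)
    set V := ∫ s in (0 : ℝ)..t, u s with hV
    set B := ∫ s in (0 : ℝ)..t, (b s : ℂ) • w s with hB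
    have i1 : (∫ s in (0 : ℝ)..t, -c • S (u s)) = -c • S V := by
      rw [intervalIntegral.integral_smul, S.intervalIntegral_comp_comm
        (hu.intervalIntegrable_zero ht)]
    have i2 : (∫ s in (0 : ℝ)..t, (b s : ℂ) • S (w s)) = S B := by
      rw [hB, ← S.intervalIntegral_comp_comm (hbw.intervalIntegrable_zero ht)]
      simp only [map_smul]
    have i3 : (∫ s in (0 : ℝ)..t, N (u s)) = N V :=
      N.intervalIntegral_comp_comm (hu.intervalIntegrable_zero ht)
    rw [intervalIntegral.integral_add
      ((k1.intervalIntegrable_zero ht).sub (k2.intervalIntegrable_zero ht))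
      (k3.intervalIntegrable_zero ht), intervalIntegral.integral_sub
      (k1.intervalIntegrable_zero ht) (k2.intervalIntegrable_zero ht), i1, i2, i3]
    rw [map_add, map_sub] at e2
    rw [← sub_eq_zero] at e2 ⊢
    rw [← e2]
    module
  have hc := (k1.sub k2).add k3
  have h1 := intervalIntegral.integral_hasDerivAt_right (hc.intervalIntegrable_zero ht.le)
    ((hc.mono Ioi_subset_Ici_self).stronglyMeasurableAtFilter isOpen_Ioi t ht)
    (hc.continuousAt (Ici_mem_nhds ht))
  refine (h1.const_add (S (w 0))).congr_of_eventuallyEq ?_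
  filter_upwards [Ioi_mem_nhds ht] with s hs
  exact hWt s (le_of_lt hs)

end IsEnergySolution

/-- The Fourier transform restricted to a shell of frequencies `2π‖x‖` of width `θ` below `p`, and
the operator by which the Laplacian differs there from `-p²`. -/
lemma exists_shell_operators {p θ : ℝ} (hp : 0 < p) {A : Set (Space d)} (hA : MeasurableSet A)
    (hAp : ∀ x ∈ A, 2 * Real.pi * ‖x‖ ∈ Icc (p - θ) p) :
    ∃ S N : L2 d →L[ℂ] L2 d,
      (∀ v : L2 d, S v =ᵐ[volume] A.indicator (𝓕 v : L2 d)) ∧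
      (∀ V Y : L2 d, Δ (distrib V) = distrib Y → S Y = N V - ((p ^ 2 : ℝ) : ℂ) • S V) ∧
      (∀ v : L2 d, ‖N v‖ ≤ 2 * p * θ * ‖S v‖) ∧
      ∀ v : L2 d, ‖N v - ((p ^ 2 : ℝ) : ℂ) • S v‖ ≤ p ^ 2 * ‖S v‖ := by
  classical
  obtain ⟨I, hI⟩ := exists_mul_clm (d := d) (a := A.indicator fun _ => 1)
    (measurable_const.indicator hA) (C := 1) fun x => by
      by_cases hx : x ∈ A <;> simp [hx]
  set q : Space d → ℝ := fun x => p ^ 2 - (2 * Real.pi * ‖x‖) ^ 2 with hq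
  have hq0 : ∀ x ∈ A, 0 ≤ q x := fun x hx => by
    have := hAp x hx
    have h0 : 0 ≤ 2 * Real.pi * ‖x‖ := by positivity
    simp only [hq]; nlinarith [this.2]
  have hqp : ∀ x ∈ A, q x ≤ p ^ 2 := fun x hx => by simp only [hq]; nlinarith
  have hqθ : ∀ x ∈ A, q x ≤ 2 * p * θ := fun x hx => by
    have := hAp x hx
    have h0 : 0 ≤ 2 * Real.pi * ‖x‖ := by positivity
    simp only [hq]; nlinarith [this.1, this.2, mul_nonneg (sub_nonneg.2 this.2) h0]
  obtain ⟨M, hM⟩ := exists_mul_clm (d := d) (a := A.indicator fun x => (q x : ℂ))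
    (Measurable.indicator (by fun_prop) hA) (C := p ^ 2) fun x => by
      by_cases hx : x ∈ A
      · simp only [indicator_of_mem hx, Complex.norm_real, Real.norm_of_nonneg (hq0 x hx)]
        exact hqp x hx
      · simp only [indicator_of_notMem hx, norm_zero]; positivity
  obtain ⟨F, hF⟩ : ∃ F : L2 d →L[ℂ] L2 d, ∀ v : L2 d, F v = 𝓕 v :=
    ⟨(Lp.fourierTransformₗᵢ (Space d) ℂ).toContinuousLinearEquiv.toContinuousLinearMap,
      fun v => rfl⟩
  have hSa : ∀ v : L2 d, I.comp F v =ᵐ[volume] A.indicator (𝓕 v : L2 d) := fun v => by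
    filter_upwards [hI (F v)] with x hx
    rw [ContinuousLinearMap.comp_apply, hx, hF]
    by_cases hxA : x ∈ A <;> simp [hxA]
  have hNa : ∀ v : L2 d, M.comp F v =ᵐ[volume] fun x => A.indicator (fun x => (q x : ℂ)) x *
      (𝓕 v : L2 d) x := fun v => by
    filter_upwards [hM (F v)] with x hx
    rw [ContinuousLinearMap.comp_apply, hx, hF]
  generalize I.comp F = S at hSa
  generalize M.comp F = N at hNa
  refine ⟨S, N, hSa, fun V Y hVY => Lp.ext ?_, fun v => Lp.norm_le_mul_norm_of_ae_le_mul ?_,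
    fun v => Lp.norm_le_mul_norm_of_ae_le_mul ?_⟩
  · filter_upwards [fourier_laplacian_ae_eq hVY, hSa Y, hNa V, hSa V,
      Lp.coeFn_sub (N V) (((p ^ 2 : ℝ) : ℂ) • S V),
      Lp.coeFn_smul (((p ^ 2 : ℝ) : ℂ)) (S V)] with x h1 h2 h3 h4 h5 h6
    rw [h2, h5, Pi.sub_apply, h6, Pi.smul_apply, h3, h4]
    by_cases hx : x ∈ A
    · simp only [indicator_of_mem hx, h1, hq, smul_eq_mul]
      push_cast; ring
    · simp [hx]
  · filter_upwards [hNa v, hSa v] with x h1 h2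
    rw [h1, h2, norm_mul]
    by_cases hx : x ∈ A
    · simp only [indicator_of_mem hx, Complex.norm_real, Real.norm_of_nonneg (hq0 x hx)]
      exact mul_le_mul_of_nonneg_right (hqθ x hx) (norm_nonneg _)
    · simp [hx]
  · filter_upwards [hNa v, hSa v, Lp.coeFn_sub (N v) (((p ^ 2 : ℝ) : ℂ) • S v),
      Lp.coeFn_smul (((p ^ 2 : ℝ) : ℂ)) (S v)] with x h1 h2 h3 h4
    rw [h3, Pi.sub_apply, h4, Pi.smul_apply, h1, h2]
    by_cases hx : x ∈ A
    · simp only [indicator_of_mem hx, smul_eq_mul, ← sub_mul, norm_mul, ← Complex.ofReal_sub,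
        Complex.norm_real]
      refine mul_le_mul_of_nonneg_right ?_ (norm_nonneg _)
      rw [Real.norm_eq_abs, abs_le]
      exact ⟨by linarith [hq0 x hx], by linarith [hqp x hx, sq_nonneg p]⟩
    · simp [hx]

/-- The frequencies in a thin shell below `p` evolve like the single frequency `p`, up to a small
perturbation. -/
lemma IsEnergySolution.exists_shellSolution {b : ℝ → ℝ} {u₀ u₁ : L2 d} {u : ℝ → L2 d}
    {g : ℝ → Fin d → L2 d} {w : ℝ → L2 d} (h : IsEnergySolution b u₀ u₁ u g w)
    (hb : ContinuousOn b (Ici 0)) {p θ : ℝ} (hp : 0 < p) {A : Set (Space d)} (hA : MeasurableSet A)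
    (hAp : ∀ x ∈ A, 2 * Real.pi * ‖x‖ ∈ Icc (p - θ) p) :
    ∃ (S : L2 d →L[ℂ] L2 d) (f : ℝ → L2 d),
      (∀ v : L2 d, S v =ᵐ[volume] A.indicator (𝓕 v : L2 d)) ∧
      ShellSolution b p θ (fun t => S (u t)) (fun t => S (w t)) f := by
  obtain ⟨S, N, hS, hSN, hN, hN'⟩ := exists_shell_operators hp hA hAp
  exact ⟨S, fun t => N (u t), hS, S.continuous.comp_continuousOn h.continuousOn,
    S.continuous.comp_continuousOn h.velocity_continuousOn,
    fun t ht => (S.restrictScalars ℝ).hasFDerivAt.comp_hasDerivAt t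
      ((h.velocity t ht.le).hasDerivAt (Ici_mem_nhds ht)),
    fun t ht => h.hasDerivAt_clm hb hSN ht, fun t _ => hN (u t), fun t _ => hN' (u t)⟩

end Shell

/-! ### Summation over the shells -/

section Summation

variable {d : ℕ}

lemma ofReal_norm_sq_eq_lintegral (v : L2 d) :
    ENNReal.ofReal (‖v‖ ^ 2) = ∫⁻ x, ENNReal.ofReal (‖v x‖ ^ 2) := by
  have h := eLpNorm_nnreal_pow_eq_lintegral (f := v) (μ := (volume : Measure (Space d)))
    (p := 2) two_ne_zero
  simp only [NNReal.coe_ofNat, ENNReal.rpow_ofNat, ENNReal.coe_ofNat] at h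
  rw [ENNReal.ofReal_pow (norm_nonneg _), ofReal_norm, Lp.enorm_def, h]
  refine lintegral_congr fun x => ?_
  rw [ENNReal.ofReal_pow (norm_nonneg _), ofReal_norm]

lemma measurable_ofReal_norm_sq {a : Space d → ℝ} (ha : Measurable a) (v : L2 d) :
    Measurable fun x => ENNReal.ofReal (a x * ‖v x‖ ^ 2) :=
  (ha.mul ((Lp.stronglyMeasurable v).measurable.norm.pow_const 2)).ennreal_ofReal

lemma measurable_ofReal_mul_norm_sq_add {a : Space d → ℝ} (ha : Measurable a) (v₀ v₁ : L2 d) :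
    Measurable fun x => ENNReal.ofReal (a x * ‖v₀ x‖ ^ 2 + ‖v₁ x‖ ^ 2) :=
  ((ha.mul ((Lp.stronglyMeasurable v₀).measurable.norm.pow_const 2)).add
    ((Lp.stronglyMeasurable v₁).measurable.norm.pow_const 2)).ennreal_ofReal

lemma ofReal_mul_norm_sq_add_of_indicator {A : Set (Space d)} (hA : MeasurableSet A)
    {v₀ v₁ V₀ V₁ : L2 d} (h₀ : V₀ =ᵐ[volume] A.indicator v₀) (h₁ : V₁ =ᵐ[volume] A.indicator v₁)
    {a : ℝ} (ha : 0 ≤ a) :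
    ENNReal.ofReal (a * ‖V₀‖ ^ 2 + ‖V₁‖ ^ 2) =
      ∫⁻ x in A, ENNReal.ofReal (a * ‖v₀ x‖ ^ 2 + ‖v₁ x‖ ^ 2) := by
  rw [ENNReal.ofReal_add (by positivity) (by positivity), ENNReal.ofReal_mul ha,
    ofReal_norm_sq_eq_lintegral, ofReal_norm_sq_eq_lintegral,
    ← lintegral_const_mul' _ _ ENNReal.ofReal_ne_top]
  simp_rw [← ENNReal.ofReal_mul ha]
  rw [← lintegral_add_left (measurable_ofReal_norm_sq measurable_const V₀),
    ← lintegral_indicator hA]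
  refine lintegral_congr_ae ?_
  filter_upwards [h₀, h₁] with x hx₀ hx₁
  rw [hx₀, hx₁, ← ENNReal.ofReal_add (by positivity) (by positivity)]
  by_cases hxA : x ∈ A <;> simp [hxA]

/-- The energy on the Fourier side. -/
lemma IsEnergySolution.ofReal_energy {b : ℝ → ℝ} {u₀ u₁ : L2 d} {u : ℝ → L2 d}
    {g : ℝ → Fin d → L2 d} {w : ℝ → L2 d} (h : IsEnergySolution b u₀ u₁ u g w) {t : ℝ}
    (ht : 0 ≤ t) :
    ENNReal.ofReal (energy g w t) = ∫⁻ x, ENNReal.ofReal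
      ((2 * Real.pi * ‖x‖) ^ 2 * ‖(𝓕 (u t) : L2 d) x‖ ^ 2 + ‖(𝓕 (w t) : L2 d) x‖ ^ 2) := by
  have hg : ∀ j, ENNReal.ofReal (‖g t j‖ ^ 2) = ∫⁻ x : Space d,
      ENNReal.ofReal ((2 * Real.pi * x j) ^ 2 * ‖(𝓕 (u t) : L2 d) x‖ ^ 2) := by
    intro j
    rw [← Lp.norm_fourier_eq, ofReal_norm_sq_eq_lintegral]
    refine lintegral_congr_ae ?_
    filter_upwards [fourier_gradient_ae_eq (h.gradient t ht j)] with x hx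
    have hxj : (inner ℝ x (EuclideanSpace.single j (1 : ℝ) : Space d) : ℝ) = x j := by
      simp [EuclideanSpace.inner_single_right]
    rw [hx, hxj, norm_mul, mul_pow]
    congr 2
    simp [abs_of_pos Real.pi_pos, mul_pow]
  rw [energy, ENNReal.ofReal_add (Finset.sum_nonneg fun _ _ => by positivity) (by positivity),
    ENNReal.ofReal_sum_of_nonneg fun _ _ => by positivity, Finset.sum_congr rfl fun j _ => hg j,
    ← Lp.norm_fourier_eq, ofReal_norm_sq_eq_lintegral, ← lintegral_finsetSum _ fun j _ =>
      measurable_ofReal_norm_sq (by fun_prop) _, ← lintegral_add_left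
      (Finset.measurable_sum _ fun j _ => measurable_ofReal_norm_sq (by fun_prop) _)]
  refine lintegral_congr fun x => ?_
  rw [← ENNReal.ofReal_sum_of_nonneg fun _ _ => by positivity, ← ENNReal.ofReal_add
    (Finset.sum_nonneg fun _ _ => by positivity) (by positivity), ← Finset.sum_mul,
    mul_pow, EuclideanSpace.norm_sq_eq, Finset.mul_sum]
  simp [mul_pow]

/-- The initial energy in a shell of width `θ ≤ 1/2` below `p`, with `p` replaced by the actual
frequencies. -/
lemma ofReal_shell_data_le {p θ : ℝ} (hθ : 0 ≤ θ) (hθ2 : θ ≤ 1 / 2) (hp : 0 < p)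
    {A : Set (Space d)} (hA : MeasurableSet A) (hAp : ∀ x ∈ A, 2 * Real.pi * ‖x‖ ∈ Icc (p - θ) p)
    {v₀ v₁ V₀ V₁ : L2 d} (h₀ : V₀ =ᵐ[volume] A.indicator v₀) (h₁ : V₁ =ᵐ[volume] A.indicator v₁) :
    ENNReal.ofReal ((1 + p ^ 2) * ‖V₀‖ ^ 2 + ‖V₁‖ ^ 2) ≤
      ENNReal.ofReal 2 * ∫⁻ x in A, ENNReal.ofReal
        ((1 + (2 * Real.pi * ‖x‖) ^ 2) * ‖v₀ x‖ ^ 2 + ‖v₁ x‖ ^ 2) := by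
  rw [ofReal_mul_norm_sq_add_of_indicator hA h₀ h₁ (by positivity),
    ← lintegral_const_mul' _ _ ENNReal.ofReal_ne_top]
  refine setLIntegral_mono' hA fun x hx => ?_
  rw [← ENNReal.ofReal_mul (by positivity)]
  refine ENNReal.ofReal_le_ofReal ?_
  have h1 := (hAp x hx).1
  set r := 2 * Real.pi * ‖x‖ with hr
  have hr0 : 0 ≤ r := by positivity
  have h2 : 1 + p ^ 2 ≤ 2 * (1 + r ^ 2) := by
    have : p ≤ r + 1 / 2 := by linarith
    nlinarith [sq_nonneg (r - 1 / 2)]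
  nlinarith [sq_nonneg ‖v₀ x‖, sq_nonneg ‖v₁ x‖]

/-- A bound for all thin shells, with the same constant, sums up to a bound for the energy. -/
lemma IsEnergySolution.energy_le_of_shells {b : ℝ → ℝ} {u₀ u₁ : L2 d} {u : ℝ → L2 d}
    {g : ℝ → Fin d → L2 d} {w : ℝ → L2 d} (h : IsEnergySolution b u₀ u₁ u g w)
    (hb : ContinuousOn b (Ici 0)) {θ t : ℝ} (hθ : 0 < θ) (ht : 0 ≤ t) {c : ℝ≥0∞}
    {D : Space d → ℝ≥0∞}
    (H : ∀ (p : ℝ) (A : Set (Space d)) (S : L2 d →L[ℂ] L2 d) (f : ℝ → L2 d), 0 < p →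
      MeasurableSet A → (∀ x ∈ A, 2 * Real.pi * ‖x‖ ∈ Icc (p - θ) p) →
      (∀ v : L2 d, S v =ᵐ[volume] A.indicator (𝓕 v : L2 d)) →
      ShellSolution b p θ (fun t => S (u t)) (fun t => S (w t)) f →
      ENNReal.ofReal (‖S (w t)‖ ^ 2 + p ^ 2 * ‖S (u t)‖ ^ 2) ≤ c * ∫⁻ x in A, D x) :
    ENNReal.ofReal (energy g w t) ≤ c * ∫⁻ x, D x := by
  set A : ℕ → Set (Space d) := fun i =>
    {x | ⌊2 * Real.pi * ‖x‖ / θ⌋₊ = i} with hAdef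
  have hA : ∀ i, MeasurableSet (A i) := fun i =>
    (Nat.measurable_floor.comp (by fun_prop : Measurable fun x : Space d =>
      2 * Real.pi * ‖x‖ / θ)) (measurableSet_singleton i)
  have hdisj : Pairwise (Function.onFun Disjoint A) := fun i j hij =>
    Set.disjoint_left.2 fun x hi hj => hij (hi.symm.trans hj)
  have hU : ⋃ i, A i = univ := eq_univ_of_forall fun x => mem_iUnion.2 ⟨_, rfl⟩
  have hsum : ∀ F : Space d → ℝ≥0∞, ∫⁻ x, F x = ∑' i, ∫⁻ x in A i, F x := fun F => by
    rw [← lintegral_iUnion hA hdisj, hU, Measure.restrict_univ]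
  rw [h.ofReal_energy ht, hsum, hsum D, ← ENNReal.tsum_mul_left]
  refine ENNReal.tsum_le_tsum fun i => ?_
  have hAp : ∀ x ∈ A i, 2 * Real.pi * ‖x‖ ∈ Icc ((i + 1) * θ - θ) ((i + 1) * θ) := by
    intro x hx
    have h1 : ⌊2 * Real.pi * ‖x‖ / θ⌋₊ = i := hx
    rw [Nat.floor_eq_iff (by positivity), le_div_iff₀ hθ, div_lt_iff₀ hθ] at h1
    exact ⟨by linarith [h1.1], h1.2.le⟩
  have hp : 0 < (i + 1) * θ := by positivity
  obtain ⟨S, f, hS, hf⟩ := h.exists_shellSolution hb hp (hA i) hAp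
  refine le_trans ?_ (H _ (A i) S f hp (hA i) hAp hS hf)
  rw [add_comm, ofReal_mul_norm_sq_add_of_indicator (hA i) (hS (u t)) (hS (w t)) (by positivity)]
  refine setLIntegral_mono' (hA i) fun x hx => ?_
  refine ENNReal.ofReal_le_ofReal ?_
  have h1 := (hAp x hx).2
  gcongr

/-- The change of variables between the two normalizations of the Fourier transform; the weight need
not be measurable. -/
lemma hat_weighted_lintegral (v₀ v₁ : L2 d) (ω : ℝ → ℝ≥0∞) :
    ∫⁻ ξ : Space d, ω ‖ξ‖ * ENNReal.ofReal ((1 + ‖ξ‖ ^ 2) * ‖hat v₀ ξ‖ ^ 2 + ‖hat v₁ ξ‖ ^ 2) =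
      ∫⁻ x : Space d, ω (2 * Real.pi * ‖x‖) * ENNReal.ofReal
        ((1 + (2 * Real.pi * ‖x‖) ^ 2) * ‖(𝓕 v₀ : L2 d) x‖ ^ 2 + ‖(𝓕 v₁ : L2 d) x‖ ^ 2) := by
  have hpi : 0 < 2 * Real.pi := by positivity
  set G : Space d → ℝ≥0∞ := fun x => ω (2 * Real.pi * ‖x‖) * ENNReal.ofReal
        ((1 + (2 * Real.pi * ‖x‖) ^ 2) * ‖(𝓕 v₀ : L2 d) x‖ ^ 2 + ‖(𝓕 v₁ : L2 d) x‖ ^ 2) with hG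
  set k : ℝ := (2 * Real.pi) ^ (-(d : ℝ) / 2) with hk
  have hk2 : k ^ 2 = ((2 * Real.pi) ^ d)⁻¹ := by
    rw [hk, ← Real.rpow_natCast, ← Real.rpow_mul hpi.le, ← Real.rpow_natCast,
      ← Real.rpow_neg hpi.le]
    congr 1; push_cast; ring
  have hne : (2 * Real.pi)⁻¹ ≠ 0 := by positivity
  have h1 : ∀ ξ : Space d, ω ‖ξ‖ *
      ENNReal.ofReal ((1 + ‖ξ‖ ^ 2) * ‖hat v₀ ξ‖ ^ 2 + ‖hat v₁ ξ‖ ^ 2) =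
      ENNReal.ofReal (((2 * Real.pi) ^ d)⁻¹) * G ((2 * Real.pi)⁻¹ • ξ) := by
    intro ξ
    have e1 : 2 * Real.pi * ‖(2 * Real.pi)⁻¹ • ξ‖ = ‖ξ‖ := by
      rw [norm_smul, Real.norm_of_nonneg (by positivity), mul_inv_cancel_left₀ hpi.ne']
    have e2 : ∀ v : L2 d, ‖hat v ξ‖ ^ 2 =
        ((2 * Real.pi) ^ d)⁻¹ * ‖(𝓕 v : L2 d) ((2 * Real.pi)⁻¹ • ξ)‖ ^ 2 := fun v => by
      rw [hat, norm_mul, mul_pow, Complex.norm_real, Real.norm_eq_abs, sq_abs, ← hk, hk2]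
    simp only [hG, e1, e2]
    rw [mul_left_comm (ENNReal.ofReal _), ← ENNReal.ofReal_mul (by positivity)]
    congr 2; ring
  have h2 : ∫⁻ ξ : Space d, G ((2 * Real.pi)⁻¹ • ξ) =
      ENNReal.ofReal ((2 * Real.pi) ^ d) * ∫⁻ x, G x := by
    have h3 := Measure.map_addHaar_smul (volume : Measure (Space d)) hne
    have h4 := (Homeomorph.smulOfNeZero (α := Space d) _ hne).measurableEmbedding.lintegral_map
      (μ := volume) G
    have h5 : Measure.map (Homeomorph.smulOfNeZero (α := Space d) _ hne) volume =
      ENNReal.ofReal ((2 * Real.pi) ^ d) • (volume : Measure (Space d)) := by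
      refine Eq.trans h3 ?_
      rw [finrank_euclideanSpace_fin, inv_pow, inv_inv, abs_of_pos (by positivity)]
    rw [h5, lintegral_smul_measure] at h4
    exact h4.symm
  rw [lintegral_congr h1, lintegral_const_mul' _ _ ENNReal.ofReal_ne_top, h2, ← mul_assoc,
    ← ENNReal.ofReal_mul (by positivity), inv_mul_cancel₀ (by positivity), ENNReal.ofReal_one,
    one_mul]

end Summation

/-! ### The weighted energy estimate -/

lemma decayExponent_eq_min {σ₀ : ℝ → ℝ} {T : ℝ} (hσ : PeriodicHolder σ₀ T)
    (h : NonnegDissipative σ₀ ∨ NonEffectiveDissipative σ₀) :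
    decayExponent σ₀ T = min 2 (mean σ₀ T) := by
  rw [decayExponent]
  split_ifs with hn
  · rfl
  · obtain ⟨m, hm, hlim⟩ := h.resolve_left hn
    rw [hσ.mean_eq_of_tendsto hlim, min_eq_right (by linarith [hm.2])]

lemma NonnegDissipative.mean_nonneg {σ₀ : ℝ → ℝ} {T : ℝ} (hσ : PeriodicHolder σ₀ T)
    (h : NonnegDissipative σ₀) : 0 ≤ mean σ₀ T := by
  have hT := hσ.period_pos
  exact mul_nonneg (by positivity)
    (intervalIntegral.integral_nonneg (by linarith) fun x _ => h x)

section

variable {d : ℕ} {σ₀ η : ℝ → ℝ} {T ε : ℝ}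

/-- If the mean of `σ₀` is positive, the estimate on each shell carries the weight at the
frequencies of this shell. If the weight is infinite there, either the right-hand side is infinite or
the solution vanishes on the shell. -/
lemma exists_weighted_shell_le (hσ : PeriodicHolder σ₀ T) (hη : AdmissiblePhase η)
    (hm : 0 < mean σ₀ T) (hε : 0 < ε) :
    ∃ C ν : ℝ, 0 < C ∧ 0 < ν ∧ ∀ {p θ t : ℝ} {A : Set (Space d)} {S : L2 d →L[ℂ] L2 d}
      {u w f : ℝ → L2 d}, 0 < p → 0 < θ → θ ≤ 1 / 2 → 4 * θ ≤ ε → 6 * θ * t ≤ 1 → 0 ≤ t →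
      MeasurableSet A → (∀ x ∈ A, 2 * Real.pi * ‖x‖ ∈ Icc (p - θ) p) →
      (∀ v : L2 d, S v =ᵐ[volume] A.indicator (𝓕 v : L2 d)) →
      ShellSolution (dissipation σ₀ η) p θ (fun t => S (u t)) (fun t => S (w t)) f →
      ENNReal.ofReal (‖S (w t)‖ ^ 2 + p ^ 2 * ‖S (u t)‖ ^ 2) ≤
        ENNReal.ofReal (C * (1 + t) ^ (-min 2 (mean σ₀ T))) * ∫⁻ x in A,
          EReal.exp (((2 * ν : ℝ) : EReal) *
            zeta η ((T / Real.pi) * (2 * (2 * Real.pi * ‖x‖) + ε))) *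
          ENNReal.ofReal ((1 + (2 * Real.pi * ‖x‖) ^ 2) * ‖(𝓕 (u 0) : L2 d) x‖ ^ 2 +
            ‖(𝓕 (w 0) : L2 d) x‖ ^ 2) := by
  have hT := hσ.period_pos
  have hpi := Real.pi_pos
  obtain ⟨K, ν, hK, hν, hmain⟩ := exists_shell_energy_le (H := L2 d) hσ hη hm (half_pos hε)
  obtain ⟨B, hB0, hB⟩ := hσ.exists_bound
  refine ⟨2 * K, ν / 2, by positivity, by positivity, ?_⟩
  intro p θ t A S u w f hp hθ hθ2 hθε hθt ht hA hAp hS hf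
  rw [mul_div_cancel₀ ν two_ne_zero]
  set D : Space d → ℝ≥0∞ := fun x => ENNReal.ofReal
    ((1 + (2 * Real.pi * ‖x‖) ^ 2) * ‖(𝓕 (u 0) : L2 d) x‖ ^ 2 + ‖(𝓕 (w 0) : L2 d) x‖ ^ 2) with hD
  have hDm : Measurable D := measurable_ofReal_mul_norm_sq_add (by fun_prop) _ _
  have hdata := ofReal_shell_data_le hθ.le hθ2 hp hA hAp (hS (u 0)) (hS (w 0))
  -- the weight at the frequency representing the shell is smaller than that in the shell
  set r : ℝ := (T / Real.pi) * (2 * p + ε / 2) with hr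
  have hwt : ∀ x ∈ A, EReal.exp ((ν : EReal) * zeta η r) ≤
      EReal.exp ((ν : EReal) * zeta η ((T / Real.pi) * (2 * (2 * Real.pi * ‖x‖) + ε))) := by
    intro x hx
    refine EReal.exp_monotone (mul_le_mul_of_nonneg_left (hη.zeta_mono ?_) ?_)
    · have := (hAp x hx).1
      exact mul_le_mul_of_nonneg_left (by linarith) (by positivity)
    · exact EReal.coe_nonneg.2 hν.le
  have hint : EReal.exp ((ν : EReal) * zeta η r) * ∫⁻ x in A, D x ≤ ∫⁻ x in A,
      EReal.exp ((ν : EReal) * zeta η ((T / Real.pi) * (2 * (2 * Real.pi * ‖x‖) + ε))) * D x := by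
    rw [← lintegral_const_mul _ hDm]
    exact setLIntegral_mono' hA fun x hx => mul_le_mul_left (hwt x hx) _
  refine le_trans ?_ (mul_le_mul_right hint _)
  by_cases hz : zeta η r = ⊤
  · rw [hz, EReal.coe_mul_top_of_pos hν, EReal.exp_top]
    by_cases h0 : ∫⁻ x in A, D x = 0
    · rw [h0, mul_zero, nonpos_iff_eq_zero, ENNReal.ofReal_eq_zero] at hdata
      have hE := hf.energyPair hp hθ.le
      have h1 := hE.le_rpow_mul hB (by positivity) le_rfl ht hθt
      have h2 : ‖S (w 0)‖ ^ 2 + p ^ 2 * ‖S (u 0)‖ ^ 2 ≤ 0 := by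
        refine le_trans ?_ hdata
        nlinarith [sq_nonneg ‖S (u 0)‖]
      have h3 := h1.trans (mul_nonpos_of_nonneg_of_nonpos (by positivity) h2)
      rw [ENNReal.ofReal_eq_zero.2 h3]
      exact zero_le
    · rw [ENNReal.top_mul h0, ENNReal.mul_top]
      · exact le_top
      · have : 0 < 2 * K * (1 + t) ^ (-min 2 (mean σ₀ T)) := by positivity
        exact (ENNReal.ofReal_pos.2 this).ne'
  · obtain ⟨τ, hτ, hrτ, hζ⟩ := hη.exists_of_zeta_ne_top hz
    have h1 : 2 * p + ε / 2 ≤ Real.pi / T * d1 η τ := by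
      calc 2 * p + ε / 2 = Real.pi / T * r := by rw [hr]; field_simp
        _ ≤ _ := mul_le_mul_of_nonneg_left hrτ (by positivity)
    have h2 := hmain hf hp hθ.le hτ h1 ht hθt
    rw [hζ, ← EReal.coe_mul, EReal.exp_coe]
    refine (ENNReal.ofReal_le_ofReal h2).trans ?_
    rw [ENNReal.ofReal_mul (by positivity)]
    refine (mul_le_mul_right hdata _).trans_eq ?_
    rw [← mul_assoc, ← mul_assoc, ← ENNReal.ofReal_mul (by positivity),
      ← ENNReal.ofReal_mul (by positivity)]
    congr 2; ring

/-- Without decay the energy of a shell is bounded by that of the data, if the dissipation is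
non-negative. -/
lemma NonnegDissipative.shell_le (hn : NonnegDissipative σ₀) {p θ t : ℝ} {A : Set (Space d)}
    {S : L2 d →L[ℂ] L2 d} {u w f : ℝ → L2 d} (hp : 0 < p) (hθ : 0 < θ) (hθ2 : θ ≤ 1 / 2)
    (hθt : 6 * θ * t ≤ 1) (ht : 0 ≤ t) (hA : MeasurableSet A)
    (hAp : ∀ x ∈ A, 2 * Real.pi * ‖x‖ ∈ Icc (p - θ) p)
    (hS : ∀ v : L2 d, S v =ᵐ[volume] A.indicator (𝓕 v : L2 d))
    (hf : ShellSolution (dissipation σ₀ η) p θ (fun t => S (u t)) (fun t => S (w t)) f) :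
    ENNReal.ofReal (‖S (w t)‖ ^ 2 + p ^ 2 * ‖S (u t)‖ ^ 2) ≤
      ENNReal.ofReal (Real.exp 1 * 2) * ∫⁻ x in A,
        ENNReal.ofReal ((1 + (2 * Real.pi * ‖x‖) ^ 2) * ‖(𝓕 (u 0) : L2 d) x‖ ^ 2 +
          ‖(𝓕 (w 0) : L2 d) x‖ ^ 2) := by
  have h1 := (hf.energyPair hp hθ.le).le_mul_exp_of_nonneg
    (fun s hs => div_nonneg (hn _) (by linarith)) ht
  have h2 : ‖S (w t)‖ ^ 2 + p ^ 2 * ‖S (u t)‖ ^ 2 ≤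
      Real.exp 1 * ((1 + p ^ 2) * ‖S (u 0)‖ ^ 2 + ‖S (w 0)‖ ^ 2) := by
    refine h1.trans ?_
    rw [mul_comm]
    refine mul_le_mul (Real.exp_le_exp.2 hθt) ?_ (by positivity) (by positivity)
    nlinarith [sq_nonneg ‖S (u 0)‖]
  refine (ENNReal.ofReal_le_ofReal h2).trans ?_
  rw [ENNReal.ofReal_mul (by positivity), ENNReal.ofReal_mul (by positivity), mul_assoc]
  exact mul_le_mul_right (ofReal_shell_data_le hθ.le hθ2 hp hA hAp (hS (u 0)) (hS (w 0))) _

end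
end DissipativeWave

theorem mainTheorem2 (d : ℕ) (hd : 0 < d) (σ₀ η : ℝ → ℝ) (T : ℝ)
    (hA1 : DissipativeWave.PeriodicHolder σ₀ T)
    (hA2 : DissipativeWave.NonnegDissipative σ₀ ∨ DissipativeWave.NonEffectiveDissipative σ₀)
    (hA3 : DissipativeWave.AdmissiblePhase η) (ε : ℝ) (hε : 0 < ε) :
    ∃ C ν : ℝ, 0 < C ∧ 0 < ν ∧
      ∀ (u₀ u₁ : DissipativeWave.L2 d) (u : ℝ → DissipativeWave.L2 d)
        (g : ℝ → Fin d → DissipativeWave.L2 d) (w : ℝ → DissipativeWave.L2 d),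
        DissipativeWave.IsEnergySolution (DissipativeWave.dissipation σ₀ η) u₀ u₁ u g w →
        ∀ t : ℝ, 0 ≤ t →
          ENNReal.ofReal (DissipativeWave.energy g w t) ≤
            ENNReal.ofReal (C * (1 + t) ^ (-DissipativeWave.decayExponent σ₀ T)) *
              ∫⁻ ξ : DissipativeWave.Space d,
                EReal.exp (((2 * ν : ℝ) : EReal) *
                    DissipativeWave.zeta η ((T / Real.pi) * (2 * ‖ξ‖ + ε))) *
                  ENNReal.ofReal ((1 + ‖ξ‖ ^ 2) * ‖DissipativeWave.hat u₀ ξ‖ ^ 2 +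
                    ‖DissipativeWave.hat u₁ ξ‖ ^ 2) := by
  have hb := hA1.continuousOn_dissipation hA3
  -- for a given time the shells have to be thin compared with `1 / t`
  have hwidth : ∀ t : ℝ, 0 ≤ t → ∃ θ : ℝ, 0 < θ ∧ θ ≤ 1 / 2 ∧ 4 * θ ≤ ε ∧ 6 * θ * t ≤ 1 := by
    intro t ht
    refine ⟨min (1 / 2) (min (ε / 4) (1 / (6 * (t + 1)))), by positivity, min_le_left _ _, ?_, ?_⟩
    · linarith [(min_le_right (1 / 2) _).trans (min_le_left (ε / 4) (1 / (6 * (t + 1))))]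
    · have h1 := (min_le_right (1 / 2) _).trans (min_le_right (ε / 4) (1 / (6 * (t + 1))))
      rw [le_div_iff₀ (by positivity)] at h1
      have h0 : 0 < min (1 / 2) (min (ε / 4) (1 / (6 * (t + 1)))) := by positivity
      nlinarith
  rw [DissipativeWave.decayExponent_eq_min hA1 hA2]
  by_cases hm : 0 < DissipativeWave.mean σ₀ T
  · obtain ⟨C, ν, hC, hν, H⟩ := DissipativeWave.exists_weighted_shell_le (d := d) hA1 hA3 hm hε
    refine ⟨C, ν, hC, hν, fun u₀ u₁ u g w h t ht => ?_⟩
    obtain ⟨θ, hθ, hθ2, hθε, hθt⟩ := hwidth t ht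
    rw [DissipativeWave.hat_weighted_lintegral u₀ u₁ fun r => EReal.exp (((2 * ν : ℝ) : EReal) *
      DissipativeWave.zeta η ((T / Real.pi) * (2 * r + ε))), ← h.initial_position,
      ← h.initial_velocity]
    exact h.energy_le_of_shells hb hθ ht fun p A S f hp hA hAp hS hf =>
      H hp hθ hθ2 hθε hθt ht hA hAp hS hf
  · -- the mean can only vanish if the dissipation is non-negative, and then there is no decay
    have hn : DissipativeWave.NonnegDissipative σ₀ := hA2.resolve_right fun ⟨m, hm', hlim⟩ =>
      hm (by rw [hA1.mean_eq_of_tendsto hlim]; exact hm'.1)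
    have hm0 : DissipativeWave.mean σ₀ T = 0 := le_antisymm (not_lt.1 hm) (hn.mean_nonneg hA1)
    refine ⟨Real.exp 1 * 2, 1, by positivity, one_pos, fun u₀ u₁ u g w h t ht => ?_⟩
    obtain ⟨θ, hθ, hθ2, -, hθt⟩ := hwidth t ht
    rw [hm0, min_eq_right zero_le_two, neg_zero, Real.rpow_zero, mul_one,
      DissipativeWave.hat_weighted_lintegral u₀ u₁ fun r => EReal.exp (((2 * 1 : ℝ) : EReal) *
      DissipativeWave.zeta η ((T / Real.pi) * (2 * r + ε))), ← h.initial_position,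
      ← h.initial_velocity]
    refine (h.energy_le_of_shells hb hθ ht fun p A S f hp hA hAp hS hf =>
      hn.shell_le hp hθ hθ2 hθt ht hA hAp hS hf).trans ?_
    refine mul_le_mul_right (lintegral_mono fun x => le_mul_of_one_le_left zero_le ?_) _
    exact EReal.one_le_exp_iff.2 (mul_nonneg (EReal.coe_nonneg.2 (by norm_num))
      (DissipativeWave.AdmissiblePhase.zeta_nonneg _))
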